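/- Let $T>0$ and let $(\Omega,\mathscr F,\mathbb P)$ be a complete probability space carrying a $d$-dimensional standard Brownian motion $W$, with $\mathbb F=(\mathscr F_s)_{s\ge 0}$ the natural filtration of $W$ augmented by all $\mathbb P$-null sets. Let $b:[0,T]\times\mathbb R^m\to\mathbb R^m$ and $\sigma:[0,T]\to\mathbb R^{m\times d}$ be continuous, and suppose that for some constant $L>0$ and all $r\in[0,T]$, $x,x'\in\mathbb R^m$, $$|b(r,x)|+\sum_{j=1}^d|\sigma_j(r)|\le L,\qquad |b(r,x)-b(r,x')|\le L|x-x'|,$$ where $\sigma_j$ is the $j$-th column of $\sigma$. For $\varepsilon\in[0,1]$ and $(t,x)\in[0,T)\times\mathbb R^m$ consider the equation $$X^{\varepsilon,t,x}_s=x+\int_t^s b(r,X^{\varepsilon,t,x}_r)\,dr+\varepsilon\int_t^s\sigma(r)\,dW_r,\quad t\le s\le T,\qquad X^{\varepsilon,t,x}_s=x,\quad 0\le s\le t. \tag{1}$$ Let $S^2_{\mathbb F}(0,T;\mathbb R^m)$ be the space of continuous $\mathbb F$-adapted processes $X$ with $\mathbb E[\sup_{0\le s\le T}|X_s|^2]<\infty$,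 and let $D$ be the Malliavin derivative with domain $\mathbb D^{1,2}$, i.e. the closure, with respect to $\|\xi\|_{1,2}^2=\mathbb E[|\xi|^2+\int_0^T|D_r\xi|^2dr]$, of the operator $D_r\,\varphi(W(h^1),\dots,W(h^n))=\sum_{i}\partial_i\varphi(W(h^1),\dots,W(h^n))\,h^i_r$, where $\varphi\in C_b^\infty(\mathbb R^n)$, $h^i\in L^2([0,T];\mathbb R^d)$ and $W(h)=\int_0^Th_r\,dW_r$. Then: 1. For all $\varepsilon\in[0,1]$ and $(t,x)\in[0,T)\times\mathbb R^m$, equation (1) has a solution $X^{\varepsilon,t,x}\in S^2_{\mathbb F}(0,T;\mathbb R^m)$, unique up to indistinguishability. 2. There is a constant $K>0$, independent of $\varepsilon,t,x$ and $s$, such that for all $\varepsilon\in[0,1]$, $(t,x)\in[0,T)\times\mathbb R^m$ and $s\in[0,T]$ the components of $X^{\varepsilon,t,x}_s$ belong to $\mathbb D^{1,2}$ and $|D_rX^{\varepsilon,t,x}_s|\le K$ for $dr\otimes\mathbb P$-almost every $(r,\omega)\in[0,T]\times\Omega$ (Euclidean norm on $\mathbb R^{m\times d}$). 3. There is a constant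 $C>0$, independent of $t,t',x,x',\varepsilon,\varepsilon'$, such that for all $\varepsilon,\varepsilon'\in[0,1]$ and $(t,x),(t',x')\in[0,T)\times\mathbb R^m$, $$\mathbb E\Big[\sup_{0\le s\le T}\big|X^{\varepsilon,t,x}_s-X^{\varepsilon',t',x'}_s\big|^2\Big]\le C\big(|t-t'|+|\varepsilon-\varepsilon'|^2+|x-x'|^2\big).$$ -/

import Mathlib

open MeasureTheory ProbabilityTheory Set
open scoped NNReal ENNReal

noncomputable section

namespace SmallNoise

/-- `ℝⁿ` with the Euclidean norm. -/
abbrev E (n : ℕ) : Type := EuclideanSpace ℝ (Fin n)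

/-- `W` is a `d`-dimensional standard Brownian motion under `P`: its coordinates are independent
standard real Brownian motions. -/
structure IsBrownianMotion {Ω : Type*} [MeasurableSpace Ω] {d : ℕ}
    (W : ℝ≥0 → Ω → E d) (P : Measure Ω) : Prop where
  brownian : ∀ j : Fin d, IsBrownianReal (fun r ω => W r ω j) P
  indep : iIndepFun (fun (j : Fin d) (ω : Ω) (r : ℝ≥0) => W r ω j) P

/-- The σ-algebra at time `s` of the natural filtration of `W`, augmented by all `P`-null sets. -/
@[reducible] def augmentedFiltration {Ω : Type*} [MeasurableSpace Ω] {d : ℕ}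
    (W : ℝ≥0 → Ω → E d) (P : Measure Ω) (s : ℝ) : MeasurableSpace Ω :=
  (⨆ r : ℝ≥0, ⨆ _ : (r : ℝ) ≤ s, MeasurableSpace.comap (W r) inferInstance) ⊔
    MeasurableSpace.generateFrom {A : Set Ω | P A = 0}

/-- The step function `∑ⱼ cⱼ 1_{(uⱼ, vⱼ]}`. -/
def stepFun {d k : ℕ} (u v : Fin k → ℝ≥0) (c : Fin k → E d) (r : ℝ) : E d :=
  ∑ j, (Ioc (u j : ℝ) (v j : ℝ)).indicator (fun _ => c j) r

/-- The elementary stochastic integral `∑ⱼ ⟨cⱼ, W_{vⱼ} - W_{uⱼ}⟩` of a step function. -/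
def stepIntegral {Ω : Type*} {d k : ℕ} (W : ℝ≥0 → Ω → E d)
    (u v : Fin k → ℝ≥0) (c : Fin k → E d) (ω : Ω) : ℝ :=
  ∑ j, inner ℝ (c j) (W (v j) ω - W (u j) ω)

/-- `ξ` is (a version of) the Wiener integral `∫₀ᵀ h_r dW_r` of `h ∈ L²([0,T]; ℝᵈ)`: step functions
converge to `h` in `L²([0,T])` while their elementary integrals converge to `ξ` in `L²(P)`. -/
structure IsWienerIntegral {Ω : Type*} [MeasurableSpace Ω] {d : ℕ}
    (W : ℝ≥0 → Ω → E d) (P : Measure Ω) (T : ℝ) (h : ℝ → E d) (ξ : Ω → ℝ) : Prop where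
  memLp_integrand : MemLp h 2 (volume.restrict (Icc 0 T))
  memLp_integral : MemLp ξ 2 P
  approx : ∀ δ : ℝ≥0∞, 0 < δ → ∃ (k : ℕ) (u v : Fin k → ℝ≥0) (c : Fin k → E d),
    (∀ j, u j ≤ v j ∧ (v j : ℝ) ≤ T) ∧
    eLpNorm (fun r => h r - stepFun u v c r) 2 (volume.restrict (Icc 0 T)) ≤ δ ∧
    eLpNorm (fun ω => ξ ω - stepIntegral W u v c ω) 2 P ≤ δ

/-- `φ ∈ C_b^∞(ℝⁿ, ℝ)`: smooth, and bounded together with all its derivatives. -/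
def IsCbInfty {n : ℕ} (φ : (Fin n → ℝ) → ℝ) : Prop :=
  ContDiff ℝ ((⊤ : ℕ∞) : WithTop ℕ∞) φ ∧ ∀ k : ℕ, ∃ B : ℝ, ∀ y, ‖iteratedFDeriv ℝ k φ y‖ ≤ B

/-- `η = φ(W(h¹), …, W(hⁿ))` is a smooth random variable, with derivative process
`Dη_r = ∑ᵢ ∂ᵢφ(W(h¹), …, W(hⁿ)) hⁱ_r`. -/
def IsSmoothWithDeriv {Ω : Type*} [MeasurableSpace Ω] {d : ℕ}
    (W : ℝ≥0 → Ω → E d) (P : Measure Ω) (T : ℝ) (η : Ω → ℝ) (Dη : ℝ → Ω → E d) : Prop :=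
  ∃ (n : ℕ) (φ : (Fin n → ℝ) → ℝ) (h : Fin n → ℝ → E d) (w : Fin n → Ω → ℝ),
    IsCbInfty φ ∧ (∀ i, IsWienerIntegral W P T (h i) (w i)) ∧
    (∀ ω, η ω = φ (fun i => w i ω)) ∧
    ∀ r ω, Dη r ω = ∑ i, fderiv ℝ φ (fun i' => w i' ω) (Pi.single i 1) • h i r

/-- `ξ ∈ 𝔻^{1,2}` with Malliavin derivative `D`: the pair `(ξ, D)` lies in the closure of the graph
of the derivative on smooth random variables, for the norm of `L²(P) × L²([0,T] × Ω)`. -/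
structure HasMalliavinDeriv {Ω : Type*} [MeasurableSpace Ω] {d : ℕ}
    (W : ℝ≥0 → Ω → E d) (P : Measure Ω) (T : ℝ) (ξ : Ω → ℝ) (D : ℝ → Ω → E d) : Prop where
  memLp : MemLp ξ 2 P
  memLp_deriv : MemLp (fun p : ℝ × Ω => D p.1 p.2) 2 ((volume.restrict (Icc 0 T)).prod P)
  approx : ∀ δ : ℝ≥0∞, 0 < δ → ∃ (η : Ω → ℝ) (Dη : ℝ → Ω → E d),
    IsSmoothWithDeriv W P T η Dη ∧
    eLpNorm (fun ω => ξ ω - η ω) 2 P ≤ δ ∧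
    eLpNorm (fun p : ℝ × Ω => D p.1 p.2 - Dη p.1 p.2) 2
      ((volume.restrict (Icc 0 T)).prod P) ≤ δ

/-- The standing assumption on the coefficients `b : [0,T] × ℝᵐ → ℝᵐ`, `σ : [0,T] → ℝ^{m×d}`, with
constant `L` (Borel measurability on these domains is implied by continuity). The values of
`b` and `σ` at times outside `[0,T]` play no role. -/
structure CoeffAssumption {m d : ℕ} (T L : ℝ)
    (b : ℝ → E m → E m) (σ : ℝ → Matrix (Fin m) (Fin d) ℝ) : Prop where
  L_pos : 0 < L
  continuous_b : ContinuousOn (fun p : ℝ × E m => b p.1 p.2) (Icc 0 T ×ˢ univ)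
  continuous_σ : ContinuousOn σ (Icc 0 T)
  bound : ∀ r ∈ Icc 0 T, ∀ x : E m,
    ‖b r x‖ + ∑ j : Fin d, ‖(WithLp.toLp 2 (fun i => σ r i j) : E m)‖ ≤ L
  lipschitz : ∀ r ∈ Icc 0 T, ∀ x x' : E m, ‖b r x - b r x'‖ ≤ L * ‖x - x'‖

/-- `X ∈ S²(0,T; ℝᵐ)`: adapted to the augmented Brownian filtration, with (a.s.) continuous paths
and `𝔼[sup_{s ∈ [0,T]} |X_s|²] < ∞`. -/
structure MemS2 {Ω : Type*} [MeasurableSpace Ω] {m d : ℕ}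
    (W : ℝ≥0 → Ω → E d) (P : Measure Ω) (T : ℝ) (X : ℝ → Ω → E m) : Prop where
  adapted : ∀ s ∈ Icc 0 T, Measurable[augmentedFiltration W P s] (X s)
  continuous_paths : ∀ᵐ ω ∂P, ContinuousOn (fun s => X s ω) (Icc 0 T)
  sup_lt_top : ∫⁻ ω, ⨆ s ∈ Icc 0 T, ‖X s ω‖ₑ ^ 2 ∂P < ∞

/-- `M` is the (continuous version of the) process `s ↦ ∫ₜˢ σ(r) dW_r`, `s ∈ [t,T]`: coordinate `i`
of `M_s` is the Wiener integral of the `i`-th row of `σ` over `(t,s]`. -/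
structure IsNoiseIntegral {Ω : Type*} [MeasurableSpace Ω] {m d : ℕ}
    (W : ℝ≥0 → Ω → E d) (P : Measure Ω) (T : ℝ) (σ : ℝ → Matrix (Fin m) (Fin d) ℝ)
    (t : ℝ) (M : ℝ → Ω → E m) : Prop where
  integral : ∀ s ∈ Icc t T, ∀ i : Fin m, IsWienerIntegral W P T
    ((Ioc t s).indicator (fun r => (WithLp.toLp 2 (σ r i) : E d))) (fun ω => M s ω i)
  continuous_paths : ∀ᵐ ω ∂P, ContinuousOn (fun s => M s ω) (Icc t T)

/-- `X ∈ S²(0,T; ℝᵐ)` solves `X_s = x + ∫ₜˢ b(r, X_r) dr + ε ∫ₜˢ σ(r) dW_r` for `t ≤ s ≤ T`, with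
the convention `X_s = x` for `0 ≤ s ≤ t`. -/
structure IsSolution {Ω : Type*} [MeasurableSpace Ω] {m d : ℕ}
    (W : ℝ≥0 → Ω → E d) (P : Measure Ω) (T : ℝ)
    (b : ℝ → E m → E m) (σ : ℝ → Matrix (Fin m) (Fin d) ℝ)
    (ε t : ℝ) (x : E m) (X : ℝ → Ω → E m) : Prop where
  memS2 : MemS2 W P T X
  before : ∀ᵐ ω ∂P, ∀ s ∈ Icc 0 t, X s ω = x
  equation : ∃ M : ℝ → Ω → E m, IsNoiseIntegral W P T σ t M ∧
    ∀ᵐ ω ∂P, ∀ s ∈ Icc t T, X s ω = x + (∫ r in t..s, b r (X r ω)) + ε • M s ω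

end SmallNoise

end

/-! Since σ does not depend on the state, the noise is additive and the equation can be solved path
by path. If Z is a continuous version of s ↦ ∫₀ˢ σ dW, then a solution is, for almost every ω, a
solution of y_s = ∫ₜˢ b(r, y_r) dr + w_s with the continuous driver w = x + ε(Z − Z_t).
Picard–Lindelöf for y − w gives existence (`exists_isPathSolution`). Grönwall shows that the
terminal value is Lipschitz in the driver for the sup norm, with constant at most e^{LT}
(`IsPathSolution.norm_sub_le`), which contains uniqueness.

The process Z comes from `exists_wienerIntegralProcess`: σ is approximated uniformly by step
functions, and the isometry together with Doob's L² inequality (`integral_sq_partialSups_le`) makes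
the elementary integrals converge uniformly in time, almost surely. The same inequality bounds E sup
|Z − Z_a|² over [a, c] by a multiple of c − a. Wiener integrals are almost surely unique, so the
noise term of every solution is an increment of this one Z. The stability estimate then follows by
comparing two drivers on one path: the earlier solution is restarted at the later initial time, and
the noise on the intermediate interval accounts for |t − t'| to the first power.

For the Malliavin derivative, b is only Lipschitz, so the flow is not differentiated. Instead the
driver is replaced by the Bernstein interpolation of its values on a grid. The resulting
`gridSolution` is a function of finitely many Wiener integrals, and it is e^{LT}-Lipschitz for the
maximum norm over the grid, however fine the grid is. Cutting off and mollifying gives smooth random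
variables whose derivatives at time r are bounded by (2e^{LT} + 1) ∑ⱼ |σⱼ(r)|. They converge to X_s
in L², while their derivatives are merely bounded. Weak compactness closes this gap, in the form of
a minimal-norm argument on convex sets (`exists_mem_closure_of_convex`), and the pointwise bound
survives in the limit (`exists_hasMalliavinDeriv_of_approx`). -/

noncomputable section

namespace SmallNoise

open Filter Topology

set_option linter.unusedSectionVars false

/-! ### Doob's L² inequality in discrete time -/

section Doob

/-- A pathwise form of Doob's `L²` inequality. -/
lemma sq_partialSups_le (s : ℕ → ℝ) (n : ℕ) :
    (partialSups s n) ^ 2 ≤ 4 * s n ^ 2 -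
      4 * ∑ k ∈ Finset.range n, partialSups s k * (s (k + 1) - s k) := by
  -- Induction on a sharper bound: a step that keeps the running maximum leaves both sides
  -- unchanged, and one raising it from M to M' gains (M' − M)²/2. Completing the square (M − 2sₙ)²
  -- ≥ 0 then gives the claim.
  have key : (partialSups s n) ^ 2 / 2 ≤ partialSups s n * s n -
      ∑ k ∈ Finset.range n, partialSups s k * (s (k + 1) - s k) := by
    induction n with
    | zero => simp; nlinarith [sq_nonneg (s 0)]
    | succ n ih =>
      rw [Finset.sum_range_succ]
      have h1 : partialSups s (n + 1) = max (partialSups s n) (s (n + 1)) := partialSups_succ s n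
      rcases le_total (s (n + 1)) (partialSups s n) with h | h
      · rw [h1, max_eq_left h]
        nlinarith
      · rw [h1, max_eq_right h]
        nlinarith [sq_nonneg (s (n + 1) - partialSups s n)]
  nlinarith [sq_nonneg (partialSups s n - 2 * s n)]

lemma partialSups_nat_succ (s : ℕ → ℝ) (n : ℕ) :
    partialSups s (n + 1) = max (partialSups s n) (s (n + 1)) :=
  partialSups_succ s n

lemma measurable_sign : Measurable (fun x : ℝ => ((SignType.sign x : SignType) : ℝ)) := by
  have : (fun x : ℝ => ((SignType.sign x : SignType) : ℝ)) =
      fun x => if 0 < x then (1 : ℝ) else if x < 0 then -1 else 0 := by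
    ext x; simp only [sign_apply]; split_ifs <;> simp
  rw [this]
  exact Measurable.ite measurableSet_Ioi measurable_const
    (Measurable.ite measurableSet_Iio measurable_const measurable_const)

lemma partialSups_le_sum (s : ℕ → ℝ) (hs : ∀ k, 0 ≤ s k) (n : ℕ) :
    partialSups s n ≤ ∑ k ∈ Finset.range (n + 1), s k :=
  partialSups_le _ _ _ fun j hj =>
    Finset.single_le_sum (f := s) (fun i _ => hs i) (Finset.mem_range.2 (by lia))

variable {Ω : Type*} [MeasurableSpace Ω] {P : Measure Ω} [IsProbabilityMeasure P]

/-- Doob's `L²` inequality for sequences with independent centered increments. -/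
lemma integral_sq_partialSups_le (S : ℕ → Ω → ℝ) (hS : ∀ k, MemLp (S k) 2 P)
    (hmean : ∀ k, ∫ ω, S (k + 1) ω - S k ω ∂P = 0)
    (hind : ∀ k, IndepFun (fun ω (i : Iic k) => S i ω) (fun ω => S (k + 1) ω - S k ω) P) (n : ℕ) :
    ∫⁻ ω, ENNReal.ofReal ((partialSups (fun k => |S k ω|) n) ^ 2) ∂P ≤
      4 * ∫⁻ ω, ENNReal.ofReal (S n ω ^ 2) ∂P := by
  have habs : ∀ k, MemLp (fun ω => |S k ω|) 2 P := fun k => (hS k).abs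
  have hmeas : ∀ k, AEStronglyMeasurable (fun ω => partialSups (fun k => |S k ω|) k) P := by
    intro k
    induction k with
    | zero => simpa using (habs 0).1
    | succ k ih =>
      simp_rw [partialSups_nat_succ]
      exact ih.sup (habs (k + 1)).1
  have hnn : ∀ k ω, 0 ≤ partialSups (fun k => |S k ω|) k := fun k ω =>
    (abs_nonneg (S k ω)).trans (le_partialSups (fun k => |S k ω|) k)
  have hsup : ∀ k, MemLp (fun ω => partialSups (fun k => |S k ω|) k) 2 P := by
    intro k
    have hsum : MemLp (fun ω => ∑ i ∈ Finset.range (k + 1), |S i ω|) 2 P :=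
      memLp_finsetSum (Finset.range (k + 1)) fun i _ => habs i
    refine MemLp.mono hsum (hmeas k) ?_
    refine ae_of_all _ fun ω => ?_
    rw [Real.norm_of_nonneg (hnn k ω),
      Real.norm_of_nonneg (Finset.sum_nonneg fun i _ => abs_nonneg _)]
    exact partialSups_le_sum _ (fun i => abs_nonneg _) k
  -- Convexity, |y| − |x| ≥ sign(x)(y − x), trades the increments of |S| for those of S. The weight
  -- `g k` depends only on the past, so each product has mean zero.
  set g : ℕ → Ω → ℝ := fun k ω => partialSups (fun k => |S k ω|) k * SignType.sign (S k ω) with hg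
  have hgind : ∀ k, IndepFun (g k) (fun ω => S (k + 1) ω - S k ω) P := by
    intro k
    -- `min i k` extends the past y to a sequence on ℕ; only indices i ≤ k enter the maximum.
    let φ : (Iic k → ℝ) → ℝ := fun y =>
      partialSups (fun i => |y ⟨min i k, mem_Iic.2 (min_le_right i k)⟩|) k *
        SignType.sign (y ⟨k, le_refl k⟩)
    have hφ : Measurable φ := by
      refine Measurable.mul ?_ (measurable_sign.comp (measurable_pi_apply _))
      have : ∀ j, Measurable fun y : Iic k → ℝ =>
          partialSups (fun i => |y ⟨min i k, mem_Iic.2 (min_le_right i k)⟩|) j := by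
        intro j
        induction j with
        | zero => simp; exact (measurable_pi_apply _).abs
        | succ j ih =>
          simp_rw [partialSups_nat_succ]
          exact ih.sup ((measurable_pi_apply _).abs)
      exact this k
    have hcomp : g k = φ ∘ (fun ω (i : Iic k) => S i ω) := by
      ext ω
      simp only [hg, φ, Function.comp]
      congr 1
      rw [partialSups_apply, partialSups_apply]
      refine Finset.sup'_congr _ rfl fun i hi => ?_
      rw [Finset.mem_Iic] at hi
      simp [hi]
    rw [hcomp]
    exact (hind k).comp hφ measurable_id
  have hgmeas : ∀ k, AEStronglyMeasurable (g k) P := by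
    intro k
    refine (hmeas k).mul ?_
    exact (measurable_sign.comp_aemeasurable (hS k).1.aemeasurable).aestronglyMeasurable
  have hgL : ∀ k, MemLp (g k) 2 P := fun k => by
    refine MemLp.mono (hsup k) (hgmeas k) (ae_of_all _ fun ω => ?_)
    simp only [hg, norm_mul]
    refine mul_le_of_le_one_right (norm_nonneg _) ?_
    cases SignType.sign (S k ω) <;> simp
  have hinc : ∀ k, MemLp (fun ω => S (k + 1) ω - S k ω) 2 P := fun k => (hS (k + 1)).sub (hS k)
  have hzero : ∀ k, ∫ ω, g k ω * (S (k + 1) ω - S k ω) ∂P = 0 := fun k => by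
    rw [(hgind k).integral_fun_mul_eq_mul_integral (hgmeas k) (hinc k).1, hmean k, mul_zero]
  have hint : ∀ k, Integrable (fun ω => g k ω * (S (k + 1) ω - S k ω)) P := fun k =>
    (hgL k).integrable_mul (hinc k)
  have hpath : ∀ ω, (partialSups (fun k => |S k ω|) n) ^ 2 ≤ 4 * S n ω ^ 2 -
      4 * ∑ k ∈ Finset.range n, g k ω * (S (k + 1) ω - S k ω) := by
    intro ω
    refine (sq_partialSups_le (fun k => |S k ω|) n).trans ?_
    rw [sq_abs]
    refine sub_le_sub_left (mul_le_mul_of_nonneg_left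
      (Finset.sum_le_sum fun k _ => ?_) (by norm_num)) _
    simp only [hg, mul_assoc]
    refine mul_le_mul_of_nonneg_left ?_ (hnn k ω)
    rw [mul_sub, sign_mul_self]
    gcongr
    rcases lt_trichotomy (S k ω) 0 with h | h | h
    · simp [sign_neg h]; exact neg_le_abs _
    · simp [h]
    · simp [sign_pos h]; exact le_abs_self _
  have hI1 : Integrable (fun ω => (partialSups (fun k => |S k ω|) n) ^ 2) P :=
    (hsup n).integrable_sq
  have hI2 : Integrable (fun ω => S n ω ^ 2) P := (hS n).integrable_sq
  rw [← ofReal_integral_eq_lintegral_ofReal hI1 (ae_of_all _ fun _ => sq_nonneg _),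
    ← ofReal_integral_eq_lintegral_ofReal hI2 (ae_of_all _ fun _ => sq_nonneg _),
    show (4 : ℝ≥0∞) = ENNReal.ofReal 4 by simp, ← ENNReal.ofReal_mul (by norm_num)]
  refine ENNReal.ofReal_le_ofReal ?_
  have hI3 : Integrable (fun ω => ∑ k ∈ Finset.range n, g k ω * (S (k + 1) ω - S k ω)) P :=
    integrable_finsetSum _ fun k _ => hint k
  calc _ ≤ ∫ ω, 4 * S n ω ^ 2 -
      4 * ∑ k ∈ Finset.range n, g k ω * (S (k + 1) ω - S k ω) ∂P :=
        integral_mono hI1 ((hI2.const_mul 4).sub (hI3.const_mul 4)) hpath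
    _ = _ := by
      rw [integral_sub (hI2.const_mul 4) (hI3.const_mul 4), integral_const_mul, integral_const_mul,
        integral_finsetSum _ fun k _ => hint k]
      simp [hzero]

end Doob

/-! ### The isometry for step functions, real case -/

section ScalarBrownian

variable {Ω : Type*} [MeasurableSpace Ω] {P : Measure Ω} [IsProbabilityMeasure P]
  {B : ℝ≥0 → Ω → ℝ}

lemma memLp_brownian (hB : IsPreBrownianReal B P) (t : ℝ≥0) : MemLp (B t) 2 P :=
  (hB.isGaussianProcess.hasGaussianLaw_eval t).memLp_two

lemma integral_brownian_mul (hB : IsPreBrownianReal B P) (s t : ℝ≥0) :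
    ∫ ω, B s ω * B t ω ∂P = min s t := by
  have h := hB.covariance_eval s t
  rw [covariance_eq_sub (memLp_brownian hB s) (memLp_brownian hB t)] at h
  simpa [hB.integral_eval] using h

/-- Bilinearity reduces this to the covariance min(s, t); both sides are the length of the overlap
of the two intervals. -/
lemma integral_increment_mul (hB : IsPreBrownianReal B P) {u v u' v' : ℝ≥0}
    (h : u ≤ v) (h' : u' ≤ v') :
    ∫ ω, (B v ω - B u ω) * (B v' ω - B u' ω) ∂P =
      ∫ r : ℝ, (Ioc (u : ℝ) v).indicator (fun _ => (1 : ℝ)) r *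
        (Ioc (u' : ℝ) v').indicator (fun _ => (1 : ℝ)) r := by
  have hi : ∀ s t, Integrable (fun ω => B s ω * B t ω) P := fun s t =>
    (memLp_brownian hB s).integrable_mul (memLp_brownian hB t)
  have e1 : ∀ ω, (B v ω - B u ω) * (B v' ω - B u' ω) =
      B v ω * B v' ω - B v ω * B u' ω - (B u ω * B v' ω - B u ω * B u' ω) := fun ω => by ring
  simp_rw [e1]
  have hs : ∀ s t s' t', Integrable (fun ω => B s ω * B t ω - B s' ω * B t' ω) P :=
    fun s t s' t' => (hi s t).sub (hi s' t')
  rw [integral_sub (hs _ _ _ _) (hs _ _ _ _), integral_sub (hi _ _) (hi _ _),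
    integral_sub (hi _ _) (hi _ _)]
  simp_rw [integral_brownian_mul hB]
  have e2 : ∀ r : ℝ, (Ioc (u : ℝ) v).indicator (fun _ => (1 : ℝ)) r *
        (Ioc (u' : ℝ) v').indicator (fun _ => (1 : ℝ)) r =
      (Ioc (max u u' : ℝ) (min v v' : ℝ)).indicator (fun _ => (1 : ℝ)) r := by
    intro r
    rw [← Set.Ioc_inter_Ioc]
    simp only [indicator_apply, mem_inter_iff]
    split_ifs <;> simp_all
  simp_rw [e2]
  rw [integral_indicator measurableSet_Ioc, setIntegral_const]
  have hu : (u : ℝ) ≤ v := h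
  have hu' : (u' : ℝ) ≤ v' := h'
  simp only [smul_eq_mul, mul_one, Measure.real, Real.volume_Ioc, ENNReal.toReal_ofReal',
    NNReal.coe_min]
  grind

variable {k : ℕ}

/-- `∑ⱼ cⱼ 1_{(uⱼ, vⱼ]}` for real coefficients. -/
def realStep (u v : Fin k → ℝ≥0) (c : Fin k → ℝ) (r : ℝ) : ℝ :=
  ∑ j, c j * (Ioc (u j : ℝ) (v j : ℝ)).indicator (fun _ => 1) r

/-- `∑ⱼ cⱼ (B_{vⱼ} - B_{uⱼ})`. -/
def realStepIntegral (B : ℝ≥0 → Ω → ℝ) (u v : Fin k → ℝ≥0) (c : Fin k → ℝ) (ω : Ω) : ℝ :=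
  ∑ j, c j * (B (v j) ω - B (u j) ω)

lemma memLp_realStepIntegral (hB : IsPreBrownianReal B P) (u v : Fin k → ℝ≥0) (c : Fin k → ℝ) :
    MemLp (realStepIntegral B u v c) 2 P :=
  memLp_finsetSum _ fun _ _ => ((memLp_brownian hB _).sub (memLp_brownian hB _)).const_mul _

lemma integral_realStepIntegral (hB : IsPreBrownianReal B P) (u v : Fin k → ℝ≥0)
    (c : Fin k → ℝ) : ∫ ω, realStepIntegral B u v c ω ∂P = 0 := by
  unfold realStepIntegral
  have h : ∀ j, Integrable (fun ω => B (v j) ω - B (u j) ω) P := fun j =>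
    (hB.integrable_eval _).sub (hB.integrable_eval _)
  rw [integral_finsetSum _ fun j _ => (h j).const_mul (c j)]
  refine Finset.sum_eq_zero fun j _ => ?_
  rw [integral_const_mul, integral_sub (hB.integrable_eval _) (hB.integrable_eval _),
    hB.integral_eval, hB.integral_eval]
  simp

lemma integrable_indicator_Ioc_mul (a b a' b' : ℝ) :
    Integrable (fun r : ℝ => (Ioc a b).indicator (fun _ => (1 : ℝ)) r *
      (Ioc a' b').indicator (fun _ => (1 : ℝ)) r) := by
  have : (fun r : ℝ => (Ioc a b).indicator (fun _ => (1 : ℝ)) r *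
      (Ioc a' b').indicator (fun _ => (1 : ℝ)) r) =
      (Ioc a b ∩ Ioc a' b').indicator (fun _ => (1 : ℝ)) := by
    ext r; simp only [indicator_apply, mem_inter_iff]; split_ifs <;> simp_all
  rw [this]
  rw [integrable_indicator_iff (measurableSet_Ioc.inter measurableSet_Ioc)]
  exact integrableOn_const ((measure_mono inter_subset_left).trans_lt measure_Ioc_lt_top).ne

/-- Both squares expand into double sums that agree term by term. The intervals may overlap, so no
common refinement is needed. -/
lemma integral_sq_realStepIntegral (hB : IsPreBrownianReal B P) {u v : Fin k → ℝ≥0}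
    (huv : ∀ j, u j ≤ v j) (c : Fin k → ℝ) :
    ∫ ω, realStepIntegral B u v c ω ^ 2 ∂P = ∫ r, realStep u v c r ^ 2 := by
  have e1 : ∀ ω, realStepIntegral B u v c ω ^ 2 =
      ∑ i, ∑ j, (c i * c j) * ((B (v i) ω - B (u i) ω) * (B (v j) ω - B (u j) ω)) := fun ω => by
    rw [sq, realStepIntegral, Finset.sum_mul_sum]
    exact Finset.sum_congr rfl fun i _ => Finset.sum_congr rfl fun j _ => by ring
  have e2 : ∀ r, realStep u v c r ^ 2 =
      ∑ i, ∑ j, (c i * c j) * ((Ioc (u i : ℝ) (v i : ℝ)).indicator (fun _ => 1) r *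
        (Ioc (u j : ℝ) (v j : ℝ)).indicator (fun _ => 1) r) := fun ω => by
    rw [sq, realStep, Finset.sum_mul_sum]
    exact Finset.sum_congr rfl fun i _ => Finset.sum_congr rfl fun j _ => by ring
  have h1 : ∀ i j, Integrable (fun ω => (c i * c j) *
      ((B (v i) ω - B (u i) ω) * (B (v j) ω - B (u j) ω))) P := fun i j =>
    (((memLp_brownian hB _).sub (memLp_brownian hB _)).integrable_mul
      ((memLp_brownian hB _).sub (memLp_brownian hB _))).const_mul _
  have h2 : ∀ i j, Integrable (fun r : ℝ => (c i * c j) *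
      ((Ioc (u i : ℝ) (v i : ℝ)).indicator (fun _ => 1) r *
        (Ioc (u j : ℝ) (v j : ℝ)).indicator (fun _ => 1) r)) := fun i j =>
    (integrable_indicator_Ioc_mul _ _ _ _).const_mul _
  simp_rw [e1, e2]
  rw [integral_finsetSum _ fun i _ => integrable_finsetSum _ fun j _ => h1 i j,
    integral_finsetSum _ fun i _ => integrable_finsetSum _ fun j _ => h2 i j]
  refine Finset.sum_congr rfl fun i _ => ?_
  rw [integral_finsetSum _ fun j _ => h1 i j, integral_finsetSum _ fun j _ => h2 i j]
  refine Finset.sum_congr rfl fun j _ => ?_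
  rw [integral_const_mul, integral_const_mul, integral_increment_mul hB (huv i) (huv j)]

end ScalarBrownian

/-! ### Truncation of times to an interval -/

/-- The point of `[a, s]` closest to `x`. -/
def clamp (a s x : ℝ≥0) : ℝ≥0 := max a (min x s)

lemma clamp_mono {a s x y : ℝ≥0} (h : x ≤ y) : clamp a s x ≤ clamp a s y := by
  unfold clamp; gcongr

lemma clamp_le {a s x : ℝ≥0} (h : a ≤ s) : clamp a s x ≤ s := by simp [clamp, h]

lemma le_clamp {a s x : ℝ≥0} : a ≤ clamp a s x := by simp [clamp]

lemma continuous_clamp (a x : ℝ≥0) : Continuous fun s => clamp a s x := by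
  unfold clamp; fun_prop

/-- For x ≤ s, moving the right end past s changes nothing; for x ≥ s, the clamp at s is s itself.
This makes truncated integrals additive in time. -/
lemma clamp_increment {G : Type*} [AddCommGroup G] (f : ℝ≥0 → G) {a s s' : ℝ≥0} (h : a ≤ s)
    (h' : s ≤ s') (x : ℝ≥0) : f (clamp a s' x) - f (clamp a s x) = f (clamp s s' x) - f s := by
  rcases le_total x s with hx | hx
  · have : clamp a s' x = clamp a s x := by simp [clamp, hx, hx.trans h']
    have h2 : clamp s s' x = s := by simp [clamp, hx]
    rw [this, h2, sub_self, sub_self]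
  · have h1 : clamp a s x = s := by simp [clamp, hx, h]
    have h2 : clamp a s' x = clamp s s' x := by
      simp [clamp, h.trans hx, h.trans h', hx, h']
    rw [h1, h2]

/-- Restricting a step function to (a, b] thus yields a step function again, with the same
coefficients. -/
lemma Ioc_clamp (a b u v : ℝ≥0) :
    Ioc (clamp a b u : ℝ) (clamp a b v : ℝ) = Ioc (a : ℝ) b ∩ Ioc (u : ℝ) v := by
  ext r
  simp only [clamp, mem_Ioc, mem_inter_iff, NNReal.coe_max, NNReal.coe_min]
  grind

/-! ### Maximal inequality for elementary integrals, real case -/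

section Scalar

variable {Ω : Type*} [MeasurableSpace Ω] {P : Measure Ω} [IsProbabilityMeasure P]
  {B : ℝ≥0 → Ω → ℝ} {k : ℕ}

lemma realStep_clamp (a b : ℝ≥0) (u v : Fin k → ℝ≥0) (c : Fin k → ℝ) :
    realStep (fun j => clamp a b (u j)) (fun j => clamp a b (v j)) c =
      (Ioc (a : ℝ) b).indicator (realStep u v c) := by
  ext r
  simp only [realStep, Ioc_clamp, indicator_apply, mem_inter_iff]
  split_ifs with h <;> simp [h]

/-- The process `s ↦ ∑ⱼ cⱼ (B_{vⱼ} - B_{uⱼ})` with all times moved into `[a, s]`. -/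
def realElementaryIntegral (B : ℝ≥0 → Ω → ℝ) (u v : Fin k → ℝ≥0) (c : Fin k → ℝ)
    (a s : ℝ≥0) (ω : Ω) : ℝ :=
  realStepIntegral B (fun j => clamp a s (u j)) (fun j => clamp a s (v j)) c ω

lemma realElementaryIntegral_sub (B : ℝ≥0 → Ω → ℝ) (u v : Fin k → ℝ≥0) (c : Fin k → ℝ)
    {a s s' : ℝ≥0}
    (h : a ≤ s) (h' : s ≤ s') (ω : Ω) :
    realElementaryIntegral B u v c a s' ω - realElementaryIntegral B u v c a s ω =
      realElementaryIntegral B u v c s s' ω := by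
  simp only [realElementaryIntegral, realStepIntegral, ← Finset.sum_sub_distrib, ← mul_sub]
  refine Finset.sum_congr rfl fun j _ => ?_
  congr 1
  have h1 := clamp_increment (fun t => B t ω) h h' (v j)
  have h2 := clamp_increment (fun t => B t ω) h h' (u j)
  linear_combination h1 - h2

/-- The past values are a measurable function of B on [0, σₙ] and the increment is one of the
shifted process B_{σₙ+·} − B_{σₙ}, so the Markov property applies. -/
lemma indepFun_realElementaryIntegral (hB : IsPreBrownianReal B P) (u v : Fin k → ℝ≥0)
    (c : Fin k → ℝ)
    {a : ℝ≥0} {σ : ℕ → ℝ≥0} (hσ : Monotone σ) (ha : ∀ n, a ≤ σ n) (n : ℕ) :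
    IndepFun (fun ω (i : Iic n) => realElementaryIntegral B u v c a (σ i) ω)
      (fun ω => realElementaryIntegral B u v c a (σ (n + 1)) ω -
        realElementaryIntegral B u v c a (σ n) ω) P := by
  have key := (hB.indepFun_shift (σ n)).symm
  let φ : (ℝ≥0 → ℝ) → ℝ := fun y => ∑ j, c j *
    (y (clamp (σ n) (σ (n + 1)) (v j) - σ n) - y (clamp (σ n) (σ (n + 1)) (u j) - σ n))
  have hφ : Measurable φ := by fun_prop
  have hm : ∀ (i : Iic n) x, clamp a (σ i) x ∈ Iic (σ n) := fun i x =>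
    (clamp_le (ha i)).trans (hσ i.2)
  let ψ : (Iic (σ n) → ℝ) → (Iic n → ℝ) := fun y i => ∑ j, c j *
    (y ⟨_, hm i (v j)⟩ - y ⟨_, hm i (u j)⟩)
  have hψ : Measurable ψ := by fun_prop
  have := key.comp hψ hφ
  have e : (fun ω => realElementaryIntegral B u v c a (σ (n + 1)) ω -
      realElementaryIntegral B u v c a (σ n) ω) =
      φ ∘ fun ω t => B (σ n + t) ω - B (σ n) ω := by
    ext ω
    rw [realElementaryIntegral_sub B u v c (ha n) (hσ n.le_succ)]
    simp only [realElementaryIntegral, realStepIntegral, φ, Function.comp]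
    refine Finset.sum_congr rfl fun j _ => ?_
    rw [add_tsub_cancel_of_le le_clamp, add_tsub_cancel_of_le le_clamp]
    ring
  rw [e]
  exact this

lemma aemeasurable_partialSups {S : ℕ → Ω → ℝ} (hS : ∀ k, AEMeasurable (S k) P) (n : ℕ) :
    AEMeasurable (fun ω => partialSups (fun k => S k ω) n) P := by
  induction n with
  | zero => simpa using hS 0
  | succ n ih =>
    simp_rw [partialSups_nat_succ]
    exact ih.sup (hS _)

lemma aemeasurable_liminf {G : ℕ → Ω → ℝ≥0∞} (hG : ∀ n, AEMeasurable (G n) P) :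
    AEMeasurable (fun ω => liminf (fun n => G n ω) atTop) P := by
  refine ⟨fun ω => liminf (fun n => (hG n).mk _ ω) atTop,
    Measurable.liminf fun n => (hG n).measurable_mk, ?_⟩
  filter_upwards [ae_all_iff.2 fun n => (hG n).ae_eq_mk] with ω hω
  simp_rw [hω]

lemma continuous_realElementaryIntegral (u v : Fin k → ℝ≥0) (c : Fin k → ℝ) (a : ℝ≥0) {ω : Ω}
    (hω : Continuous fun t => B t ω) :
    Continuous fun s => realElementaryIntegral B u v c a s ω := by
  unfold realElementaryIntegral realStepIntegral
  exact continuous_finsetSum _ fun j _ => continuous_const.mul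
    ((hω.comp (continuous_clamp a (v j))).sub (hω.comp (continuous_clamp a (u j))))

/-- The isometry for step functions, in extended nonnegative form. -/
lemma lintegral_sq_realStepIntegral (hB : IsPreBrownianReal B P) {u v : Fin k → ℝ≥0}
    (huv : ∀ j, u j ≤ v j) (c : Fin k → ℝ) :
    ∫⁻ ω, ENNReal.ofReal (realStepIntegral B u v c ω ^ 2) ∂P =
      ∫⁻ r, ENNReal.ofReal (realStep u v c r ^ 2) := by
  have h2 : Integrable (fun r => realStep u v c r ^ 2) := by
    have e2 : ∀ r, realStep u v c r ^ 2 =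
        ∑ i, ∑ j, (c i * c j) * ((Ioc (u i : ℝ) (v i : ℝ)).indicator (fun _ => 1) r *
          (Ioc (u j : ℝ) (v j : ℝ)).indicator (fun _ => 1) r) := fun ω => by
      rw [sq, realStep, Finset.sum_mul_sum]
      exact Finset.sum_congr rfl fun i _ => Finset.sum_congr rfl fun j _ => by ring
    simp_rw [e2]
    exact integrable_finsetSum _ fun i _ => integrable_finsetSum _ fun j _ =>
      (integrable_indicator_Ioc_mul _ _ _ _).const_mul _
  rw [← ofReal_integral_eq_lintegral_ofReal (memLp_realStepIntegral hB u v c).integrable_sq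
    (ae_of_all _ fun _ => sq_nonneg _),
    ← ofReal_integral_eq_lintegral_ofReal h2 (ae_of_all _ fun _ => sq_nonneg _),
    integral_sq_realStepIntegral hB huv]

/-- The maximal inequality for elementary stochastic integrals. -/
lemma exists_bound_realElementaryIntegral (hB : IsBrownianReal B P) {u v : Fin k → ℝ≥0}
    (huv : ∀ j, u j ≤ v j) (c : Fin k → ℝ) {a b : ℝ≥0} (hab : a ≤ b) :
    ∃ G : Ω → ℝ≥0∞, AEMeasurable G P ∧
      (∀ᵐ ω ∂P, ∀ s ∈ Icc a b, ENNReal.ofReal (realElementaryIntegral B u v c a s ω ^ 2) ≤ G ω) ∧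
      ∫⁻ ω, G ω ∂P ≤ 4 * ∫⁻ r in Ioc (a : ℝ) b, ENNReal.ofReal (realStep u v c r ^ 2) := by
  have hB' := hB.toIsPreBrownianReal
  -- The grid reaches b at index n + 1. Later indices run past b and do not enter the maximum.
  let τ : ℕ → ℕ → ℝ≥0 := fun n i => a + (b - a) * ((i : ℝ≥0) / (n + 1 : ℝ≥0))
  have hτ : ∀ n, Monotone (τ n) := fun n i j hij => by
    simp only [τ]; gcongr
  have hτa : ∀ n i, a ≤ τ n i := fun n i => le_self_add
  have hτb : ∀ n, τ n (n + 1) = b := fun n => by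
    simp only [τ]
    push_cast
    rw [div_self (by positivity), mul_one, add_tsub_cancel_of_le hab]
  let S : ℕ → ℕ → Ω → ℝ := fun n i ω => realElementaryIntegral B u v c a (τ n i) ω
  have hS : ∀ n i, MemLp (S n i) 2 P := fun n i => memLp_realStepIntegral hB' _ _ _
  let Gn : ℕ → Ω → ℝ≥0∞ := fun n ω =>
    ENNReal.ofReal ((partialSups (fun i => |S n i ω|) (n + 1)) ^ 2)
  have hGn : ∀ n, AEMeasurable (Gn n) P := fun n =>
    ((aemeasurable_partialSups (fun i => ((hS n i).abs.1.aemeasurable)) (n + 1)).pow_const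
      2).ennreal_ofReal
  have hle : ∀ n, ∫⁻ ω, Gn n ω ∂P ≤
      4 * ∫⁻ r in Ioc (a : ℝ) b, ENNReal.ofReal (realStep u v c r ^ 2) := fun n => by
    refine (integral_sq_partialSups_le (S n) (hS n) (fun i => ?_)
      (fun i => indepFun_realElementaryIntegral hB' u v c (hτ n) (hτa n) i) (n + 1)).trans ?_
    · rw [integral_sub ((hS n (i + 1)).integrable one_le_two) ((hS n i).integrable one_le_two)]
      simp only [S, realElementaryIntegral, integral_realStepIntegral hB', sub_self]
    · simp only [S, hτb, realElementaryIntegral]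
      rw [lintegral_sq_realStepIntegral hB' (fun j => clamp_mono (huv j)), realStep_clamp,
        ← lintegral_indicator measurableSet_Ioc]
      refine mul_le_mul_right (lintegral_mono fun r => ?_) _
      simp only [indicator_apply]
      split_ifs <;> simp
  -- A liminf of grid maxima instead of an uncountable supremum: it is measurable, dominates every
  -- time by continuity of paths, and Fatou bounds its mean.
  refine ⟨fun ω => liminf (fun n => Gn n ω) atTop, ?_, ?_, ?_⟩
  · exact aemeasurable_liminf hGn
  · filter_upwards [hB.cont] with ω hω s hs
    have hc := continuous_realElementaryIntegral u v c a hω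
    -- The relative position of s in [a, b], approximated by ⌊q(n+1)⌋/(n+1). If a = b, division by
    -- zero gives q = 0, which is still correct.
    let q : ℝ≥0 := (s - a) / (b - a)
    have hq1 : q ≤ 1 := div_le_one_of_le₀ (tsub_le_tsub_right hs.2 a) zero_le
    have hqs : a + (b - a) * q = s := by
      rcases eq_or_lt_of_le hab with h | h
      · subst h
        have : s = a := le_antisymm hs.2 hs.1
        simp [this]
      · have : b - a ≠ 0 := (tsub_pos_of_lt h).ne'
        simp only [q]
        rw [mul_div_cancel₀ _ this, add_tsub_cancel_of_le hs.1]
    have hlim : Tendsto (fun n : ℕ => (⌊(q : ℝ) * (n + 1 : ℝ)⌋₊ : ℝ≥0) / (n + 1 : ℝ≥0)) atTop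
        (𝓝 q) := by
      rw [← NNReal.tendsto_coe]
      push_cast
      exact (tendsto_nat_floor_mul_div_atTop (R := ℝ) q.coe_nonneg).comp
        (tendsto_natCast_atTop_atTop.atTop_add (tendsto_const_nhds (x := (1 : ℝ))))
    have hlim2 : Tendsto (fun n : ℕ => τ n ⌊(q : ℝ) * (n + 1 : ℝ)⌋₊) atTop (𝓝 s) := by
      have := (hlim.const_mul (b - a)).const_add a
      rwa [hqs] at this
    have hlim3 : Tendsto (fun n : ℕ =>
        ENNReal.ofReal (S n ⌊(q : ℝ) * (n + 1 : ℝ)⌋₊ ω ^ 2)) atTop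
        (𝓝 (ENNReal.ofReal (realElementaryIntegral B u v c a s ω ^ 2))) :=
      ENNReal.tendsto_ofReal ((((hc.tendsto s).comp hlim2)).pow 2)
    rw [← hlim3.liminf_eq]
    refine liminf_le_liminf (Eventually.of_forall fun n => ?_)
    refine ENNReal.ofReal_le_ofReal ?_
    rw [← sq_abs]
    refine pow_le_pow_left₀ (abs_nonneg _) ?_ 2
    refine le_partialSups_of_le (fun i => |S n i ω|) (Nat.floor_le_of_le ?_)
    push_cast
    exact mul_le_of_le_one_left (by positivity) (by exact_mod_cast hq1)
  · refine (lintegral_liminf_le' hGn).trans ?_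
    exact (liminf_le_liminf (Eventually.of_forall hle)).trans (by simp)

end Scalar

/-! ### Elementary integrals of vector-valued step functions -/

section Vector

variable {Ω : Type*} [MeasurableSpace Ω] {P : Measure Ω} [IsProbabilityMeasure P] {d : ℕ}
  {W : ℝ≥0 → Ω → E d} {k : ℕ}

/-- The process `s ↦ ∑ⱼ ⟨cⱼ, W_{vⱼ} - W_{uⱼ}⟩` with all times moved into `[a, s]`. -/
def elementaryIntegral (W : ℝ≥0 → Ω → E d) (u v : Fin k → ℝ≥0) (c : Fin k → E d)
    (a s : ℝ≥0) (ω : Ω) : ℝ :=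
  stepIntegral W (fun j => clamp a s (u j)) (fun j => clamp a s (v j)) c ω

lemma stepIntegral_eq_sum (W : ℝ≥0 → Ω → E d) (u v : Fin k → ℝ≥0) (c : Fin k → E d) (ω : Ω) :
    stepIntegral W u v c ω =
      ∑ i, realStepIntegral (fun r ω => W r ω i) u v (fun j => c j i) ω := by
  simp only [stepIntegral, realStepIntegral, PiLp.inner_apply]
  rw [Finset.sum_comm]
  simp [mul_comm]

lemma stepFun_apply (u v : Fin k → ℝ≥0) (c : Fin k → E d) (r : ℝ) (i : Fin d) :
    stepFun u v c r i = realStep u v (fun j => c j i) r := by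
  simp only [stepFun, realStep, WithLp.ofLp_sum, Finset.sum_apply]
  refine Finset.sum_congr rfl fun j _ => ?_
  by_cases h : r ∈ Ioc (u j : ℝ) (v j : ℝ) <;> simp [h]

lemma enorm_sq_stepFun (u v : Fin k → ℝ≥0) (c : Fin k → E d) (r : ℝ) :
    ‖stepFun u v c r‖ₑ ^ 2 = ∑ i, ENNReal.ofReal (realStep u v (fun j => c j i) r ^ 2) := by
  rw [← ofReal_norm, ← ENNReal.ofReal_pow (norm_nonneg _), EuclideanSpace.norm_sq_eq,
    ENNReal.ofReal_sum_of_nonneg fun i _ => sq_nonneg _]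
  simp [stepFun_apply]

lemma measurable_realStep (u v : Fin k → ℝ≥0) (c : Fin k → ℝ) : Measurable (realStep u v c) :=
  Finset.measurable_sum _ fun _ _ =>
    (measurable_const.indicator measurableSet_Ioc).const_mul _

/-- Cauchy–Schwarz over the coordinates; this is the origin of the factor d in the later bounds. -/
lemma enorm_sq_sum_le (f : Fin d → ℝ) :
    ‖∑ i, f i‖ₑ ^ 2 ≤ d * ∑ i, ENNReal.ofReal (f i ^ 2) := by
  rw [← ENNReal.ofReal_sum_of_nonneg fun i _ => sq_nonneg _, ← ofReal_norm,
    ← ENNReal.ofReal_pow (norm_nonneg _), ← ENNReal.ofReal_natCast, ← ENNReal.ofReal_mul (by simp)]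
  refine ENNReal.ofReal_le_ofReal ?_
  have := sq_sum_le_card_mul_sum_sq (s := Finset.univ) (f := f)
  simpa using this

lemma lintegral_enorm_sq_stepIntegral_le (hW : IsBrownianMotion W P) {u v : Fin k → ℝ≥0}
    (huv : ∀ j, u j ≤ v j) (c : Fin k → E d) :
    ∫⁻ ω, ‖stepIntegral W u v c ω‖ₑ ^ 2 ∂P ≤ d * ∫⁻ r, ‖stepFun u v c r‖ₑ ^ 2 := by
  simp_rw [stepIntegral_eq_sum, enorm_sq_stepFun]
  refine (lintegral_mono fun ω => enorm_sq_sum_le _).trans ?_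
  rw [lintegral_const_mul' _ _ (by simp), lintegral_finsetSum' _ fun i _ =>
    ((memLp_realStepIntegral (hW.brownian i).toIsPreBrownianReal u v
      _).1.aemeasurable.pow_const 2).ennreal_ofReal,
    lintegral_finsetSum _ fun i _ => ((measurable_realStep _ _ _).pow_const 2).ennreal_ofReal]
  simp_rw [lintegral_sq_realStepIntegral (hW.brownian _).toIsPreBrownianReal huv]
  rfl

/-- The maximal inequality for elementary stochastic integrals of vector-valued step functions. -/
lemma exists_bound_elementaryIntegral (hW : IsBrownianMotion W P) {u v : Fin k → ℝ≥0}
    (huv : ∀ j, u j ≤ v j) (c : Fin k → E d) {a b : ℝ≥0} (hab : a ≤ b) :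
    ∃ G : Ω → ℝ≥0∞, AEMeasurable G P ∧
      (∀ᵐ ω ∂P, ∀ s ∈ Icc a b, ‖elementaryIntegral W u v c a s ω‖ₑ ^ 2 ≤ G ω) ∧
      ∫⁻ ω, G ω ∂P ≤ 4 * d * ∫⁻ r in Ioc (a : ℝ) b, ‖stepFun u v c r‖ₑ ^ 2 := by
  choose G hGm hG hGle using fun i =>
    exists_bound_realElementaryIntegral (hW.brownian i) huv (fun j => c j i) hab
  refine ⟨fun ω => d * ∑ i, G i ω, ?_, ?_, ?_⟩
  · exact (Finset.aemeasurable_fun_sum _ fun i _ => hGm i).const_mul _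
  · filter_upwards [ae_all_iff.2 hG] with ω hω s hs
    rw [elementaryIntegral, stepIntegral_eq_sum]
    refine (enorm_sq_sum_le _).trans ?_
    gcongr with i hi
    exact hω i s hs
  · rw [lintegral_const_mul' _ _ (by simp), lintegral_finsetSum' _ fun i _ => hGm i]
    simp_rw [enorm_sq_stepFun]
    rw [lintegral_finsetSum _ fun i _ => ((measurable_realStep _ _ _).pow_const 2).ennreal_ofReal,
      mul_comm 4 (d : ℝ≥0∞), mul_assoc, Finset.mul_sum _ _ (4 : ℝ≥0∞)]
    exact mul_le_mul_right (Finset.sum_le_sum fun i _ => hGle i) _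

end Vector

/-- A continuous function on `[0, T]` is a uniform limit of step functions whose values are among
its values. -/
lemma exists_stepFun_approx {d : ℕ} {T : ℝ≥0} {h : ℝ → E d} (hh : ContinuousOn h (Icc 0 T))
    {ε : ℝ} (hε : 0 < ε) :
    ∃ (k : ℕ) (u v : Fin k → ℝ≥0) (c : Fin k → E d), (∀ j, u j ≤ v j) ∧ (∀ j, v j ≤ T) ∧
      ∀ r ∈ Ioc (0 : ℝ) T, ‖h r - stepFun u v c r‖ ≤ ε ∧
        ∃ r' ∈ Icc (0 : ℝ) T, stepFun u v c r = h r' := by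
  obtain ⟨δ, hδ, hδ'⟩ := Metric.uniformContinuousOn_iff.1
    (isCompact_Icc.uniformContinuousOn_of_continuous hh) ε hε
  obtain ⟨n, hn⟩ := exists_nat_gt ((T : ℝ) / δ)
  let u : Fin (n + 1) → ℝ≥0 := fun j => T * ((j : ℕ) / (n + 1 : ℝ≥0))
  let v : Fin (n + 1) → ℝ≥0 := fun j => T * (((j : ℕ) + 1 : ℝ≥0) / (n + 1 : ℝ≥0))
  have hu : ∀ j, (u j : ℝ) = T * ((j : ℕ) / (n + 1 : ℝ)) := fun j => by simp [u]
  have hv : ∀ j, (v j : ℝ) = T * (((j : ℕ) + 1 : ℝ) / (n + 1 : ℝ)) := fun j => by simp [v]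
  have hvT : ∀ j, v j ≤ T := fun j => by
    have : ((j : ℕ) + 1 : ℝ≥0) / (n + 1 : ℝ≥0) ≤ 1 := div_le_one_of_le₀ (by
      have := j.2
      exact_mod_cast this) zero_le
    exact mul_le_of_le_one_right zero_le this
  have huv : ∀ j, u j ≤ v j := fun j => by
    simp only [u, v]; gcongr; exact le_self_add
  refine ⟨n + 1, u, v, fun j => h (u j), huv, hvT, fun r hr => ?_⟩
  have hT : (0 : ℝ) < T := hr.1.trans_le hr.2
  have hn0 : (0 : ℝ) < n + 1 := by positivity
  have hx : 0 < r * (n + 1) / T := by have := hr.1; positivity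
  -- The cells are open on the left and closed on the right, so r lies in the one with index q − 1,
  -- q being a ceiling.
  set q := ⌈r * (n + 1) / T⌉₊ with hq
  have hq1 : 1 ≤ q := Nat.one_le_ceil_iff.2 hx
  have hqn : q ≤ n + 1 := by
    rw [hq, Nat.ceil_le, div_le_iff₀ hT]
    push_cast
    nlinarith [hr.2]
  have hqlt : (q : ℝ) < r * (n + 1) / T + 1 := Nat.ceil_lt_add_one hx.le
  have hqge : r * (n + 1) / T ≤ q := Nat.le_ceil _
  have hiff : ∀ j : Fin (n + 1), r ∈ Ioc (u j : ℝ) (v j) ↔ (j : ℕ) + 1 = q := by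
    intro j
    rw [mem_Ioc, hu, hv, ← mul_div_assoc, ← mul_div_assoc, div_lt_iff₀ hn0, le_div_iff₀ hn0,
      mul_comm (T : ℝ), mul_comm (T : ℝ), ← lt_div_iff₀ hT, ← div_le_iff₀ hT]
    constructor
    · rintro ⟨h1, h2⟩
      have h3 : q ≤ (j : ℕ) + 1 := by rw [hq, Nat.ceil_le]; push_cast; exact h2
      have h4 : (j : ℕ) < q := Nat.lt_ceil.2 h1
      lia
    · intro h1
      have : ((j : ℕ) : ℝ) + 1 = q := by exact_mod_cast h1
      exact ⟨by linarith, by linarith⟩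
  let j₀ : Fin (n + 1) := ⟨q - 1, by lia⟩
  have hj₀ : r ∈ Ioc (u j₀ : ℝ) (v j₀) := (hiff j₀).2 (by simp only [j₀]; lia)
  have hval : stepFun u v (fun j => h (u j)) r = h (u j₀) := by
    rw [stepFun, Finset.sum_eq_single j₀]
    · rw [indicator_of_mem hj₀]
    · intro j _ hj
      refine indicator_of_notMem (fun hr' => hj (Fin.ext ?_)) _
      have := (hiff j).1 hr'
      simp only [j₀]; lia
    · simp
  have hmem : (u j₀ : ℝ) ∈ Icc (0 : ℝ) T :=
    ⟨NNReal.coe_nonneg _, NNReal.coe_le_coe.2 ((huv j₀).trans (hvT j₀))⟩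
  refine ⟨?_, u j₀, hmem, hval⟩
  rw [hval, ← dist_eq_norm]
  refine (hδ' r ⟨hr.1.le, hr.2⟩ _ hmem ?_).le
  have h1 := hj₀.1
  have h2 := hj₀.2
  have h3 : (v j₀ : ℝ) - u j₀ = T / (n + 1) := by rw [hu, hv]; field_simp; ring
  have h4 : (T : ℝ) / (n + 1) < δ := by
    rw [div_lt_iff₀ hδ] at hn
    rw [div_lt_iff₀ hn0]
    nlinarith
  rw [Real.dist_eq, abs_of_pos (by linarith)]
  linarith

/-! ### The augmented filtration -/

section Augmented

variable {Ω : Type*} [MeasurableSpace Ω] {P : Measure Ω} {d : ℕ} {W : ℝ≥0 → Ω → E d}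

lemma measurableSet_augmentedFiltration_of_null (s : ℝ) {A : Set Ω} (hA : P A = 0) :
    MeasurableSet[augmentedFiltration W P s] A := by
  have : MeasurableSpace.generateFrom {A : Set Ω | P A = 0} ≤ augmentedFiltration W P s :=
    le_sup_right
  exact this _ (MeasurableSpace.measurableSet_generateFrom hA)

lemma measurable_augmentedFiltration (W : ℝ≥0 → Ω → E d) (P : Measure Ω) {s : ℝ} {r : ℝ≥0}
    (hr : (r : ℝ) ≤ s) : Measurable[augmentedFiltration W P s] (W r) := by
  have : MeasurableSpace.comap (W r) inferInstance ≤ augmentedFiltration W P s :=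
    le_sup_of_le_left (le_iSup_of_le r (le_iSup_of_le hr le_rfl))
  exact (comap_measurable (W r)).mono this le_rfl

lemma augmentedFiltration_mono {s s' : ℝ} (h : s ≤ s') :
    augmentedFiltration W P s ≤ augmentedFiltration W P s' := by
  refine sup_le_sup_right (iSup_mono fun r => ?_) _
  exact iSup_le fun hr => le_iSup_of_le (hr.trans h) le_rfl

/-- Almost sure limits of `ℱ_s`-measurable functions are `ℱ_s`-measurable. -/
lemma measurable_of_ae_tendsto {F : Type*} [NormedAddCommGroup F] [MeasurableSpace F]
    [BorelSpace F] {s : ℝ} {f : ℕ → Ω → F} {g : Ω → F}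
    (hf : ∀ n, Measurable[augmentedFiltration W P s] (f n))
    (hg : ∀ᵐ ω ∂P, Tendsto (fun n => f n ω) atTop (𝓝 (g ω))) :
    Measurable[augmentedFiltration W P s] g := by
  set A : Set Ω := {ω | ¬ Tendsto (fun n => f n ω) atTop (𝓝 (g ω))} with hA
  have hA0 : P A = 0 := hg
  have hAm : MeasurableSet[augmentedFiltration W P s] Aᶜ :=
    (measurableSet_augmentedFiltration_of_null s hA0).compl
  have h1 : Measurable[augmentedFiltration W P s] (Aᶜ.indicator g) := by
    refine @measurable_of_tendsto_metrizable _ _ (augmentedFiltration W P s) _ _ _ _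
      (fun n => Aᶜ.indicator (f n)) _ (fun n => (hf n).indicator hAm) ?_
    rw [tendsto_pi_nhds]
    intro ω
    by_cases h : ω ∈ A
    · simp [h]
    · have : Tendsto (fun n => f n ω) atTop (𝓝 (g ω)) := by
        simpa [hA] using h
      simpa [indicator_of_mem (mem_compl h)] using this
  intro S hS
  -- The piece inside A is null and therefore belongs to the augmented σ-algebra, whatever g does
  -- there.
  have h2 : g ⁻¹' S = (Aᶜ.indicator g ⁻¹' S ∩ Aᶜ) ∪ (g ⁻¹' S ∩ A) := by
    ext ω
    by_cases h : ω ∈ A <;> simp [h]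
  rw [h2]
  exact ((h1 hS).inter hAm).union (measurableSet_augmentedFiltration_of_null s
    (measure_mono_null inter_subset_right hA0))

lemma measurable_stepIntegral {k : ℕ} {s : ℝ} {u v : Fin k → ℝ≥0} (hu : ∀ j, (u j : ℝ) ≤ s)
    (hv : ∀ j, (v j : ℝ) ≤ s) (c : Fin k → E d) :
    Measurable[augmentedFiltration W P s] (stepIntegral W u v c) :=
  Finset.measurable_sum _ fun j _ => Measurable.const_inner
    ((measurable_augmentedFiltration W P (hv j)).sub (measurable_augmentedFiltration W P (hu j)))

end Augmented

/-! ### Differences of step functions; uniqueness of Wiener integrals -/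

section Steps

variable {Ω : Type*} [MeasurableSpace Ω] {P : Measure Ω} [IsProbabilityMeasure P] {d : ℕ}
  {W : ℝ≥0 → Ω → E d}

lemma eLpNorm_two_eq {α F : Type*} [MeasurableSpace α] [NormedAddCommGroup F] (f : α → F)
    (μ : Measure α) : eLpNorm f 2 μ = (∫⁻ x, ‖f x‖ₑ ^ 2 ∂μ) ^ (1 / 2 : ℝ) := by
  rw [eLpNorm_eq_lintegral_rpow_enorm_toReal (by simp) (by simp)]
  simp

lemma stepFun_clamp {k : ℕ} (a b : ℝ≥0) (u v : Fin k → ℝ≥0) (c : Fin k → E d) :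
    stepFun (fun j => clamp a b (u j)) (fun j => clamp a b (v j)) c =
      (Ioc (a : ℝ) b).indicator (stepFun u v c) := by
  ext r
  simp only [stepFun, Ioc_clamp, indicator_apply, mem_inter_iff]
  split_ifs with h <;> simp [h]

lemma stepFun_eq_indicator {k : ℕ} {T : ℝ≥0} {u v : Fin k → ℝ≥0} (hv : ∀ j, v j ≤ T)
    (c : Fin k → E d) : stepFun u v c = (Ioc (0 : ℝ) T).indicator (stepFun u v c) := by
  have := stepFun_clamp 0 T u v c
  rw [NNReal.coe_zero] at this
  by_cases h : ∀ j, u j ≤ v j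
  · rw [← this]
    congr 1 <;> ext j <;> simp [clamp, hv j, (h j).trans (hv j)]
  · rw [← this]
    ext1 r
    simp only [stepFun, Ioc_clamp]
    refine Finset.sum_congr rfl fun j _ => ?_
    rw [inter_eq_right.2]
    exact Ioc_subset_Ioc (by simp) (by exact_mod_cast hv j)

lemma aestronglyMeasurable_stepIntegral (hW : IsBrownianMotion W P) {k : ℕ} (u v : Fin k → ℝ≥0)
    (c : Fin k → E d) : AEStronglyMeasurable (stepIntegral W u v c) P := by
  simp_rw [funext (stepIntegral_eq_sum W u v c)]
  exact Finset.aestronglyMeasurable_fun_sum _ fun i _ =>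
    (memLp_realStepIntegral (hW.brownian i).toIsPreBrownianReal u v _).1

lemma eLpNorm_stepIntegral_le (hW : IsBrownianMotion W P) {k : ℕ} {u v : Fin k → ℝ≥0} {T : ℝ≥0}
    (huv : ∀ j, u j ≤ v j) (hv : ∀ j, v j ≤ T) (c : Fin k → E d) :
    eLpNorm (stepIntegral W u v c) 2 P ≤
      (d : ℝ≥0∞) ^ (1 / 2 : ℝ) * eLpNorm (stepFun u v c) 2 (volume.restrict (Icc 0 (T : ℝ))) := by
  rw [eLpNorm_two_eq, eLpNorm_two_eq, ← ENNReal.mul_rpow_of_nonneg _ _ (by norm_num)]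
  refine ENNReal.rpow_le_rpow ?_ (by norm_num)
  refine (lintegral_enorm_sq_stepIntegral_le hW huv c).trans_eq ?_
  congr 1
  rw [← Measure.restrict_congr_set Ioc_ae_eq_Icc, ← lintegral_indicator measurableSet_Ioc]
  refine lintegral_congr fun r => ?_
  rw [stepFun_eq_indicator hv]
  simp only [indicator_apply]
  split_ifs <;> simp

/-- Concatenating the data, with one sign reversed, presents a difference as a single step integral,
so bounds for step functions apply to differences. -/
lemma stepIntegral_append {k k' : ℕ} (u v : Fin k → ℝ≥0) (u' v' : Fin k' → ℝ≥0) (c : Fin k → E d)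
    (c' : Fin k' → E d) (ω : Ω) :
    stepIntegral W (Fin.append u u') (Fin.append v v') (Fin.append c (-c')) ω =
      stepIntegral W u v c ω - stepIntegral W u' v' c' ω := by
  simp [stepIntegral, Fin.sum_univ_add, sub_eq_add_neg]

lemma elementaryIntegral_append {k k' : ℕ} (u v : Fin k → ℝ≥0) (u' v' : Fin k' → ℝ≥0)
    (c : Fin k → E d)
    (c' : Fin k' → E d) (a s : ℝ≥0) (ω : Ω) :
    elementaryIntegral W (Fin.append u u') (Fin.append v v') (Fin.append c (-c')) a s ω =
      elementaryIntegral W u v c a s ω - elementaryIntegral W u' v' c' a s ω := by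
  simp [elementaryIntegral, stepIntegral, Fin.sum_univ_add, sub_eq_add_neg]

lemma stepFun_append {k k' : ℕ} (u v : Fin k → ℝ≥0) (u' v' : Fin k' → ℝ≥0) (c : Fin k → E d)
    (c' : Fin k' → E d) (r : ℝ) :
    stepFun (Fin.append u u') (Fin.append v v') (Fin.append c (-c')) r =
      stepFun u v c r - stepFun u' v' c' r := by
  simp only [stepFun, Fin.sum_univ_add, Fin.append_left, Fin.append_right, sub_eq_add_neg,
    ← Finset.sum_neg_distrib]
  congr 1
  refine Finset.sum_congr rfl fun j _ => ?_
  simp only [indicator_apply]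
  split_ifs <;> simp

lemma append_le_append {k k' : ℕ} {u v : Fin k → ℝ≥0} {u' v' : Fin k' → ℝ≥0}
    (h : ∀ j, u j ≤ v j) (h' : ∀ j, u' j ≤ v' j) (j : Fin (k + k')) :
    Fin.append u u' j ≤ Fin.append v v' j := by
  refine Fin.addCases (fun i => ?_) (fun i => ?_) j
  · simpa using h i
  · simpa using h' i

lemma append_le {k k' : ℕ} {v : Fin k → ℝ≥0} {v' : Fin k' → ℝ≥0} {T : ℝ≥0}
    (h : ∀ j, v j ≤ T) (h' : ∀ j, v' j ≤ T) (j : Fin (k + k')) : Fin.append v v' j ≤ T := by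
  refine Fin.addCases (fun i => ?_) (fun i => ?_) j
  · simpa using h i
  · simpa using h' i

lemma elementaryIntegral_sub {k : ℕ} (u v : Fin k → ℝ≥0) (c : Fin k → E d) {a s s' : ℝ≥0}
    (h : a ≤ s) (h' : s ≤ s') (ω : Ω) :
    elementaryIntegral W u v c a s' ω - elementaryIntegral W u v c a s ω =
      elementaryIntegral W u v c s s' ω := by
  simp only [elementaryIntegral, stepIntegral, ← Finset.sum_sub_distrib, ← inner_sub_right]
  refine Finset.sum_congr rfl fun j _ => ?_
  congr 1
  have h1 := clamp_increment (fun t => W t ω) h h' (v j)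
  have h2 := clamp_increment (fun t => W t ω) h h' (u j)
  have : ∀ A B C D X Y Z : E d, A - C = X - Z → B - D = Y - Z → A - B - (C - D) = X - Y := by
    intro A B C D X Y Z e1 e2
    rw [sub_sub_sub_comm, e1, e2]; abel
  exact this _ _ _ _ _ _ _ h1 h2

lemma continuous_brownian (hW : IsBrownianMotion W P) : ∀ᵐ ω ∂P, Continuous fun t => W t ω := by
  filter_upwards [ae_all_iff.2 fun j => (hW.brownian j).cont] with ω hω
  have : (fun t => W t ω) = fun t => WithLp.toLp 2 (fun j => W t ω j) := rfl
  rw [this]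
  exact (PiLp.continuous_toLp 2 _).comp (continuous_pi hω)

lemma continuous_elementaryIntegral {k : ℕ} (u v : Fin k → ℝ≥0) (c : Fin k → E d) (a : ℝ≥0) {ω : Ω}
    (hω : Continuous fun t => W t ω) : Continuous fun s => elementaryIntegral W u v c a s ω := by
  unfold elementaryIntegral stepIntegral
  exact continuous_finsetSum _ fun j _ => continuous_const.inner
    ((hω.comp (continuous_clamp a (v j))).sub (hω.comp (continuous_clamp a (u j))))

/-- Wiener integrals are unique up to null sets. -/
lemma IsWienerIntegral.ae_eq (hW : IsBrownianMotion W P) {T : ℝ≥0} {h : ℝ → E d} {ξ ξ' : Ω → ℝ}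
    (hξ : IsWienerIntegral W P T h ξ) (hξ' : IsWienerIntegral W P T h ξ') : ξ =ᵐ[P] ξ' := by
  set μ := volume.restrict (Icc 0 (T : ℝ)) with hμ
  set κ : ℝ≥0∞ := (d : ℝ≥0∞) ^ (1 / 2 : ℝ) with hκ
  have hκ' : κ ≠ ∞ := by simp [hκ]
  have hstep : ∀ {k : ℕ} (u v : Fin k → ℝ≥0) (c : Fin k → E d),
      AEStronglyMeasurable (stepFun u v c) μ := fun u v c =>
    (Finset.measurable_sum _ fun j _ =>
      (measurable_const.indicator measurableSet_Ioc)).aestronglyMeasurable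
  have key : ∀ δ : ℝ≥0∞, 0 < δ → eLpNorm (fun ω => ξ ω - ξ' ω) 2 P ≤ (2 + 2 * κ) * δ := by
    intro δ hδ
    obtain ⟨k, u, v, c, huv, h1, h2⟩ := hξ.approx δ hδ
    obtain ⟨k', u', v', c', huv', h1', h2'⟩ := hξ'.approx δ hδ
    -- The first two terms are at most δ by approximation. The last integrates a step function of
    -- norm at most 2δ, since both step functions are δ-close to h.
    have e : (fun ω => ξ ω - ξ' ω) = ((fun ω => ξ ω - stepIntegral W u v c ω) -
        (fun ω => ξ' ω - stepIntegral W u' v' c' ω)) +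
        stepIntegral W (Fin.append u u') (Fin.append v v') (Fin.append c (-c')) := by
      ext ω; simp only [Pi.add_apply, Pi.sub_apply, stepIntegral_append]; ring
    have m1 := hξ.memLp_integral.1.sub (aestronglyMeasurable_stepIntegral hW u v c)
    have m2 := hξ'.memLp_integral.1.sub (aestronglyMeasurable_stepIntegral hW u' v' c')
    have b1 : eLpNorm (stepIntegral W (Fin.append u u') (Fin.append v v')
        (Fin.append c (-c'))) 2 P ≤ κ * (δ + δ) := by
      refine (eLpNorm_stepIntegral_le hW (append_le_append (fun j => (huv j).1)
        (fun j => (huv' j).1)) (append_le (fun j => NNReal.coe_le_coe.1 (huv j).2)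
        (fun j => NNReal.coe_le_coe.1 (huv' j).2)) _).trans ?_
      refine mul_le_mul_right ?_ _
      have e2 : stepFun (Fin.append u u') (Fin.append v v') (Fin.append c (-c')) =
          (fun r => h r - stepFun u' v' c' r) - (fun r => h r - stepFun u v c r) := by
        ext1 r; simp only [Pi.sub_apply, stepFun_append]; abel
      rw [e2]
      exact (eLpNorm_sub_le (hξ.memLp_integrand.1.sub (hstep _ _ _))
        (hξ.memLp_integrand.1.sub (hstep _ _ _)) (by norm_num)).trans (add_le_add h1' h1)
    rw [e]
    refine (eLpNorm_add_le (m1.sub m2) (aestronglyMeasurable_stepIntegral hW _ _ _)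
      (by norm_num)).trans ((add_le_add ((eLpNorm_sub_le m1 m2 (by norm_num)).trans
        (add_le_add h2 h2')) b1).trans_eq ?_)
    ring
  have h0 : eLpNorm (fun ω => ξ ω - ξ' ω) 2 P = 0 := by
    have hc : 2 + 2 * κ ≠ ∞ := by finiteness
    refine le_antisymm (ENNReal.le_of_forall_pos_le_add fun ε hε _ => ?_) zero_le
    have hc0 : 2 + 2 * κ ≠ 0 := by simp
    refine (key (ε / (2 + 2 * κ)) (ENNReal.div_pos (by simpa using hε.ne') hc)).trans ?_
    rw [ENNReal.mul_div_cancel hc0 hc, zero_add]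
  have h1 := (eLpNorm_eq_zero_iff (hξ.memLp_integral.1.sub hξ'.memLp_integral.1) (by simp)).1 h0
  filter_upwards [h1] with ω hω
  exact sub_eq_zero.1 hω

end Steps

/-! ### Continuous versions of Wiener integrals -/

variable {Ω : Type*} [MeasurableSpace Ω] {P : Measure Ω} [IsProbabilityMeasure P] {d : ℕ}
  {W : ℝ≥0 → Ω → E d}

lemma eLpNorm_restrict_Icc_le {F : Type*} [NormedAddCommGroup F] {T : ℝ≥0} {f : ℝ → F} {C : ℝ}
    (hf : ∀ r ∈ Ioc (0 : ℝ) T, ‖f r‖ ≤ C) :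
    eLpNorm f 2 (volume.restrict (Icc (0 : ℝ) T)) ≤
      (T : ℝ≥0∞) ^ (1 / 2 : ℝ) * ENNReal.ofReal C := by
  rw [← Measure.restrict_congr_set Ioc_ae_eq_Icc]
  refine (eLpNorm_le_of_ae_bound (C := C) ?_).trans_eq ?_
  · exact (ae_restrict_iff' measurableSet_Ioc).2 (ae_of_all _ hf)
  · simp [Real.volume_Ioc]

lemma memLp_indicator_Ioc {T : ℝ≥0} {h : ℝ → E d} (hh : ContinuousOn h (Icc 0 T)) {L : ℝ}
    (hL : ∀ r ∈ Icc (0 : ℝ) T, ‖h r‖ ≤ L) (a s : ℝ) :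
    MemLp ((Ioc a s).indicator h) 2 (volume.restrict (Icc (0 : ℝ) T)) := by
  refine MemLp.indicator measurableSet_Ioc (MemLp.of_bound ?_ L ?_)
  · exact hh.aestronglyMeasurable measurableSet_Icc
  · exact (ae_restrict_iff' measurableSet_Icc).2 (ae_of_all _ hL)

/-- A limit of elementary integrals of step functions converging uniformly at a geometric rate is
a Wiener integral. -/
lemma isWienerIntegral_of_tendsto (hW : IsBrownianMotion W P) {T : ℝ≥0} {h : ℝ → E d} {ξ : Ω → ℝ}
    (hh : MemLp h 2 (volume.restrict (Icc (0 : ℝ) T)))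
    {k : ℕ → ℕ} {u v : ∀ l, Fin (k l) → ℝ≥0} {c : ∀ l, Fin (k l) → E d}
    (huv : ∀ l j, u l j ≤ v l j) (hv : ∀ l j, v l j ≤ T)
    (hc : ∀ l, ∀ r ∈ Ioc (0 : ℝ) T, ‖h r - stepFun (u l) (v l) (c l) r‖ ≤ (1 / 2) ^ l)
    (hlim : ∀ᵐ ω ∂P, Tendsto (fun l => stepIntegral W (u l) (v l) (c l) ω) atTop (𝓝 (ξ ω))) :
    IsWienerIntegral W P T h ξ := by
  set Q : ℕ → Ω → ℝ := fun l => stepIntegral W (u l) (v l) (c l) with hQ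
  have hQm : ∀ l, AEStronglyMeasurable (Q l) P := fun l =>
    aestronglyMeasurable_stepIntegral hW _ _ _
  have hξm : AEStronglyMeasurable ξ P := aestronglyMeasurable_of_tendsto_ae atTop hQm hlim
  set κ : ℝ≥0∞ := (d : ℝ≥0∞) ^ (1 / 2 : ℝ) * ((T : ℝ≥0∞) ^ (1 / 2 : ℝ)) with hκ
  have hκ' : κ ≠ ∞ := by
    rw [hκ]; exact ENNReal.mul_ne_top (by simp) (by simp)
  have h1 : ∀ l m, l ≤ m →
      eLpNorm (fun ω => Q m ω - Q l ω) 2 P ≤ κ * ENNReal.ofReal (2 * (1 / 2) ^ l) := by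
    intro l m hlm
    have e : (fun ω => Q m ω - Q l ω) = stepIntegral W (Fin.append (u m) (u l))
        (Fin.append (v m) (v l)) (Fin.append (c m) (-(c l))) := by
      ext ω; rw [stepIntegral_append]
    rw [e, hκ, mul_assoc]
    refine (eLpNorm_stepIntegral_le hW (append_le_append (huv m) (huv l))
      (append_le (hv m) (hv l)) _).trans (mul_le_mul_right (eLpNorm_restrict_Icc_le fun r hr => ?_) _)
    rw [stepFun_append]
    have e2 : stepFun (u m) (v m) (c m) r - stepFun (u l) (v l) (c l) r =
        (h r - stepFun (u l) (v l) (c l) r) - (h r - stepFun (u m) (v m) (c m) r) := by abel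
    rw [e2]
    refine (norm_sub_le _ _).trans ?_
    have h3 : (1 / 2 : ℝ) ^ m ≤ (1 / 2) ^ l :=
      pow_le_pow_of_le_one (by norm_num) (by norm_num) hlm
    linarith [hc l r hr, hc m r hr]
  -- Fatou as m → ∞ turns the Cauchy bound and almost sure convergence into an L² rate.
  have h2 : ∀ l, eLpNorm (fun ω => ξ ω - Q l ω) 2 P ≤ κ * ENNReal.ofReal (2 * (1 / 2) ^ l) := by
    intro l
    refine (Lp.eLpNorm_lim_le_liminf_eLpNorm (f := fun m ω => Q m ω - Q l ω)
      (fun m => (hQm m).sub (hQm l)) _ ?_).trans ?_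
    · filter_upwards [hlim] with ω hω using hω.sub_const _
    · exact (liminf_le_liminf (eventually_atTop.2 ⟨l, fun m hm => h1 l m hm⟩)).trans
        (liminf_const _).le
  have h3 : Tendsto (fun l : ℕ => κ * ENNReal.ofReal (2 * (1 / 2) ^ l)) atTop (𝓝 0) := by
    have : Tendsto (fun l : ℕ => (2 * (1 / 2 : ℝ) ^ l)) atTop (𝓝 (2 * 0)) :=
      (tendsto_pow_atTop_nhds_zero_of_lt_one (by norm_num) (by norm_num)).const_mul 2
    have h4 := ENNReal.Tendsto.const_mul (ENNReal.tendsto_ofReal this) (Or.inr hκ')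
    simpa using h4
  have h4 : Tendsto (fun l : ℕ => (T : ℝ≥0∞) ^ (1 / 2 : ℝ) * ENNReal.ofReal ((1 / 2) ^ l)) atTop
      (𝓝 0) := by
    have : Tendsto (fun l : ℕ => ((1 / 2 : ℝ) ^ l)) atTop (𝓝 0) :=
      tendsto_pow_atTop_nhds_zero_of_lt_one (by norm_num) (by norm_num)
    have h4 := ENNReal.Tendsto.const_mul (ENNReal.tendsto_ofReal this)
      (a := (T : ℝ≥0∞) ^ (1 / 2 : ℝ)) (Or.inr (by simp))
    simpa using h4
  have hQL : MemLp (Q 0) 2 P := by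
    refine ⟨hQm 0, (eLpNorm_stepIntegral_le hW (huv 0) (hv 0) _).trans_lt
      (ENNReal.mul_lt_top (ENNReal.rpow_lt_top_of_nonneg (by norm_num) (by simp)) ?_)⟩
    have : MemLp (stepFun (u 0) (v 0) (c 0)) 2 (volume.restrict (Icc (0 : ℝ) T)) :=
      memLp_finsetSum _ fun j _ => (memLp_const (c 0 j)).indicator measurableSet_Ioc
    exact this.2
  refine ⟨hh, ?_, fun δ hδ => ?_⟩
  · have : ξ = (fun ω => ξ ω - Q 0 ω) + Q 0 := by ext; simp
    rw [this]
    exact MemLp.add ⟨hξm.sub (hQm 0), (h2 0).trans_lt (ENNReal.mul_lt_top hκ'.lt_top (by simp))⟩ hQL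
  · obtain ⟨l, hl1, hl2⟩ := ((h3.eventually (ge_mem_nhds hδ)).and
      (h4.eventually (ge_mem_nhds hδ))).exists
    exact ⟨k l, u l, v l, c l, fun j => ⟨huv l j, NNReal.coe_le_coe.2 (hv l j)⟩,
      (eLpNorm_restrict_Icc_le (hc l)).trans hl2, (h2 l).trans hl1⟩

lemma enorm_sq_le_ofReal {F : Type*} [SeminormedAddCommGroup F] {x : F} {C : ℝ} (h : ‖x‖ ≤ C) :
    ‖x‖ₑ ^ 2 ≤ ENNReal.ofReal (C ^ 2) := by
  rw [← ofReal_norm, ← ENNReal.ofReal_pow (norm_nonneg _)]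
  exact ENNReal.ofReal_le_ofReal (pow_le_pow_left₀ (norm_nonneg _) h 2)

/-- The Wiener integral process `s ↦ ∫₀ˢ h_r dW_r` of a continuous function, with continuous paths,
and its maximal inequality. -/
theorem exists_wienerIntegralProcess (hW : IsBrownianMotion W P) {T : ℝ≥0} {h : ℝ → E d}
    (hh : ContinuousOn h (Icc 0 T)) {L : ℝ} (hL : ∀ r ∈ Icc (0 : ℝ) T, ‖h r‖ ≤ L) :
    ∃ Y : ℝ≥0 → Ω → ℝ, (∀ᵐ ω ∂P, ContinuousOn (fun s => Y s ω) (Icc 0 T)) ∧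
      (∀ s ≤ T, Measurable[augmentedFiltration W P s] (Y s)) ∧
      (∀ a s, a ≤ s → s ≤ T → IsWienerIntegral W P T ((Ioc (a : ℝ) s).indicator h)
        (fun ω => Y s ω - Y a ω)) ∧
      (∀ a b, a ≤ b → b ≤ T → ∃ G : Ω → ℝ≥0∞, AEMeasurable G P ∧
        (∀ᵐ ω ∂P, ∀ s ∈ Icc a b, ‖Y s ω - Y a ω‖ₑ ^ 2 ≤ G ω) ∧
        ∫⁻ ω, G ω ∂P ≤ 4 * d * ENNReal.ofReal (L ^ 2 * (b - a))) := by
  choose k u v c huv hv hc using fun l : ℕ =>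
    exists_stepFun_approx hh (ε := (1 / 2) ^ l) (by positivity)
  -- The steps take values of h itself, so the maximal inequality keeps exactly the constant L.
  have hcL : ∀ l, ∀ r ∈ Ioc (0 : ℝ) T, ‖stepFun (u l) (v l) (c l) r‖ ≤ L := fun l r hr => by
    obtain ⟨r', hr', e⟩ := (hc l r hr).2
    rw [e]; exact hL r' hr'
  let N : ℕ → ℝ≥0 → Ω → ℝ := fun l s ω => elementaryIntegral W (u l) (v l) (c l) 0 s ω
  -- successive differences are dominated by a summable sequence
  choose G hGm hG hGle using fun l : ℕ => exists_bound_elementaryIntegral hW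
    (append_le_append (huv (l + 1)) (huv l)) (Fin.append (c (l + 1)) (-(c l)))
    (a := 0) (b := T) zero_le
  simp_rw [elementaryIntegral_append] at hG
  have hGle' : ∀ l, ∫⁻ ω, G l ω ∂P ≤ ENNReal.ofReal (4 * d * (4 * T) * (1 / 4) ^ l) := by
    intro l
    refine (hGle l).trans ?_
    have : ∀ r ∈ Ioc ((0 : ℝ≥0) : ℝ) T, ‖stepFun (Fin.append (u (l + 1)) (u l))
        (Fin.append (v (l + 1)) (v l)) (Fin.append (c (l + 1)) (-(c l))) r‖ₑ ^ 2 ≤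
          ENNReal.ofReal ((2 * (1 / 2) ^ l) ^ 2) := by
      intro r hr
      refine enorm_sq_le_ofReal ?_
      rw [stepFun_append, show stepFun (u (l + 1)) (v (l + 1)) (c (l + 1)) r -
        stepFun (u l) (v l) (c l) r = (h r - stepFun (u l) (v l) (c l) r) -
          (h r - stepFun (u (l + 1)) (v (l + 1)) (c (l + 1)) r) by abel]
      refine (norm_sub_le _ _).trans ?_
      have h1 := (hc l r hr).1
      have h2 := (hc (l + 1) r hr).1
      have h3 : (1 / 2 : ℝ) ^ (l + 1) ≤ (1 / 2) ^ l :=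
        pow_le_pow_of_le_one (by norm_num) (by norm_num) l.le_succ
      linarith
    refine (mul_le_mul_right (setLIntegral_mono measurable_const this) _).trans_eq ?_
    rw [setLIntegral_const, Real.volume_Ioc, ← ENNReal.ofReal_mul (by positivity),
      ← ENNReal.ofReal_natCast, show (4 : ℝ≥0∞) = ENNReal.ofReal 4 by simp,
      ← ENNReal.ofReal_mul (by norm_num), ← ENNReal.ofReal_mul (by positivity)]
    congr 1
    rw [mul_pow, ← pow_mul, mul_comm l 2, pow_mul]
    norm_num
    ring
  -- The means decay like 4⁻ˡ, which leaves room for the weight 2ˡ.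
  have hsum : ∀ᵐ ω ∂P, ∑' l, ENNReal.ofReal (2 ^ l) * G l ω < ∞ := by
    refine ae_lt_top' (AEMeasurable.tsum fun l => (hGm l).const_mul _) ?_
    rw [lintegral_tsum fun l => (hGm l).const_mul _]
    have hs : Summable fun l : ℕ => 4 * d * (4 * T) * (1 / 2 : ℝ) ^ l :=
      (summable_geometric_of_lt_one (by norm_num) (by norm_num)).mul_left _
    refine ne_top_of_le_ne_top hs.tsum_ofReal_ne_top (ENNReal.tsum_le_tsum fun l => ?_)
    rw [lintegral_const_mul' _ _ (by simp)]
    refine (mul_le_mul_right (hGle' l) _).trans_eq ?_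
    rw [← ENNReal.ofReal_mul (by positivity)]
    congr 1
    rw [show (1 / 2 : ℝ) = 2 * (1 / 4) by norm_num, mul_pow]
    ring
  -- Where the limit fails to exist this is an arbitrary value; for s ≤ T that happens only on a
  -- null set.
  let Y : ℝ≥0 → Ω → ℝ := fun s ω => limUnder atTop fun l => N l s ω
  have hunif : ∀ᵐ ω ∂P, TendstoUniformlyOn (fun l s => N l s ω) (fun s => Y s ω) atTop
      (Icc 0 T) := by
    filter_upwards [hsum, ae_all_iff.2 hG] with ω hω hGω
    -- From 2x ≤ 2⁻ˡ + 2ˡx², where x is the size of a difference and x² ≤ G l ω: no square root has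
    -- to be summed.
    set b : ℕ → ℝ := fun l => (1 / 2) ^ l + (ENNReal.ofReal (2 ^ l) * G l ω).toReal with hb
    have hbs : Summable b :=
      (summable_geometric_of_lt_one (by norm_num) (by norm_num)).add
        (ENNReal.summable_toReal hω.ne)
    have hstep : ∀ s ∈ Icc 0 T, ∀ l, dist (N l s ω) (N l.succ s ω) ≤ b l := by
      intro s hs l
      have h1 := hGω l s hs
      have hfin : ENNReal.ofReal (2 ^ l) * G l ω < ∞ := (ENNReal.le_tsum l).trans_lt hω
      have hGfin : G l ω ≠ ∞ := by
        rintro h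
        rw [h, ENNReal.mul_top (by simp)] at hfin
        exact lt_irrefl _ hfin
      rw [dist_comm, dist_eq_norm]
      set x : ℝ := ‖N l.succ s ω - N l s ω‖ with hx
      have h2 : x ^ 2 ≤ (G l ω).toReal := by
        rw [← ofReal_norm, ← ENNReal.ofReal_pow (norm_nonneg _)] at h1
        exact (ENNReal.ofReal_le_iff_le_toReal hGfin).1 h1
      simp only [hb, ENNReal.toReal_mul]
      rw [ENNReal.toReal_ofReal (by positivity)]
      have h3 : (0 : ℝ) < 2 ^ l := by positivity
      have h4 : (1 / 2 : ℝ) ^ l * 2 ^ l = 1 := by rw [← mul_pow]; norm_num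
      have h5 : (0 : ℝ) < (1 / 2) ^ l := by positivity
      have h6 : (2 : ℝ) ^ l * x ^ 2 ≤ 2 ^ l * (G l ω).toReal := by gcongr
      have h7 : 0 ≤ (1 / 2 : ℝ) ^ l * (1 - 2 ^ l * x) ^ 2 := by positivity
      have h8 : (1 / 2 : ℝ) ^ l * (1 - 2 ^ l * x) ^ 2 = (1 / 2) ^ l - 2 * x + 2 ^ l * x ^ 2 := by
        linear_combination (-2 * x + 2 ^ l * x ^ 2) * h4
      have h9 : 0 ≤ x := norm_nonneg _
      linarith
    have hlim : ∀ s ∈ Icc 0 T, Tendsto (fun l => N l s ω) atTop (𝓝 (Y s ω)) := fun s hs =>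
      CauchySeq.tendsto_limUnder (cauchySeq_of_dist_le_of_summable b (hstep s hs) hbs)
    rw [Metric.tendstoUniformlyOn_iff]
    intro ε hε
    have htail := tendsto_sum_nat_add b
    filter_upwards [htail.eventually (gt_mem_nhds hε)] with l hl s hs
    rw [dist_comm]
    refine (dist_le_tsum_of_dist_le_of_tendsto b (hstep s hs) hbs (hlim s hs) l).trans_lt ?_
    simpa [add_comm] using hl
  have hlim : ∀ᵐ ω ∂P, ∀ s ∈ Icc 0 T, Tendsto (fun l => N l s ω) atTop (𝓝 (Y s ω)) := by
    filter_upwards [hunif] with ω hω s hs using hω.tendsto_at hs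
  have hinc : ∀ a s, a ≤ s → ∀ l ω, N l s ω - N l a ω =
      elementaryIntegral W (u l) (v l) (c l) a s ω :=
    fun a s has l ω => elementaryIntegral_sub _ _ _ zero_le has ω
  refine ⟨Y, ?_, fun s hs => ?_, fun a s has hs => ?_, fun a b hab hb => ?_⟩
  · filter_upwards [hunif, continuous_brownian hW] with ω hω hc
    exact hω.continuousOn (Frequently.of_forall fun l =>
      (continuous_elementaryIntegral _ _ _ _ hc).continuousOn)
  · refine measurable_of_ae_tendsto (f := fun l => N l s) (fun l => ?_) ?_
    · exact measurable_stepIntegral (fun j => NNReal.coe_le_coe.2 (clamp_le zero_le))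
        (fun j => NNReal.coe_le_coe.2 (clamp_le zero_le)) _
    · filter_upwards [hlim] with ω hω using hω s ⟨zero_le, hs⟩
  · refine isWienerIntegral_of_tendsto hW (memLp_indicator_Ioc hh hL _ _)
      (u := fun l j => clamp a s (u l j)) (v := fun l j => clamp a s (v l j)) (c := c)
      (fun l j => clamp_mono (huv l j)) (fun l j => (clamp_le has).trans hs)
      (fun l r hr => ?_) ?_
    · rw [stepFun_clamp]
      simp only [indicator_apply]
      split_ifs
      · exact (hc l r hr).1
      · simp
    · filter_upwards [hlim] with ω hω
      have := (hω s ⟨zero_le, hs⟩).sub (hω a ⟨zero_le, has.trans hs⟩)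
      simp_rw [hinc a s has] at this
      exact this
  · choose G' hGm' hG' hGle' using fun l : ℕ => exists_bound_elementaryIntegral hW (huv l) (c l) hab
    refine ⟨fun ω => liminf (fun l => G' l ω) atTop, aemeasurable_liminf hGm', ?_, ?_⟩
    · filter_upwards [hlim, ae_all_iff.2 hG'] with ω hω hGω s hs
      have h1 := (hω s ⟨zero_le, hs.2.trans hb⟩).sub (hω a ⟨zero_le, hab.trans hb⟩)
      simp_rw [hinc a s hs.1] at h1
      have h2 := (ENNReal.continuous_pow 2).continuousAt.tendsto.comp h1.enorm
      rw [← h2.liminf_eq]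
      exact liminf_le_liminf (Eventually.of_forall fun l => hGω l s hs)
    · refine (lintegral_liminf_le' hGm').trans ?_
      refine (liminf_le_liminf (v := fun _ => 4 * d * ENNReal.ofReal (L ^ 2 * (b - a)))
        (Eventually.of_forall fun l => (hGle' l).trans ?_)).trans (liminf_const _).le
      have : ∀ r ∈ Ioc (a : ℝ) b, ‖stepFun (u l) (v l) (c l) r‖ₑ ^ 2 ≤
          ENNReal.ofReal (L ^ 2) := fun r hr =>
        enorm_sq_le_ofReal (hcL l r ⟨a.coe_nonneg.trans_lt hr.1,
          hr.2.trans (NNReal.coe_le_coe.2 hb)⟩)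
      refine mul_le_mul_right ((setLIntegral_mono measurable_const this).trans_eq ?_) _
      rw [setLIntegral_const, Real.volume_Ioc, ← ENNReal.ofReal_mul (by positivity)]

/-! ### The noise process -/

variable {Ω : Type*} [MeasurableSpace Ω] {P : Measure Ω} [IsProbabilityMeasure P] {m d : ℕ}
  {W : ℝ≥0 → Ω → E d}

/-- `Z` is a continuous version of `s ↦ ∫₀ˢ σ(r) dW_r` on `[0, T]`, for which the maximal inequality
holds with constant `C`. -/
structure IsNoiseProcess (W : ℝ≥0 → Ω → E d) (P : Measure Ω) (T : ℝ)
    (σ : ℝ → Matrix (Fin m) (Fin d) ℝ) (C : ℝ) (Z : ℝ → Ω → E m) : Prop where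
  continuous_paths : ∀ᵐ ω ∂P, ContinuousOn (fun s => Z s ω) (Icc 0 T)
  adapted : ∀ s ∈ Icc 0 T, Measurable[augmentedFiltration W P s] (Z s)
  integral : ∀ t ∈ Icc 0 T, IsNoiseIntegral W P T σ t (fun s ω => Z s ω - Z t ω)
  maximal : ∀ a b, 0 ≤ a → a ≤ b → b ≤ T → ∃ G : Ω → ℝ≥0∞, AEMeasurable G P ∧
    (∀ᵐ ω ∂P, ∀ s ∈ Icc a b, ‖Z s ω - Z a ω‖ₑ ^ 2 ≤ G ω) ∧
    ∫⁻ ω, G ω ∂P ≤ ENNReal.ofReal (C * (b - a))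

/-- The assumption bounds columns of σ, while each coordinate of the noise integrates a row. -/
lemma norm_row_le (A : Matrix (Fin m) (Fin d) ℝ) (i : Fin m) :
    ‖(WithLp.toLp 2 (A i) : E d)‖ ≤ ∑ j, ‖(WithLp.toLp 2 (fun i => A i j) : E m)‖ := by
  have h1 : ‖(WithLp.toLp 2 (A i) : E d)‖ ≤ ∑ j, |A i j| := by
    refine le_of_sq_le_sq ?_ (Finset.sum_nonneg fun _ _ => abs_nonneg _)
    rw [EuclideanSpace.norm_sq_eq]
    simp only [Real.norm_eq_abs]
    exact Finset.sum_sq_le_sq_sum_of_nonneg fun _ _ => abs_nonneg _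
  refine h1.trans (Finset.sum_le_sum fun j _ => ?_)
  exact PiLp.norm_apply_le (WithLp.toLp 2 (fun i => A i j) : E m) i

lemma continuousOn_row {T : ℝ} {σ : ℝ → Matrix (Fin m) (Fin d) ℝ}
    (hσ : ContinuousOn σ (Icc 0 T)) (i : Fin m) :
    ContinuousOn (fun r => (WithLp.toLp 2 (σ r i) : E d)) (Icc 0 T) :=
  (PiLp.continuous_toLp 2 _).comp_continuousOn ((continuous_apply i).comp_continuousOn hσ)

lemma enorm_sq_eq_sum (x : E m) : ‖x‖ₑ ^ 2 = ∑ i, ‖x i‖ₑ ^ 2 := by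
  simp_rw [← ofReal_norm, ← ENNReal.ofReal_pow (norm_nonneg _)]
  rw [EuclideanSpace.norm_sq_eq, ENNReal.ofReal_sum_of_nonneg fun i _ => sq_nonneg _]

/-- The coordinates are the Wiener integrals of the rows. In the constant, 4 is Doob's, d is from
Cauchy–Schwarz, L² bounds a row and m counts the rows. -/
theorem exists_noiseProcess (hW : IsBrownianMotion W P) {T L : ℝ} (hT : 0 ≤ T)
    {b : ℝ → E m → E m} {σ : ℝ → Matrix (Fin m) (Fin d) ℝ} (hA : CoeffAssumption T L b σ) :
    ∃ Z : ℝ → Ω → E m, IsNoiseProcess W P T σ (m * (4 * d * L ^ 2)) Z := by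
  lift T to ℝ≥0 using hT
  have hrow : ∀ i, ∀ r ∈ Icc (0 : ℝ) T, ‖(WithLp.toLp 2 (σ r i) : E d)‖ ≤ L := fun i r hr =>
    (norm_row_le (σ r) i).trans ((le_add_of_nonneg_left (norm_nonneg _)).trans (hA.bound r hr 0))
  choose Y hYc hYm hYi hYmax using fun i : Fin m =>
    exists_wienerIntegralProcess hW (continuousOn_row hA.continuous_σ i) (hrow i)
  have hpos : ∀ {s : ℝ}, s ∈ Icc (0 : ℝ) T → s.toNNReal ≤ T := fun {s} hs =>
    Real.toNNReal_le_iff_le_coe.2 hs.2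
  have hcont : ∀ᵐ ω ∂P, ContinuousOn
      (fun s : ℝ => (WithLp.toLp 2 (fun i => Y i s.toNNReal ω) : E m)) (Icc 0 T) := by
    filter_upwards [ae_all_iff.2 hYc] with ω hω
    refine (PiLp.continuous_toLp 2 _).comp_continuousOn (continuousOn_pi.2 fun i => ?_)
    exact (hω i).comp continuous_real_toNNReal.continuousOn fun s hs => ⟨zero_le, hpos hs⟩
  refine ⟨fun s ω => WithLp.toLp 2 (fun i => Y i s.toNNReal ω), ⟨hcont, fun s hs => ?_,
    fun t ht => ⟨fun s hs i => ?_, ?_⟩, fun a b' ha hab hb => ?_⟩⟩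
  · have h1 : ∀ i, Measurable[augmentedFiltration W P s] (Y i s.toNNReal) := fun i => by
      have := hYm i s.toNNReal (hpos hs)
      rwa [Real.coe_toNNReal _ hs.1] at this
    have h2 : Measurable[augmentedFiltration W P s] fun ω i => Y i s.toNNReal ω :=
      @measurable_pi_lambda _ _ _ (augmentedFiltration W P s) _ _ h1
    exact (WithLp.measurable_toLp 2 _).comp h2
  · have hs0 : 0 ≤ s := ht.1.trans hs.1
    have := hYi i t.toNNReal s.toNNReal (Real.toNNReal_le_toNNReal hs.1) (hpos ⟨hs0, hs.2⟩)
    rwa [Real.coe_toNNReal _ hs0, Real.coe_toNNReal _ ht.1] at this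
  · filter_upwards [hcont] with ω hω
    exact (hω.mono (Icc_subset_Icc_left ht.1)).sub continuousOn_const
  · lift a to ℝ≥0 using ha
    lift b' to ℝ≥0 using a.coe_nonneg.trans hab
    choose G hGm hG hGle using fun i => hYmax i a b' hab hb
    refine ⟨fun ω => ∑ i, G i ω, Finset.aemeasurable_fun_sum _ fun i _ => hGm i, ?_, ?_⟩
    · filter_upwards [ae_all_iff.2 hG] with ω hω s hs
      rw [enorm_sq_eq_sum]
      refine Finset.sum_le_sum fun i _ => ?_
      have := hω i s.toNNReal ⟨NNReal.le_toNNReal_of_coe_le hs.1,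
        Real.toNNReal_le_iff_le_coe.2 hs.2⟩
      simpa using this
    · rw [lintegral_finsetSum' _ fun i _ => hGm i]
      refine (Finset.sum_le_sum fun i _ => hGle i).trans_eq ?_
      rw [Finset.sum_const, Finset.card_univ, Fintype.card_fin, nsmul_eq_mul,
        ← ENNReal.ofReal_natCast, ← ENNReal.ofReal_natCast,
        show (4 : ℝ≥0∞) = ENNReal.ofReal 4 by simp, ← ENNReal.ofReal_mul (by norm_num),
        ← ENNReal.ofReal_mul (by positivity), ← ENNReal.ofReal_mul (by positivity)]
      congr 1
      ring

/-- Every noise integral started at `t` is the increment of the noise process. -/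
lemma IsNoiseProcess.eq_of_isNoiseIntegral (hW : IsBrownianMotion W P) {T C : ℝ}
    {σ : ℝ → Matrix (Fin m) (Fin d) ℝ} {Z : ℝ → Ω → E m} (hZ : IsNoiseProcess W P T σ C Z)
    {t : ℝ} (ht : t ∈ Icc 0 T) {M : ℝ → Ω → E m} (hM : IsNoiseIntegral W P T σ t M) :
    ∀ᵐ ω ∂P, ∀ s ∈ Icc t T, M s ω = Z s ω - Z t ω := by
  have hT : 0 ≤ T := ht.1.trans ht.2
  have hM' := hZ.integral t ht
  lift T to ℝ≥0 using hT
  have h1 : ∀ s ∈ Icc t (T : ℝ), ∀ᵐ ω ∂P, M s ω = Z s ω - Z t ω := by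
    intro s hs
    filter_upwards [ae_all_iff.2 fun i => (hM.integral s hs i).ae_eq hW (hM'.integral s hs i)]
      with ω hω
    ext i
    exact hω i
  -- The exceptional null set depends on the time; a countable dense set and continuity give a
  -- common one.
  obtain ⟨D, hDc, hDd⟩ := TopologicalSpace.exists_countable_dense (Icc t (T : ℝ))
  have h2 : ∀ᵐ ω ∂P, ∀ s ∈ D, M s ω = Z s ω - Z t ω :=
    (ae_ball_iff hDc).2 fun s _ => h1 s s.2
  filter_upwards [h2, hM.continuous_paths, hM'.continuous_paths] with ω h h3 h4 s hs
  have := Continuous.ext_on hDd (continuousOn_iff_continuous_domRestrict.1 h3)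
    (continuousOn_iff_continuous_domRestrict.1 h4) (fun s hs => h s hs)
  exact congrFun this ⟨s, hs⟩

/-! ### The integral equation along a single path -/

section Deterministic

variable {m d : ℕ} {T L : ℝ} {b : ℝ → E m → E m} {σ : ℝ → Matrix (Fin m) (Fin d) ℝ}

/-- `y` solves `y_s = ∫ₜˢ b(r, y_r) dr + w_s` on `[t, s₁]`. -/
structure IsPathSolution (b : ℝ → E m → E m) (t s₁ : ℝ) (w y : ℝ → E m) : Prop where
  continuousOn : ContinuousOn y (Icc t s₁)
  equation : ∀ s ∈ Icc t s₁, y s = (∫ r in t..s, b r (y r)) + w s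

lemma CoeffAssumption.continuousOn_comp (hA : CoeffAssumption T L b σ) {t s₁ : ℝ} (ht : 0 ≤ t)
    (hs : s₁ ≤ T) {y : ℝ → E m} (hy : ContinuousOn y (Icc t s₁)) :
    ContinuousOn (fun r => b r (y r)) (Icc t s₁) :=
  hA.continuous_b.comp (continuousOn_id.prodMk hy) fun _ hr =>
    ⟨⟨ht.trans hr.1, hr.2.trans hs⟩, mem_univ _⟩

lemma CoeffAssumption.norm_b_le (hA : CoeffAssumption T L b σ) {r : ℝ} (hr : r ∈ Icc 0 T)
    (x : E m) : ‖b r x‖ ≤ L :=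
  (le_add_of_nonneg_right (Finset.sum_nonneg fun _ _ => norm_nonneg _)).trans (hA.bound r hr x)

lemma IsPathSolution.mono {t s₁ s₂ : ℝ} {w y : ℝ → E m} (h : IsPathSolution b t s₁ w y)
    (hs : s₂ ≤ s₁) : IsPathSolution b t s₂ w y :=
  ⟨h.continuousOn.mono (Icc_subset_Icc_right hs), fun s hs' =>
    h.equation s ⟨hs'.1, hs'.2.trans hs⟩⟩

/-- Restarting a solution at a later time. -/
lemma IsPathSolution.restart (hA : CoeffAssumption T L b σ) {t t' s₁ : ℝ} {w y : ℝ → E m}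
    (ht : 0 ≤ t) (htt' : t ≤ t') (hs₁ : s₁ ≤ T) (h : IsPathSolution b t s₁ w y) :
    IsPathSolution b t' s₁ (fun s => y t' + (w s - w t')) y := by
  refine ⟨h.continuousOn.mono (Icc_subset_Icc_left htt'), fun s hs => ?_⟩
  have hc := hA.continuousOn_comp ht hs₁ h.continuousOn
  have h1 : IntervalIntegrable (fun r => b r (y r)) volume t t' :=
    (hc.mono (Icc_subset_Icc_right (hs.1.trans hs.2))).intervalIntegrable_of_Icc htt'
  have h2 : IntervalIntegrable (fun r => b r (y r)) volume t' s :=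
    (hc.mono (Icc_subset_Icc htt' hs.2)).intervalIntegrable_of_Icc hs.1
  rw [h.equation t' ⟨htt', hs.1.trans hs.2⟩]
  conv_lhs => rw [h.equation s ⟨htt'.trans hs.1, hs.2⟩,
    ← intervalIntegral.integral_add_adjacent_intervals h1 h2]
  abel

/-- Solutions depend Lipschitz continuously on the driving path. -/
lemma IsPathSolution.norm_sub_le (hA : CoeffAssumption T L b σ) {t s₁ : ℝ} {w w' y y' : ℝ → E m}
    (ht : 0 ≤ t) (hts : t ≤ s₁) (hs₁ : s₁ ≤ T) (h : IsPathSolution b t s₁ w y)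
    (h' : IsPathSolution b t s₁ w' y') {A : ℝ} (hw : ∀ s ∈ Icc t s₁, ‖w s - w' s‖ ≤ A) :
    ‖y s₁ - y' s₁‖ ≤ A * Real.exp (L * (s₁ - t)) := by
  -- The drivers are not assumed differentiable, so Grönwall is applied to the drift part alone.
  set D : ℝ → E m := fun s => ∫ r in t..s, (b r (y r) - b r (y' r)) with hD
  have hc : ContinuousOn (fun r => b r (y r) - b r (y' r)) (Icc t s₁) :=
    (hA.continuousOn_comp ht hs₁ h.continuousOn).sub (hA.continuousOn_comp ht hs₁ h'.continuousOn)
  have hdiff : ∀ s ∈ Icc t s₁, y s - y' s = D s + (w s - w' s) := by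
    intro s hs
    have h1 : IntervalIntegrable (fun r => b r (y r)) volume t s :=
      ((hA.continuousOn_comp ht hs₁ h.continuousOn).mono
        (Icc_subset_Icc_right hs.2)).intervalIntegrable_of_Icc hs.1
    have h2 : IntervalIntegrable (fun r => b r (y' r)) volume t s :=
      ((hA.continuousOn_comp ht hs₁ h'.continuousOn).mono
        (Icc_subset_Icc_right hs.2)).intervalIntegrable_of_Icc hs.1
    simp only [hD]
    rw [intervalIntegral.integral_sub h1 h2, h.equation s hs, h'.equation s hs]
    abel
  have hint : IntervalIntegrable (fun r => b r (y r) - b r (y' r)) volume t s₁ :=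
    hc.intervalIntegrable_of_Icc hts
  have hDc : ContinuousOn D (Icc t s₁) := by
    have := intervalIntegral.continuousOn_primitive_interval (μ := volume)
      (f := fun r => b r (y r) - b r (y' r)) (a := t) (b := s₁) (by
        rw [uIcc_of_le hts]
        exact hc.integrableOn_Icc)
    rwa [uIcc_of_le hts] at this
  have hDd : ∀ s ∈ Ico t s₁, HasDerivWithinAt D (b s (y s) - b s (y' s)) (Ici s) s := by
    intro s hs
    have hmem : Icc t s₁ ∈ 𝓝[>] s :=
      mem_of_superset (Ioc_mem_nhdsGT hs.2) fun r hr => ⟨hs.1.trans hr.1.le, hr.2⟩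
    refine intervalIntegral.integral_hasDerivWithinAt_right
      (hint.mono_set (by
        rw [uIcc_of_le hs.1, uIcc_of_le hts]; exact Icc_subset_Icc_right hs.2.le))
      (t := Ioi s) ?_ ?_
    · exact ⟨Icc t s₁, hmem, hc.aestronglyMeasurable measurableSet_Icc⟩
    · exact (hc s ⟨hs.1, hs.2.le⟩).mono_of_mem_nhdsWithin hmem
  have hgr := norm_le_gronwallBound_of_norm_deriv_right_le (δ := 0) (K := L) (ε := L * A) hDc hDd
    (by simp [hD]) (fun s hs => by
      have hs' : s ∈ Icc t s₁ := ⟨hs.1, hs.2.le⟩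
      refine (hA.lipschitz s ⟨ht.trans hs.1, hs'.2.trans hs₁⟩ _ _).trans ?_
      rw [← mul_add]
      refine mul_le_mul_of_nonneg_left ?_ hA.L_pos.le
      rw [hdiff s hs']
      exact (norm_add_le _ _).trans (add_le_add_right (hw s hs') _)) s₁ ⟨hts, le_rfl⟩
  -- Grönwall gives A(e^{L(s₁−t)} − 1) for D; the driver difference contributes the missing A.
  rw [gronwallBound_of_K_ne_0 hA.L_pos.ne', mul_div_cancel_left₀ _ hA.L_pos.ne'] at hgr
  simp only [zero_mul, zero_add] at hgr
  rw [hdiff s₁ ⟨hts, le_rfl⟩]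
  refine (norm_add_le _ _).trans ?_
  have := hw s₁ ⟨hts, le_rfl⟩
  linarith

/-- Existence of solutions, by the Picard–Lindelöf theorem for `y - w`. -/
lemma exists_isPathSolution (hA : CoeffAssumption T L b σ) {t s₁ : ℝ} {w : ℝ → E m}
    (ht : 0 ≤ t) (hts : t ≤ s₁) (hs₁ : s₁ ≤ T) (hw : ContinuousOn w (Icc t s₁)) :
    ∃ y, IsPathSolution b t s₁ w y := by
  have hmem : ∀ {r}, r ∈ Icc t s₁ → r ∈ Icc 0 T := fun hr => ⟨ht.trans hr.1, hr.2.trans hs₁⟩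
  -- As |b| ≤ L, the ball of radius L(s₁ − t) is never left, so the whole interval is covered at
  -- once.
  have hPL : IsPicardLindelof (fun r z => b r (z + w r)) (tmin := t) (tmax := s₁)
      ⟨t, le_rfl, hts⟩ (0 : E m) (L.toNNReal * (s₁ - t).toNNReal) 0 L.toNNReal L.toNNReal := by
    refine ⟨fun r hr => ?_, fun z _ => ?_, fun r hr z _ => ?_, ?_⟩
    · refine LipschitzWith.lipschitzOnWith (LipschitzWith.of_dist_le_mul fun z z' => ?_)
      rw [dist_eq_norm, Real.coe_toNNReal _ hA.L_pos.le]
      refine (hA.lipschitz r (hmem hr) _ _).trans_eq ?_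
      rw [dist_eq_norm]; congr 2; abel
    · exact hA.continuousOn_comp ht hs₁ (continuousOn_const.add hw)
    · rw [Real.coe_toNNReal _ hA.L_pos.le]
      exact hA.norm_b_le (hmem hr) _
    · simp [hts, Real.coe_toNNReal _ hA.L_pos.le, Real.coe_toNNReal _ (sub_nonneg.2 hts)]
  obtain ⟨z, hz0, hz⟩ := hPL.exists_eq_forall_mem_Icc_hasDerivWithinAt (x := 0) (by simp)
  have hzc : ContinuousOn z (Icc t s₁) := fun r hr => (hz r hr).continuousWithinAt
  refine ⟨fun r => z r + w r, hzc.add hw, fun s hs => ?_⟩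
  have hc := hA.continuousOn_comp ht hs₁ (hzc.add hw)
  have := intervalIntegral.integral_eq_sub_of_hasDeriv_right_of_le hs.1
    (hzc.mono (Icc_subset_Icc_right hs.2)) (f' := fun r => b r (z r + w r)) (fun r hr => by
      have hr' : r ∈ Ioo t s₁ := ⟨hr.1, hr.2.trans_le hs.2⟩
      exact ((hz r ⟨hr'.1.le, hr'.2.le⟩).hasDerivAt (Icc_mem_nhds hr'.1 hr'.2)).hasDerivWithinAt)
    ((hc.mono (Icc_subset_Icc_right hs.2)).intervalIntegrable_of_Icc hs.1)
  rw [this]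
  simp only at hz0
  rw [hz0, sub_zero]

lemma IsPathSolution.eq (hA : CoeffAssumption T L b σ) {t s₁ : ℝ} {w y y' : ℝ → E m}
    (ht : 0 ≤ t) (hs₁ : s₁ ≤ T) (h : IsPathSolution b t s₁ w y)
    (h' : IsPathSolution b t s₁ w y') {s : ℝ} (hs : s ∈ Icc t s₁) : y s = y' s := by
  have := (h.mono hs.2).norm_sub_le hA ht hs.1 (hs.2.trans hs₁) (h'.mono hs.2) (A := 0)
    (fun _ _ => by simp)
  rw [zero_mul] at this
  exact sub_eq_zero.1 (norm_le_zero_iff.1 this)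

lemma IsPathSolution.norm_sub_driver_le (hA : CoeffAssumption T L b σ) {t s₁ : ℝ} {w y : ℝ → E m}
    (ht : 0 ≤ t) (hs₁ : s₁ ≤ T) (h : IsPathSolution b t s₁ w y) {s : ℝ} (hs : s ∈ Icc t s₁) :
    ‖y s - w s‖ ≤ L * (s - t) := by
  rw [h.equation s hs, add_sub_cancel_right]
  refine (intervalIntegral.norm_integral_le_of_norm_le_const (C := L) fun r hr => ?_).trans_eq ?_
  · rw [uIoc_of_le hs.1] at hr
    exact hA.norm_b_le ⟨ht.trans hr.1.le, hr.2.trans (hs.2.trans hs₁)⟩ _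
  · rw [abs_of_nonneg (sub_nonneg.2 hs.1)]

end Deterministic

/-! ### Bernstein interpolation of paths -/

section Interpolation

variable {m : ℕ}

/-- The Bernstein interpolation on `[t, s]` of the values `y` at the `n + 1` equidistant points. -/
def interpolation (t s : ℝ) {n : ℕ} (y : Fin (n + 1) → E m) (r : ℝ) : E m :=
  ∑ k : Fin (n + 1), bernstein n k (projIcc 0 1 zero_le_one ((r - t) / (s - t))) • y k

/-- The equidistant points of `[t, s]`. -/
def gridPoint (t s : ℝ) {n : ℕ} (k : Fin (n + 1)) : ℝ := t + (s - t) * ((k : ℕ) / n : ℝ)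

lemma gridPoint_mem {t s : ℝ} (hts : t ≤ s) {n : ℕ} (k : Fin (n + 1)) :
    gridPoint t s k ∈ Icc t s := by
  have h1 : (0 : ℝ) ≤ (k : ℕ) / n := by positivity
  have h2 : ((k : ℕ) / n : ℝ) ≤ 1 := div_le_one_of_le₀ (by exact_mod_cast k.is_le) (by positivity)
  unfold gridPoint
  constructor <;> nlinarith

lemma continuous_interpolation (t s : ℝ) {n : ℕ} (y : Fin (n + 1) → E m) :
    Continuous (interpolation t s y) := by
  unfold interpolation
  refine continuous_finsetSum _ fun k _ => ?_
  have h : Continuous fun r : ℝ => bernstein n k (projIcc 0 1 zero_le_one ((r - t) / (s - t))) :=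
    (bernstein n k).continuous.comp (continuous_projIcc.comp (by fun_prop))
  exact h.smul continuous_const

/-- Bernstein weights are nonnegative with sum one. Being a contraction for the maximum norm is what
keeps later constants independent of n. -/
lemma norm_interpolation_sub_le (t s : ℝ) {n : ℕ} (y y' : Fin (n + 1) → E m) (r : ℝ) :
    ‖interpolation t s y r - interpolation t s y' r‖ ≤ ‖y - y'‖ := by
  simp only [interpolation, ← Finset.sum_sub_distrib, ← smul_sub]
  refine (norm_sum_le _ _).trans ?_
  calc _ ≤ ∑ k : Fin (n + 1), bernstein n k (projIcc 0 1 zero_le_one ((r - t) / (s - t))) *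
        ‖y - y'‖ := by
        refine Finset.sum_le_sum fun k _ => ?_
        rw [norm_smul, Real.norm_of_nonneg bernstein_nonneg]
        exact mul_le_mul_of_nonneg_left (norm_le_pi_norm (y - y') k) bernstein_nonneg
    _ = _ := by rw [← Finset.sum_mul, bernstein.probability, one_mul]

lemma tendsto_interpolation {t s : ℝ} (hts : t < s) {f : ℝ → E m} (hf : ContinuousOn f (Icc t s))
    {ε : ℝ} (hε : 0 < ε) : ∀ᶠ n : ℕ in atTop, ∀ r ∈ Icc t s,
      ‖f r - interpolation t s (fun k : Fin (n + 1) => f (gridPoint t s k)) r‖ ≤ ε := by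
  have hst : 0 < s - t := sub_pos.2 hts
  have hmaps : ∀ q : unitInterval, t + (s - t) * (q : ℝ) ∈ Icc t s := fun q => by
    have := q.2.1; have := q.2.2
    constructor <;> nlinarith
  let g : C(unitInterval, E m) := ⟨fun q => f (t + (s - t) * (q : ℝ)), by
    rw [← continuousOn_univ]
    exact hf.comp (by fun_prop) fun q _ => hmaps q⟩
  have := Metric.tendsto_nhds.1 (bernsteinApproximation_uniform g) ε hε
  filter_upwards [this] with n hn r hr
  have h1 := (ContinuousMap.dist_lt_iff hε).1 hn (projIcc 0 1 zero_le_one ((r - t) / (s - t)))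
  have hq : (r - t) / (s - t) ∈ Icc (0 : ℝ) 1 :=
    ⟨div_nonneg (sub_nonneg.2 hr.1) hst.le, div_le_one_of_le₀ (by linarith [hr.2]) hst.le⟩
  rw [bernsteinApproximation.apply, dist_comm, dist_eq_norm] at h1
  have h2 : g (projIcc 0 1 zero_le_one ((r - t) / (s - t))) = f r := by
    simp only [g, ContinuousMap.coe_mk, projIcc_of_mem _ hq]
    congr 1
    field_simp
    ring
  rw [h2] at h1
  exact h1.le

end Interpolation

/-! ### Solutions driven by finitely many noise values -/

section GridSolution

variable {m d : ℕ} {T L : ℝ} {b : ℝ → E m → E m} {σ : ℝ → Matrix (Fin m) (Fin d) ℝ}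

open Classical in
/-- The value at time `s` of the solution started from `x` at time `t` and driven by `ε` times the
Bernstein interpolation of the values `y`. -/
def gridSolution (b : ℝ → E m → E m) (t s : ℝ) (x : E m) (ε : ℝ) {n : ℕ}
    (y : Fin (n + 1) → E m) : E m :=
  if h : ∃ z, IsPathSolution b t s (fun r => x + ε • interpolation t s y r) z then h.choose s else 0

lemma gridSolution_spec (hA : CoeffAssumption T L b σ) {t s : ℝ} (ht : 0 ≤ t) (hts : t ≤ s)
    (hs : s ≤ T) (x : E m) (ε : ℝ) {n : ℕ} (y : Fin (n + 1) → E m) :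
    ∃ z, IsPathSolution b t s (fun r => x + ε • interpolation t s y r) z ∧
      gridSolution b t s x ε y = z s := by
  have h : ∃ z, IsPathSolution b t s (fun r => x + ε • interpolation t s y r) z :=
    exists_isPathSolution hA ht hts hs (continuous_const.add
      ((continuous_interpolation t s y).const_smul ε)).continuousOn
  exact ⟨h.choose, h.choose_spec, by rw [gridSolution, dif_pos h]⟩

lemma CoeffAssumption.exp_le (hA : CoeffAssumption T L b σ) {t s : ℝ} (ht : 0 ≤ t) (hs : s ≤ T) :
    Real.exp (L * (s - t)) ≤ Real.exp (L * T) :=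
  Real.exp_le_exp.2 (mul_le_mul_of_nonneg_left (by linarith) hA.L_pos.le)

/-- Interpolation contracts and ε ≤ 1, so only the Grönwall factor remains. Its independence of n is
the source of the uniform Malliavin bound. -/
lemma norm_gridSolution_sub_le (hA : CoeffAssumption T L b σ) {t s : ℝ} (ht : 0 ≤ t) (hts : t ≤ s)
    (hs : s ≤ T) (x : E m) {ε : ℝ} (hε : ε ∈ Icc (0 : ℝ) 1) {n : ℕ} (y y' : Fin (n + 1) → E m) :
    ‖gridSolution b t s x ε y - gridSolution b t s x ε y'‖ ≤ Real.exp (L * T) * ‖y - y'‖ := by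
  obtain ⟨z, hz, e⟩ := gridSolution_spec hA ht hts hs x ε y
  obtain ⟨z', hz', e'⟩ := gridSolution_spec hA ht hts hs x ε y'
  rw [e, e', mul_comm]
  refine (hz.norm_sub_le hA ht hts hs hz' (A := ‖y - y'‖) fun r _ => ?_).trans
    (mul_le_mul_of_nonneg_left (hA.exp_le ht hs) (norm_nonneg _))
  rw [add_sub_add_left_eq_sub, ← smul_sub, norm_smul, Real.norm_of_nonneg hε.1]
  exact (mul_le_of_le_one_left (norm_nonneg _) hε.2).trans (norm_interpolation_sub_le _ _ _ _ _)

lemma continuous_gridSolution (hA : CoeffAssumption T L b σ) {t s : ℝ} (ht : 0 ≤ t) (hts : t ≤ s)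
    (hs : s ≤ T) (x : E m) {ε : ℝ} (hε : ε ∈ Icc (0 : ℝ) 1) (n : ℕ) :
    Continuous fun y : Fin (n + 1) → E m => gridSolution b t s x ε y :=
  (LipschitzWith.of_dist_le_mul (K := ⟨Real.exp (L * T), (Real.exp_pos _).le⟩) fun y y' => by
    rw [dist_eq_norm, dist_eq_norm]
    exact norm_gridSolution_sub_le hA ht hts hs x hε y y').continuous

/-- The grid solutions converge to the solution. -/
lemma norm_sub_gridSolution_le (hA : CoeffAssumption T L b σ) {t s : ℝ} (ht : 0 ≤ t) (hts : t ≤ s)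
    (hs : s ≤ T) (x : E m) {ε : ℝ} (hε : ε ∈ Icc (0 : ℝ) 1) {f z : ℝ → E m}
    (hz : IsPathSolution b t s (fun r => x + ε • f r) z) {n : ℕ} {A : ℝ}
    (hf : ∀ r ∈ Icc t s,
      ‖f r - interpolation t s (fun k : Fin (n + 1) => f (gridPoint t s k)) r‖ ≤ A) :
    ‖z s - gridSolution b t s x ε (fun k : Fin (n + 1) => f (gridPoint t s k))‖ ≤
      A * Real.exp (L * T) := by
  obtain ⟨z', hz', e⟩ := gridSolution_spec hA ht hts hs x ε
    (fun k : Fin (n + 1) => f (gridPoint t s k))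
  have hA0 : 0 ≤ A := (norm_nonneg _).trans (hf t ⟨le_rfl, hts⟩)
  rw [e]
  refine (hz.norm_sub_le hA ht hts hs hz' (A := A) fun r hr => ?_).trans
    (mul_le_mul_of_nonneg_left (hA.exp_le ht hs) hA0)
  rw [add_sub_add_left_eq_sub, ← smul_sub, norm_smul, Real.norm_of_nonneg hε.1]
  exact (mul_le_of_le_one_left (norm_nonneg _) hε.2).trans (hf r hr)

lemma tendsto_gridSolution (hA : CoeffAssumption T L b σ) {t s : ℝ} (ht : 0 ≤ t) (hts : t < s)
    (hs : s ≤ T) (x : E m) {ε : ℝ} (hε : ε ∈ Icc (0 : ℝ) 1) {f z : ℝ → E m}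
    (hf : ContinuousOn f (Icc t s)) (hz : IsPathSolution b t s (fun r => x + ε • f r) z) :
    Tendsto (fun n : ℕ => gridSolution b t s x ε (fun k : Fin (n + 1) => f (gridPoint t s k)))
      atTop (𝓝 (z s)) := by
  rw [tendsto_iff_norm_sub_tendsto_zero, Metric.tendsto_nhds]
  intro δ hδ
  have hpos := Real.exp_pos (L * T)
  filter_upwards [tendsto_interpolation hts hf (ε := δ / 2 / Real.exp (L * T)) (by positivity)]
    with n hn
  have := norm_sub_gridSolution_le hA ht hts.le hs x hε hz hn
  rw [dist_zero_right, norm_norm, norm_sub_rev]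
  refine this.trans_lt ?_
  rw [div_mul_cancel₀ _ hpos.ne']
  linarith

end GridSolution

/-! ### Existence, uniqueness and stability -/

section Solutions

variable {Ω : Type*} [MeasurableSpace Ω] {P : Measure Ω} [IsProbabilityMeasure P] {m d : ℕ}
  {W : ℝ≥0 → Ω → E d} {T L C : ℝ} {b : ℝ → E m → E m} {σ : ℝ → Matrix (Fin m) (Fin d) ℝ}
  {Z : ℝ → Ω → E m}

/-- The maximal inequality with a finite dominating random variable. -/
lemma IsNoiseProcess.exists_bound (hZ : IsNoiseProcess W P T σ C Z) {a c : ℝ} (ha : 0 ≤ a)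
    (hac : a ≤ c) (hc : c ≤ T) : ∃ g : Ω → ℝ, AEMeasurable g P ∧ (∀ ω, 0 ≤ g ω) ∧
      (∀ᵐ ω ∂P, ∀ s ∈ Icc a c, ‖Z s ω - Z a ω‖ ^ 2 ≤ g ω) ∧
      ∫⁻ ω, ENNReal.ofReal (g ω) ∂P ≤ ENNReal.ofReal (C * (c - a)) := by
  obtain ⟨G, hGm, hG, hGle⟩ := hZ.maximal a c ha hac hc
  have hfin := ae_lt_top' hGm (hGle.trans_lt ENNReal.ofReal_lt_top).ne
  refine ⟨fun ω => (G ω).toReal, hGm.ennreal_toReal, fun _ => ENNReal.toReal_nonneg, ?_, ?_⟩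
  · filter_upwards [hG, hfin] with ω h h' s hs
    have := h s hs
    rw [← ofReal_norm, ← ENNReal.ofReal_pow (norm_nonneg _)] at this
    exact (ENNReal.ofReal_le_iff_le_toReal h'.ne).1 this
  · exact (lintegral_mono fun ω => ENNReal.ofReal_toReal_le).trans hGle

/-- The paths of a solution solve the integral equation driven by the noise process. -/
lemma IsSolution.ae_isPathSolution (hW : IsBrownianMotion W P) (hZ : IsNoiseProcess W P T σ C Z)
    {ε t : ℝ} (ht : t ∈ Ico 0 T) {x : E m} {X : ℝ → Ω → E m}
    (hX : IsSolution W P T b σ ε t x X) :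
    ∀ᵐ ω ∂P, IsPathSolution b t T (fun s => x + ε • (Z s ω - Z t ω)) (fun s => X s ω) := by
  obtain ⟨M, hM, heq⟩ := hX.equation
  filter_upwards [hX.memS2.continuous_paths, heq,
    hZ.eq_of_isNoiseIntegral hW ⟨ht.1, ht.2.le⟩ hM] with ω h1 h2 h3
  refine ⟨h1.mono (Icc_subset_Icc_left ht.1), fun s hs => ?_⟩
  rw [h2 s hs, h3 s hs]
  abel

lemma sq_add_sq_le (a b : ℝ) : (a + b) ^ 2 ≤ 2 * a ^ 2 + 2 * b ^ 2 := by
  nlinarith [sq_nonneg (a - b)]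

theorem exists_isSolution (hA : CoeffAssumption T L b σ) (hZ : IsNoiseProcess W P T σ C Z)
    {ε t : ℝ} (hε : ε ∈ Icc (0 : ℝ) 1) (ht : t ∈ Ico 0 T) (x : E m) :
    ∃ X, IsSolution W P T b σ ε t x X := by
  classical
  let w : Ω → ℝ → E m := fun ω s => x + ε • (Z s ω - Z t ω)
  -- The default x after time t is taken only when the path has no solution, which happens on a null
  -- set.
  let X : ℝ → Ω → E m := fun s ω => if s ≤ t then x else
    if h : ∃ y, IsPathSolution b t T (w ω) y then h.choose s else x
  have ht' : t ∈ Icc 0 T := ⟨ht.1, ht.2.le⟩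
  have hpath : ∀ᵐ ω ∂P, ContinuousOn (fun s => Z s ω) (Icc 0 T) ∧
      ∃ y, IsPathSolution b t T (w ω) y ∧ ∀ s, X s ω = y (max s t) := by
    filter_upwards [hZ.continuous_paths] with ω hω
    have h : ∃ y, IsPathSolution b t T (w ω) y := exists_isPathSolution hA ht.1 ht.2.le le_rfl
      (continuousOn_const.add (((hω.mono (Icc_subset_Icc_left ht.1)).sub
        continuousOn_const).const_smul ε))
    have h0 : h.choose t = x := by
      rw [h.choose_spec.equation t ⟨le_rfl, ht.2.le⟩]
      simp [w]
    refine ⟨hω, h.choose, h.choose_spec, fun s => ?_⟩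
    by_cases hs : s ≤ t
    · simp only [X, if_pos hs, max_eq_right hs, h0]
    · simp only [X, if_neg hs, dif_pos h, max_eq_left (le_of_not_ge hs)]
  have hpath' : ∀ᵐ ω ∂P, IsPathSolution b t T (w ω) (fun s => X s ω) := by
    filter_upwards [hpath] with ω ⟨_, y, hy, hXy⟩
    have : ∀ s ∈ Icc t T, X s ω = y s := fun s hs => by rw [hXy, max_eq_left hs.1]
    refine ⟨hy.continuousOn.congr this, fun s hs => ?_⟩
    rw [this s hs, hy.equation s hs]
    congr 1
    refine intervalIntegral.integral_congr fun r hr => ?_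
    rw [uIcc_of_le hs.1] at hr
    simp only [this r ⟨hr.1, hr.2.trans hs.2⟩]
  refine ⟨X, ⟨fun s hs => ?_, ?_, ?_⟩, ?_, ?_⟩
  · rcases le_or_gt s t with hst | hst
    · have : X s = fun _ => x := by ext1 ω; simp only [X, if_pos hst]
      rw [this]
      exact measurable_const
    -- Adaptedness without measurable selection: X_s is an almost sure limit of continuous functions
    -- of noise values at times up to s.
    · refine measurable_of_ae_tendsto (f := fun n ω => gridSolution b t s x ε
        (fun k : Fin (n + 1) => Z (gridPoint t s k) ω - Z t ω)) (fun n => ?_) ?_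
      · refine (continuous_gridSolution hA ht.1 hst.le hs.2 x hε n).measurable.comp ?_
        refine @measurable_pi_lambda _ _ _ (augmentedFiltration W P s) _ _ fun k => ?_
        have hk := gridPoint_mem hst.le k
        exact ((hZ.adapted _ ⟨ht.1.trans hk.1, hk.2.trans hs.2⟩).mono
          (augmentedFiltration_mono hk.2) le_rfl).sub
          ((hZ.adapted t ht').mono (augmentedFiltration_mono hst.le) le_rfl)
      · filter_upwards [hpath, hpath'] with ω h1 h2
        exact tendsto_gridSolution hA ht.1 hst hs.2 x hε (f := fun r => Z r ω - Z t ω)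
          ((h1.1.mono (Icc_subset_Icc ht.1 hs.2)).sub continuousOn_const) (h2.mono hs.2)
  · filter_upwards [hpath] with ω ⟨_, y, hy, hXy⟩
    simp_rw [hXy]
    exact hy.continuousOn.comp (by fun_prop) fun s hs =>
      ⟨le_max_right _ _, max_le hs.2 ht.2.le⟩
  · obtain ⟨g, hgm, hg0, hg, hgle⟩ := hZ.exists_bound ht.1 ht.2.le le_rfl
    have hb : ∀ᵐ ω ∂P, ⨆ s ∈ Icc 0 T, ‖X s ω‖ₑ ^ 2 ≤
        ENNReal.ofReal (2 * (‖x‖ + L * T) ^ 2) + ENNReal.ofReal 2 * ENNReal.ofReal (g ω) := by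
      filter_upwards [hpath, hg] with ω ⟨_, y, hy, hXy⟩ hgω
      refine iSup₂_le fun s hs => ?_
      have hs' : max s t ∈ Icc t T := ⟨le_max_right _ _, max_le hs.2 ht.2.le⟩
      have h1 := hy.norm_sub_driver_le hA ht.1 le_rfl hs'
      have h2 := hgω _ hs'
      have h3 : ‖w ω (max s t)‖ ≤ ‖x‖ + ‖Z (max s t) ω - Z t ω‖ := by
        refine (norm_add_le _ _).trans (add_le_add_right ?_ _)
        rw [norm_smul, Real.norm_of_nonneg hε.1]
        exact mul_le_of_le_one_left (norm_nonneg _) hε.2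
      have h4 : L * (max s t - t) ≤ L * T :=
        mul_le_mul_of_nonneg_left (by linarith [hs'.2, ht.1]) hA.L_pos.le
      have h5 : ‖y (max s t)‖ ≤ (‖x‖ + L * T) + ‖Z (max s t) ω - Z t ω‖ := by
        have := norm_add_le (y (max s t) - w ω (max s t)) (w ω (max s t))
        rw [sub_add_cancel] at this
        linarith
      rw [hXy]
      refine (enorm_sq_le_ofReal h5).trans ?_
      rw [← ENNReal.ofReal_mul (by norm_num),
        ← ENNReal.ofReal_add (by positivity) (mul_nonneg (by norm_num) (hg0 ω))]
      refine ENNReal.ofReal_le_ofReal ((sq_add_sq_le _ _).trans ?_)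
      linarith
    refine (lintegral_mono_ae hb).trans_lt ?_
    rw [lintegral_add_left measurable_const, lintegral_const, lintegral_const_mul' _ _ ENNReal.ofReal_ne_top]
    refine ENNReal.add_lt_top.2 ⟨ENNReal.mul_lt_top ENNReal.ofReal_lt_top (by simp),
      ENNReal.mul_lt_top ENNReal.ofReal_lt_top
      (hgle.trans_lt ENNReal.ofReal_lt_top)⟩
  · filter_upwards with ω s hs
    simp only [X, if_pos hs.2]
  · refine ⟨fun s ω => Z s ω - Z t ω, hZ.integral t ht', ?_⟩
    filter_upwards [hpath'] with ω hω s hs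
    rw [hω.equation s hs]
    simp only [w]
    abel

theorem IsSolution.ae_eq (hW : IsBrownianMotion W P) (hA : CoeffAssumption T L b σ)
    (hZ : IsNoiseProcess W P T σ C Z) {ε t : ℝ} (ht : t ∈ Ico 0 T) {x : E m}
    {X Y : ℝ → Ω → E m} (hX : IsSolution W P T b σ ε t x X) (hY : IsSolution W P T b σ ε t x Y) :
    ∀ᵐ ω ∂P, ∀ s ∈ Icc 0 T, Y s ω = X s ω := by
  filter_upwards [hX.before, hY.before, hX.ae_isPathSolution hW hZ ht,
    hY.ae_isPathSolution hW hZ ht] with ω h1 h2 h3 h4 s hs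
  rcases le_total s t with hst | hst
  · rw [h1 s ⟨hs.1, hst⟩, h2 s ⟨hs.1, hst⟩]
  · exact h4.eq hA ht.1 le_rfl h3 ⟨hst, hs.2⟩

/-- The stability estimate when the first solution starts earlier. -/
theorem stability_of_le (hW : IsBrownianMotion W P) (hA : CoeffAssumption T L b σ)
    (hC : 0 ≤ C) (hZ : IsNoiseProcess W P T σ C Z) {ε ε' t t' : ℝ} (hε : ε ∈ Icc (0 : ℝ) 1)
    (ht : t ∈ Ico 0 T) (ht' : t' ∈ Ico 0 T) (htt' : t ≤ t')
    {x x' : E m} {X X' : ℝ → Ω → E m} (hX : IsSolution W P T b σ ε t x X)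
    (hX' : IsSolution W P T b σ ε' t' x' X') :
    ∫⁻ ω, ⨆ s ∈ Icc 0 T, ‖X s ω - X' s ω‖ₑ ^ 2 ∂P ≤
      ENNReal.ofReal (4 * Real.exp (L * T) ^ 2 * (1 + L ^ 2 * T + C + C * T) *
        (|t - t'| + |ε - ε'| ^ 2 + ‖x - x'‖ ^ 2)) := by
  -- g₁ controls the noise on [t, t'], felt by the first solution only, and its mean is of order t'
  -- − t. g₂ controls it on [t', T], where it enters with the factor ε − ε'.
  obtain ⟨g₁, hgm₁, hg₁0, hg₁, hgle₁⟩ := hZ.exists_bound ht.1 htt' ht'.2.le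
  obtain ⟨g₂, hgm₂, hg₂0, hg₂, hgle₂⟩ := hZ.exists_bound ht'.1 ht'.2.le le_rfl
  set K := Real.exp (L * T) with hK
  have hK1 : 1 ≤ K := Real.one_le_exp (mul_nonneg hA.L_pos.le (ht.1.trans ht.2.le))
  have hL := hA.L_pos
  have hT : 0 < T := ht.1.trans_lt ht.2
  have hb : ∀ᵐ ω ∂P, ⨆ s ∈ Icc 0 T, ‖X s ω - X' s ω‖ₑ ^ 2 ≤
      ENNReal.ofReal (4 * K ^ 2 * (‖x - x'‖ ^ 2 + L ^ 2 * (t' - t) ^ 2)) +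
        (ENNReal.ofReal (4 * K ^ 2) * ENNReal.ofReal (g₁ ω) +
        ENNReal.ofReal (4 * K ^ 2 * |ε - ε'| ^ 2) * ENNReal.ofReal (g₂ ω)) := by
    filter_upwards [hX.before, hX'.before, hX.ae_isPathSolution hW hZ ht,
      hX'.ae_isPathSolution hW hZ ht', hg₁, hg₂] with ω h1 h2 h3 h4 h5 h6
    have h5' : ∀ s ∈ Icc t t', ‖Z s ω - Z t ω‖ ≤ √(g₁ ω) := fun s hs =>
      Real.le_sqrt_of_sq_le (h5 s hs)
    have h6' : ∀ s ∈ Icc t' T, ‖Z s ω - Z t' ω‖ ≤ √(g₂ ω) := fun s hs =>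
      Real.le_sqrt_of_sq_le (h6 s hs)
    set R := ‖x - x'‖ + L * (t' - t) + √(g₁ ω) + |ε - ε'| * √(g₂ ω) with hR
    have hR1 : 0 ≤ L * (t' - t) := mul_nonneg hL.le (sub_nonneg.2 htt')
    have hR2 : 0 ≤ |ε - ε'| * √(g₂ ω) := by positivity
    have hR0 : 0 ≤ R := by positivity
    have hmid : ∀ s ∈ Icc t t', ‖X s ω - x'‖ ≤ ‖x - x'‖ + L * (t' - t) + √(g₁ ω) := by
      intro s hs
      have hs' : s ∈ Icc t T := ⟨hs.1, hs.2.trans ht'.2.le⟩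
      have e1 := h3.norm_sub_driver_le hA ht.1 le_rfl hs'
      have e2 : ‖ε • (Z s ω - Z t ω)‖ ≤ √(g₁ ω) := by
        rw [norm_smul, Real.norm_of_nonneg hε.1]
        exact (mul_le_of_le_one_left (norm_nonneg _) hε.2).trans (h5' s hs)
      have e3 : X s ω - x' = (X s ω - (x + ε • (Z s ω - Z t ω))) + (x - x') +
          ε • (Z s ω - Z t ω) := by abel
      have e4 : L * (s - t) ≤ L * (t' - t) :=
        mul_le_mul_of_nonneg_left (by linarith [hs.2]) hL.le
      rw [e3]
      refine (norm_add₃_le).trans ?_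
      linarith
    have hall : ∀ s ∈ Icc 0 T, ‖X s ω - X' s ω‖ ≤ K * R := by
      intro s hs
      have hRK : R ≤ K * R := le_mul_of_one_le_left hR0 hK1
      rcases le_total s t with hst | hst
      · rw [h1 s ⟨hs.1, hst⟩, h2 s ⟨hs.1, hst.trans htt'⟩]
        have := Real.sqrt_nonneg (g₁ ω)
        linarith
      rcases le_total s t' with hst' | hst'
      · rw [h2 s ⟨hs.1, hst'⟩]
        linarith [hmid s ⟨hst, hst'⟩]
      -- Restarted at t', the first solution has initial value X_{t'}, so the drivers differ by
      -- X_{t'} − x' plus (ε − ε') times the noise since t'.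
      · have e1 := ((h3.restart hA ht.1 htt' le_rfl).mono hs.2).norm_sub_le hA ht'.1 hst' hs.2
          (h4.mono hs.2) (A := R) (fun r hr => ?_)
        · rw [mul_comm] at e1
          exact e1.trans (mul_le_mul_of_nonneg_right (hA.exp_le ht'.1 hs.2) hR0)
        · have e2 : X t' ω + (x + ε • (Z r ω - Z t ω) - (x + ε • (Z t' ω - Z t ω))) -
              (x' + ε' • (Z r ω - Z t' ω)) = (X t' ω - x') + (ε - ε') • (Z r ω - Z t' ω) := by
            module
          rw [e2]
          refine (norm_add_le _ _).trans (add_le_add (hmid t' ⟨htt', le_rfl⟩) ?_)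
          rw [norm_smul, Real.norm_eq_abs]
          exact mul_le_mul_of_nonneg_left (h6' r ⟨hr.1, hr.2.trans hs.2⟩) (abs_nonneg _)
    refine iSup₂_le fun s hs => (enorm_sq_le_ofReal (hall s hs)).trans ?_
    have q1 := hg₁0 ω
    have q2 := hg₂0 ω
    rw [← ENNReal.ofReal_mul (by positivity), ← ENNReal.ofReal_mul (by positivity),
      ← ENNReal.ofReal_add (by positivity) (by positivity),
      ← ENNReal.ofReal_add (by positivity) (by positivity)]
    refine ENNReal.ofReal_le_ofReal ?_
    have hsq : R ^ 2 ≤ 4 * (‖x - x'‖ ^ 2 + (L * (t' - t)) ^ 2 + √(g₁ ω) ^ 2 +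
        (|ε - ε'| * √(g₂ ω)) ^ 2) := by
      have := sq_add_sq_le (‖x - x'‖ + L * (t' - t)) (√(g₁ ω) + |ε - ε'| * √(g₂ ω))
      have := sq_add_sq_le ‖x - x'‖ (L * (t' - t))
      have := sq_add_sq_le (√(g₁ ω)) (|ε - ε'| * √(g₂ ω))
      rw [hR, add_assoc]
      linarith
    rw [mul_pow, mul_pow, Real.sq_sqrt q1, Real.sq_sqrt q2] at hsq
    have := mul_le_mul_of_nonneg_left hsq (sq_nonneg K)
    rw [mul_pow]
    linarith
  refine (lintegral_mono_ae hb).trans ?_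
  rw [lintegral_add_left measurable_const, lintegral_add_left' (hgm₁.ennreal_ofReal.const_mul _),
    lintegral_const, measure_univ, mul_one, lintegral_const_mul' _ _ ENNReal.ofReal_ne_top,
    lintegral_const_mul' _ _ ENNReal.ofReal_ne_top]
  have q1 : 0 ≤ t' - t := sub_nonneg.2 htt'
  have q2 : 0 ≤ T - t' := sub_nonneg.2 ht'.2.le
  refine (add_le_add_right (add_le_add (mul_le_mul_right hgle₁ _)
    (mul_le_mul_right hgle₂ _)) _).trans ?_
  rw [← ENNReal.ofReal_mul (by positivity), ← ENNReal.ofReal_mul (by positivity),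
    ← ENNReal.ofReal_add (by positivity) (by positivity),
    ← ENNReal.ofReal_add (by positivity) (by positivity)]
  refine ENNReal.ofReal_le_ofReal ?_
  rw [abs_sub_comm t t', abs_of_nonneg q1]
  -- The squared drift term is absorbed into the first power, which the noise forces anyway.
  have e1 : (t' - t) ^ 2 ≤ T * (t' - t) := by
    rw [sq]; exact mul_le_mul_of_nonneg_right (by linarith [ht.1, ht'.2]) q1
  have e2 : T - t' ≤ T := by linarith [ht'.1]
  have e3 : ‖x - x'‖ ^ 2 + L ^ 2 * (t' - t) ^ 2 + C * (t' - t) + |ε - ε'| ^ 2 * (C * (T - t')) ≤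
      (1 + L ^ 2 * T + C + C * T) * ((t' - t) + |ε - ε'| ^ 2 + ‖x - x'‖ ^ 2) := by
    have a1 : L ^ 2 * (t' - t) ^ 2 ≤ L ^ 2 * (T * (t' - t)) := by gcongr
    have a2 : |ε - ε'| ^ 2 * (C * (T - t')) ≤ |ε - ε'| ^ 2 * (C * T) := by gcongr
    have p1 : 0 ≤ (1 + C * T) * (t' - t) := by positivity
    have p2 : 0 ≤ (1 + L ^ 2 * T + C) * |ε - ε'| ^ 2 := by positivity
    have p3 : 0 ≤ (L ^ 2 * T + C + C * T) * ‖x - x'‖ ^ 2 := by positivity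
    nlinarith
  have := mul_le_mul_of_nonneg_left e3 (show 0 ≤ 4 * K ^ 2 by positivity)
  linarith

theorem stability (hW : IsBrownianMotion W P) (hA : CoeffAssumption T L b σ)
    (hC : 0 ≤ C) (hZ : IsNoiseProcess W P T σ C Z) {ε ε' t t' : ℝ} (hε : ε ∈ Icc (0 : ℝ) 1)
    (hε' : ε' ∈ Icc (0 : ℝ) 1) (ht : t ∈ Ico 0 T) (ht' : t' ∈ Ico 0 T)
    {x x' : E m} {X X' : ℝ → Ω → E m} (hX : IsSolution W P T b σ ε t x X)
    (hX' : IsSolution W P T b σ ε' t' x' X') :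
    ∫⁻ ω, ⨆ s ∈ Icc 0 T, ‖X s ω - X' s ω‖ₑ ^ 2 ∂P ≤
      ENNReal.ofReal (4 * Real.exp (L * T) ^ 2 * (1 + L ^ 2 * T + C + C * T) *
        (|t - t'| + |ε - ε'| ^ 2 + ‖x - x'‖ ^ 2)) := by
  rcases le_total t t' with h | h
  · exact stability_of_le hW hA hC hZ hε ht ht' h hX hX'
  · have := stability_of_le hW hA hC hZ hε' ht' ht h hX' hX
    simp_rw [enorm_sub_rev (X' _ _), abs_sub_comm t' t, abs_sub_comm ε' ε,
      norm_sub_rev x' x] at this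
    exact this

end Solutions

/-! ### A substitute for weak compactness -/

section Hilbert

/-- If `S` is convex with bounded second components, every point in the closure of its first
projection has a partner in the closure of `S`. -/
lemma exists_mem_closure_of_convex {H₁ H₂ : Type*} [NormedAddCommGroup H₁] [NormedSpace ℝ H₁]
    [NormedAddCommGroup H₂] [InnerProductSpace ℝ H₂] [CompleteSpace H₂] {S : Set (H₁ × H₂)}
    (hS : Convex ℝ S) {R : ℝ} (hR : ∀ p ∈ S, ‖p.2‖ ≤ R) {x : H₁}
    (hx : x ∈ closure (Prod.fst '' S)) : ∃ g, (x, g) ∈ closure S := by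
  let δ : ℕ → ℝ := fun n => 1 / (n + 1)
  have hδ : ∀ n, 0 < δ n := fun n => by positivity
  have hδanti : Antitone δ := fun n k h => one_div_le_one_div_of_le (by positivity) (by gcongr)
  have hδlim : Tendsto δ atTop (𝓝 0) := tendsto_one_div_add_atTop_nhds_zero_nat
  -- These sets decrease and are stable under midpoints. As in the projection theorem, almost
  -- minimal elements are Cauchy by the parallelogram law; the bound R makes the increasing minimal
  -- norms converge.
  let A : ℕ → Set H₂ := fun n => {g | ∃ y, (y, g) ∈ S ∧ ‖y - x‖ ≤ δ n}
  have hAne : ∀ n, (A n).Nonempty := fun n => by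
    obtain ⟨_, ⟨p, hp, rfl⟩, hd⟩ := Metric.mem_closure_iff.1 hx (δ n) (hδ n)
    refine ⟨p.2, p.1, hp, ?_⟩
    rw [dist_comm, dist_eq_norm] at hd
    exact hd.le
  have hAanti : ∀ n k, n ≤ k → A k ⊆ A n := fun n k h g ⟨y, hy, hyx⟩ =>
    ⟨y, hy, hyx.trans (hδanti h)⟩
  have hAmid : ∀ n, ∀ g ∈ A n, ∀ g' ∈ A n, (1 / 2 : ℝ) • (g + g') ∈ A n := by
    rintro n g ⟨y, hy, hyx⟩ g' ⟨y', hy', hyx'⟩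
    refine ⟨(1 / 2 : ℝ) • y + (1 / 2 : ℝ) • y', ?_, ?_⟩
    · have := hS hy hy' (a := 1 / 2) (b := 1 / 2) (by norm_num) (by norm_num) (by norm_num)
      rw [smul_add]
      exact this
    · rw [show (1 / 2 : ℝ) • y + (1 / 2 : ℝ) • y' - x = (1 / 2 : ℝ) • ((y - x) + (y' - x)) by
        module, norm_smul]
      have := norm_add_le (y - x) (y' - x)
      norm_num
      linarith
  let a : ℕ → ℝ := fun n => sInf (norm '' A n)
  have hbdd : ∀ n, BddBelow (norm '' A n) := fun n => ⟨0, by rintro _ ⟨g, _, rfl⟩; positivity⟩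
  have ha_le : ∀ n, ∀ g ∈ A n, a n ≤ ‖g‖ := fun n g hg => csInf_le (hbdd n) ⟨g, hg, rfl⟩
  have hamono : Monotone a := fun n k h =>
    csInf_le_csInf (hbdd n) ((hAne k).image _) (image_mono (hAanti n k h))
  have haR : ∀ n, a n ≤ R := fun n => by
    obtain ⟨g, hg⟩ := hAne n
    have hg' := hg
    obtain ⟨y, hy, _⟩ := hg'
    exact (ha_le n g hg).trans (hR _ hy)
  have ha0 : ∀ n, 0 ≤ a n := fun n => Real.sInf_nonneg (by rintro _ ⟨g, _, rfl⟩; positivity)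
  have halim := tendsto_atTop_ciSup hamono ⟨R, by rintro _ ⟨n, rfl⟩; exact haR n⟩
  set α := ⨆ n, a n with hα
  have haα : ∀ n, a n ≤ α := fun n => hamono.ge_of_tendsto halim n
  have hg : ∀ n, ∃ g ∈ A n, ‖g‖ < a n + δ n := fun n => by
    obtain ⟨_, ⟨g, hg, rfl⟩, hlt⟩ := exists_lt_of_csInf_lt ((hAne n).image norm)
      (lt_add_of_pos_right (a n) (hδ n))
    exact ⟨g, hg, hlt⟩
  choose g hgA hglt using hg
  have hcauchy : CauchySeq g := by
    refine cauchySeq_of_le_tendsto_0 (fun N => √(4 * (α + δ N) ^ 2 - 4 * a N ^ 2)) ?_ ?_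
    · intro n k N hn hk
      rw [dist_eq_norm]
      refine Real.le_sqrt_of_sq_le ?_
      have h1 := ha_le N _ (hAmid N _ (hAanti N n hn (hgA n)) _ (hAanti N k hk (hgA k)))
      have h2 : ‖g n‖ ≤ α + δ N := (hglt n).le.trans (add_le_add (haα n) (hδanti hn))
      have h3 : ‖g k‖ ≤ α + δ N := (hglt k).le.trans (add_le_add (haα k) (hδanti hk))
      rw [norm_smul] at h1
      have h4 : 2 * a N ≤ ‖g n + g k‖ := by norm_num at h1; linarith
      have h5 := parallelogram_law_with_norm ℝ (g n) (g k)
      have h6 : (2 * a N) ^ 2 ≤ ‖g n + g k‖ ^ 2 :=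
        pow_le_pow_left₀ (by linarith [ha0 N]) h4 2
      have h7 : ‖g n‖ ^ 2 ≤ (α + δ N) ^ 2 := pow_le_pow_left₀ (norm_nonneg _) h2 2
      have h8 : ‖g k‖ ^ 2 ≤ (α + δ N) ^ 2 := pow_le_pow_left₀ (norm_nonneg _) h3 2
      linarith
    · have h1 : Tendsto (fun N => √(4 * (α + δ N) ^ 2 - 4 * a N ^ 2)) atTop
          (𝓝 (√(4 * (α + 0) ^ 2 - 4 * α ^ 2))) :=
        ((((hδlim.const_add α).pow 2).const_mul 4).sub ((halim.pow 2).const_mul 4)).sqrt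
      simpa using h1
  obtain ⟨G, hG⟩ := cauchySeq_tendsto_of_complete hcauchy
  choose y hyS hyx using hgA
  have hy : Tendsto y atTop (𝓝 x) :=
    tendsto_iff_norm_sub_tendsto_zero.2
      (squeeze_zero (fun _ => norm_nonneg _) hyx hδlim)
  exact ⟨G, mem_closure_of_tendsto (hy.prodMk_nhds hG) (Eventually.of_forall hyS)⟩

end Hilbert

/-! ### Functions with bounded derivatives -/

section BoundedDerivatives

variable {V V' F : Type*} [NormedAddCommGroup V] [NormedSpace ℝ V] [NormedAddCommGroup V']
  [NormedSpace ℝ V'] [NormedAddCommGroup F] [NormedSpace ℝ F]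

/-- Smooth maps that are bounded together with all their derivatives. -/
def HasBoundedDerivs (φ : V → F) : Prop :=
  ContDiff ℝ ((⊤ : ℕ∞) : WithTop ℕ∞) φ ∧ ∀ k : ℕ, ∃ B : ℝ, ∀ y, ‖iteratedFDeriv ℝ k φ y‖ ≤ B

lemma HasBoundedDerivs.comp_clm {φ : V → F} (hφ : HasBoundedDerivs φ) (A : V' →L[ℝ] V) :
    HasBoundedDerivs (φ ∘ A) := by
  refine ⟨hφ.1.comp A.contDiff, fun k => ?_⟩
  obtain ⟨B, hB⟩ := hφ.2 k
  refine ⟨B * ‖A‖ ^ k, fun y => ?_⟩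
  rw [A.iteratedFDeriv_comp_right hφ.1 y (by exact_mod_cast le_top)]
  refine (ContinuousMultilinearMap.norm_compContinuousLinearMap_le _ _).trans ?_
  simp only [Finset.prod_const, Finset.card_univ, Fintype.card_fin]
  exact mul_le_mul_of_nonneg_right (hB _) (by positivity)

lemma HasBoundedDerivs.add {φ ψ : V → F} (hφ : HasBoundedDerivs φ) (hψ : HasBoundedDerivs ψ) :
    HasBoundedDerivs (φ + ψ) := by
  refine ⟨hφ.1.add hψ.1, fun k => ?_⟩
  obtain ⟨B, hB⟩ := hφ.2 k
  obtain ⟨B', hB'⟩ := hψ.2 k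
  refine ⟨B + B', fun y => ?_⟩
  rw [iteratedFDeriv_add_apply (hφ.1.of_le (by exact_mod_cast le_top)).contDiffAt
    (hψ.1.of_le (by exact_mod_cast le_top)).contDiffAt]
  exact (norm_add_le _ _).trans (add_le_add (hB y) (hB' y))

lemma HasBoundedDerivs.const_smul {φ : V → F} (hφ : HasBoundedDerivs φ) (a : ℝ) :
    HasBoundedDerivs (a • φ) := by
  refine ⟨hφ.1.const_smul a, fun k => ?_⟩
  obtain ⟨B, hB⟩ := hφ.2 k
  refine ⟨|a| * B, fun y => ?_⟩
  rw [iteratedFDeriv_const_smul_apply (hφ.1.of_le (by exact_mod_cast le_top)).contDiffAt,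
    norm_smul, Real.norm_eq_abs]
  exact mul_le_mul_of_nonneg_left (hB y) (abs_nonneg _)

lemma hasBoundedDerivs_of_hasCompactSupport {φ : V → F}
    (hφ : ContDiff ℝ ((⊤ : ℕ∞) : WithTop ℕ∞) φ) (hc : HasCompactSupport φ) :
    HasBoundedDerivs φ :=
  ⟨hφ, fun k => (hφ.continuous_iteratedFDeriv (by exact_mod_cast le_top)).bounded_above_of_compact_support
    (hc.iteratedFDeriv k)⟩

lemma isCbInfty_iff {n : ℕ} {φ : (Fin n → ℝ) → ℝ} : IsCbInfty φ ↔ HasBoundedDerivs φ := Iff.rfl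

end BoundedDerivatives

/-! ### Smooth random variables and closure of the derivative -/

section Smooth

variable {Ω : Type*} [MeasurableSpace Ω] {P : Measure Ω} [IsProbabilityMeasure P] {m d : ℕ}
  {W : ℝ≥0 → Ω → E d} {T : ℝ}

/-- Both functionals are pulled back to the concatenated family of Wiener integrals. This supplies
the convexity needed for the closure argument. -/
lemma IsSmoothWithDeriv.combination {η η' : Ω → ℝ} {D D' : ℝ → Ω → E d}
    (h : IsSmoothWithDeriv W P T η D) (h' : IsSmoothWithDeriv W P T η' D') (a a' : ℝ) :
    IsSmoothWithDeriv W P T (fun ω => a * η ω + a' * η' ω)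
      (fun r ω => a • D r ω + a' • D' r ω) := by
  obtain ⟨n, φ, g, w, hφ, hw, hη, hD⟩ := h
  obtain ⟨n', φ', g', w', hφ', hw', hη', hD'⟩ := h'
  let A : (Fin (n + n') → ℝ) →L[ℝ] (Fin n → ℝ) :=
    ContinuousLinearMap.pi fun i => ContinuousLinearMap.proj (Fin.castAdd n' i)
  let A' : (Fin (n + n') → ℝ) →L[ℝ] (Fin n' → ℝ) :=
    ContinuousLinearMap.pi fun i => ContinuousLinearMap.proj (Fin.natAdd n i)
  have hA : ∀ ω, A (fun i => Fin.append w w' i ω) = fun i => w i ω := fun ω => by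
    ext i; simp [A]
  have hA' : ∀ ω, A' (fun i => Fin.append w w' i ω) = fun i => w' i ω := fun ω => by
    ext i; simp [A']
  have e1 : ∀ i, A (Pi.single (Fin.castAdd n' i) 1) = Pi.single i 1 := fun i => by
    ext j; simp [A, Pi.single_apply]
  have e2 : ∀ i, A (Pi.single (Fin.natAdd n i) 1) = 0 := fun i => by
    ext j
    simp only [A, ContinuousLinearMap.coe_pi', ContinuousLinearMap.proj_apply, Pi.single_apply,
      Pi.zero_apply, ite_eq_right_iff]
    intro h
    have := congrArg Fin.val h
    simp at this
    lia
  have e3 : ∀ i, A' (Pi.single (Fin.natAdd n i) 1) = Pi.single i 1 := fun i => by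
    ext j; simp [A', Pi.single_apply]
  have e4 : ∀ i, A' (Pi.single (Fin.castAdd n' i) 1) = 0 := fun i => by
    ext j
    simp only [A', ContinuousLinearMap.coe_pi', ContinuousLinearMap.proj_apply, Pi.single_apply,
      Pi.zero_apply, ite_eq_right_iff]
    intro h
    have := congrArg Fin.val h
    simp at this
    lia
  rw [isCbInfty_iff] at hφ hφ'
  have hd : ∀ y v, fderiv ℝ (a • (φ ∘ A) + a' • (φ' ∘ A')) y v =
      a * fderiv ℝ φ (A y) (A v) + a' * fderiv ℝ φ' (A' y) (A' v) := by
    intro y v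
    have h1 : HasFDerivAt (φ ∘ A) ((fderiv ℝ φ (A y)).comp A) y :=
      ((hφ.1.differentiable (by simp)) (A y)).hasFDerivAt.comp y A.hasFDerivAt
    have h2 : HasFDerivAt (φ' ∘ A') ((fderiv ℝ φ' (A' y)).comp A') y :=
      ((hφ'.1.differentiable (by simp)) (A' y)).hasFDerivAt.comp y A'.hasFDerivAt
    rw [((h1.const_smul a).add (h2.const_smul a')).fderiv]
    simp
  refine ⟨n + n', a • (φ ∘ A) + a' • (φ' ∘ A'), Fin.append g g', Fin.append w w', ?_, ?_, ?_, ?_⟩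
  · exact ((hφ.comp_clm A).const_smul a).add ((hφ'.comp_clm A').const_smul a')
  · intro i
    refine Fin.addCases (fun i => ?_) (fun i => ?_) i
    · simpa using hw i
    · simpa using hw' i
  · intro ω
    simp [hη, hη', hA, hA']
  · intro r ω
    simp only [Fin.sum_univ_add, hD, hD', Finset.smul_sum]
    simp [hd, e1, e2, e3, e4, hA, hA', smul_smul]

lemma isSmoothWithDeriv_const (c : ℝ) :
    IsSmoothWithDeriv W P T (fun _ => c) (fun _ _ => (0 : E d)) := by
  refine ⟨0, fun _ => c, Fin.elim0, Fin.elim0, ⟨contDiff_const, fun k => ?_⟩, fun i => i.elim0,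
    fun _ => rfl, fun _ _ => by simp⟩
  refine ⟨‖iteratedFDeriv ℝ k (fun _ : Fin 0 → ℝ => c) 0‖, fun y => ?_⟩
  rw [Subsingleton.elim y 0]

lemma IsSmoothWithDeriv.memLp {η : Ω → ℝ} {D : ℝ → Ω → E d}
    (h : IsSmoothWithDeriv W P T η D) : MemLp η 2 P := by
  obtain ⟨n, φ, g, w, hφ, hw, hη, hD⟩ := h
  obtain ⟨B, hB⟩ := hφ.2 0
  have : η = fun ω => φ (fun i => w i ω) := funext hη
  rw [this]
  refine MemLp.of_bound ?_ B (ae_of_all _ fun ω => ?_)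
  · exact hφ.1.continuous.comp_aestronglyMeasurable
      (aemeasurable_pi_lambda _ fun i => (hw i).memLp_integral.1.aemeasurable).aestronglyMeasurable
  · simpa using hB fun i => w i ω

lemma IsSmoothWithDeriv.aestronglyMeasurable_deriv {η : Ω → ℝ} {D : ℝ → Ω → E d}
    (h : IsSmoothWithDeriv W P T η D) : AEStronglyMeasurable (fun p : ℝ × Ω => D p.1 p.2)
      ((volume.restrict (Icc 0 T)).prod P) := by
  obtain ⟨n, φ, g, w, hφ, hw, hη, hD⟩ := h
  simp_rw [hD]
  refine Finset.aestronglyMeasurable_fun_sum _ fun i _ => ?_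
  have h3 : AEStronglyMeasurable (fun p : ℝ × Ω =>
      fderiv ℝ φ (fun i' => w i' p.2) (Pi.single i 1)) ((volume.restrict (Icc 0 T)).prod P) := by
    have h1 : Continuous fun y => fderiv ℝ φ y (Pi.single i 1) :=
      (hφ.1.continuous_fderiv (by simp)).clm_apply continuous_const
    have h2 : AEStronglyMeasurable (fun ω => fderiv ℝ φ (fun i' => w i' ω) (Pi.single i 1)) P :=
      h1.comp_aestronglyMeasurable (aemeasurable_pi_lambda _ fun i =>
        (hw i).memLp_integral.1.aemeasurable).aestronglyMeasurable
    exact h2.comp_snd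
  exact h3.smul (hw i).memLp_integrand.1.comp_fst

/-- Weak closedness of the Malliavin derivative: an `L²` limit of smooth random vectors whose
derivatives are bounded by `K` has a Malliavin derivative bounded by `K`. -/
theorem exists_hasMalliavinDeriv_of_approx {U : Ω → E m} (hU : MemLp U 2 P) {K : ℝ} (hK : 0 ≤ K)
    (happ : ∀ δ : ℝ≥0∞, 0 < δ → ∃ (η : Fin m → Ω → ℝ) (Dη : Fin m → ℝ → Ω → E d),
      (∀ i, IsSmoothWithDeriv W P T (η i) (Dη i)) ∧
      (∀ᵐ p ∂((volume.restrict (Icc 0 T)).prod P), ∑ i, ‖Dη i p.1 p.2‖ ^ 2 ≤ K ^ 2) ∧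
      eLpNorm (fun ω => U ω - WithLp.toLp 2 (fun i => η i ω)) 2 P ≤ δ) :
    ∃ D : Fin m → ℝ → Ω → E d, (∀ i, HasMalliavinDeriv W P T (fun ω => U ω i) (D i)) ∧
      ∀ᵐ p ∂((volume.restrict (Icc 0 T)).prod P), ∑ i, ‖D i p.1 p.2‖ ^ 2 ≤ K ^ 2 := by
  set Q : Measure (ℝ × Ω) := (volume.restrict (Icc 0 T)).prod P with hQ
  let G := PiLp 2 (fun _ : Fin m => E d)
  -- The graph of the derivative cut down by the pointwise bound. It is convex, and its second
  -- components are bounded in L² because the measure Q is finite.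
  let S : Set (Lp (E m) 2 P × Lp G 2 Q) := {p | ∃ (η : Fin m → Ω → ℝ)
    (Dη : Fin m → ℝ → Ω → E d), (∀ i, IsSmoothWithDeriv W P T (η i) (Dη i)) ∧
    (∀ᵐ ω ∂P, p.1 ω = WithLp.toLp 2 (fun i => η i ω)) ∧
    (∀ᵐ q ∂Q, p.2 q = WithLp.toLp 2 (fun i => Dη i q.1 q.2)) ∧ ∀ᵐ q ∂Q, ‖p.2 q‖ ≤ K}
  have hS : Convex ℝ S := by
    rintro p ⟨η, D, h1, h2, h3, h4⟩ p' ⟨η', D', h1', h2', h3', h4'⟩ a a' ha ha' haa'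
    refine ⟨fun i ω => a * η i ω + a' * η' i ω, fun i r ω => a • D i r ω + a' • D' i r ω,
      fun i => (h1 i).combination (h1' i) a a', ?_, ?_, ?_⟩
    · filter_upwards [h2, h2', Lp.coeFn_add (a • p.1) (a' • p'.1), Lp.coeFn_smul a p.1,
        Lp.coeFn_smul a' p'.1] with ω e1 e2 e3 e4 e5
      simp only [Prod.fst_add, Prod.smul_fst]
      rw [e3, Pi.add_apply, e4, e5, Pi.smul_apply, Pi.smul_apply, e1, e2]
      ext i; simp
    · filter_upwards [h3, h3', Lp.coeFn_add (a • p.2) (a' • p'.2), Lp.coeFn_smul a p.2,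
        Lp.coeFn_smul a' p'.2] with q e1 e2 e3 e4 e5
      simp only [Prod.snd_add, Prod.smul_snd]
      rw [e3, Pi.add_apply, e4, e5, Pi.smul_apply, Pi.smul_apply, e1, e2]
      rfl
    · filter_upwards [h4, h4', Lp.coeFn_add (a • p.2) (a' • p'.2), Lp.coeFn_smul a p.2,
        Lp.coeFn_smul a' p'.2] with q e1 e2 e3 e4 e5
      simp only [Prod.snd_add, Prod.smul_snd]
      rw [e3, Pi.add_apply, e4, e5, Pi.smul_apply, Pi.smul_apply]
      refine (norm_add_le _ _).trans ?_
      rw [norm_smul, norm_smul, Real.norm_of_nonneg ha, Real.norm_of_nonneg ha']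
      calc a * ‖p.2 q‖ + a' * ‖p'.2 q‖ ≤ a * K + a' * K := by gcongr
        _ = K := by rw [← add_mul, haa', one_mul]
  have hR : ∀ p ∈ S, ‖p.2‖ ≤ (measureUnivNNReal Q : ℝ) ^ (2 : ℝ≥0∞).toReal⁻¹ * K := by
    rintro p ⟨_, _, _, _, _, h4⟩
    exact Lp.norm_le_of_ae_bound hK h4
  have hx : hU.toLp U ∈ closure (Prod.fst '' S) := by
    rw [EMetric.mem_closure_iff]
    intro δ hδ
    obtain ⟨δ', hδ', hlt⟩ := exists_between hδ
    obtain ⟨η, D, h1, h2, h3⟩ := happ δ' hδ'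
    have hη : MemLp (fun ω => (WithLp.toLp 2 (fun i => η i ω) : E m)) 2 P :=
      (MemLp.of_eval_piLp fun i => by simpa using (h1 i).memLp)
    have hb : ∀ᵐ q ∂Q, ‖(WithLp.toLp 2 (fun i => D i q.1 q.2) : G)‖ ≤ K := by
      filter_upwards [h2] with q hq
      refine le_of_sq_le_sq ?_ hK
      rw [PiLp.norm_sq_eq_of_L2]
      exact hq
    have hD : MemLp (fun q : ℝ × Ω => (WithLp.toLp 2 (fun i => D i q.1 q.2) : G)) 2 Q := by
      refine MemLp.of_bound ?_ K hb
      refine (PiLp.continuous_toLp 2 _).comp_aestronglyMeasurable ?_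
      exact (aemeasurable_pi_lambda _ fun i =>
        (h1 i).aestronglyMeasurable_deriv.aemeasurable).aestronglyMeasurable
    refine ⟨hη.toLp _, ⟨(hη.toLp _, hD.toLp _), ⟨η, D, h1, hη.coeFn_toLp, hD.coeFn_toLp, ?_⟩,
      rfl⟩, ?_⟩
    · filter_upwards [hb, hD.coeFn_toLp] with q h h'
      rw [h']; exact h
    · rw [Lp.edist_toLp_toLp]
      exact h3.trans_lt hlt
  obtain ⟨g, hg⟩ := exists_mem_closure_of_convex hS hR hx
  have hgK : ∀ᵐ q ∂Q, ‖g q‖ ≤ K := by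
    obtain ⟨p, hpS, hp⟩ := mem_closure_iff_seq_limit.1 hg
    have hp2 : Tendsto (fun n => (p n).2) atTop (𝓝 g) := (continuous_snd.tendsto _).comp hp
    -- An almost everywhere convergent subsequence carries the pointwise bound to the limit.
    obtain ⟨ns, _, hns⟩ := (tendstoInMeasure_of_tendsto_Lp hp2).exists_seq_tendsto_ae
    have hb : ∀ᵐ q ∂Q, ∀ n, ‖(p n).2 q‖ ≤ K :=
      ae_all_iff.2 fun n => by
        obtain ⟨_, _, _, _, _, h4⟩ := hpS n
        exact h4
    filter_upwards [hns, hb] with q h1 h2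
    exact le_of_tendsto h1.norm (Eventually.of_forall fun n => h2 _)
  refine ⟨fun i r ω => g (r, ω) i, fun i => ⟨?_, ?_, fun δ hδ => ?_⟩, ?_⟩
  · exact hU.eval_piLp i
  · exact (Lp.memLp g).eval_piLp i
  · obtain ⟨p, ⟨η, D, h1, h2, h3, h4⟩, hd⟩ := EMetric.mem_closure_iff.1 hg δ hδ
    have hd1 : edist (hU.toLp U) p.1 ≤ δ := (le_max_left _ _).trans hd.le
    have hd2 : edist g p.2 ≤ δ := (le_max_right _ _).trans hd.le
    refine ⟨η i, D i, h1 i, ?_, ?_⟩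
    · rw [Lp.edist_def] at hd1
      refine le_trans (eLpNorm_mono_ae ?_) hd1
      filter_upwards [h2, hU.coeFn_toLp] with ω e1 e2
      rw [Pi.sub_apply, e1, e2]
      exact PiLp.norm_apply_le (U ω - WithLp.toLp 2 (fun i => η i ω)) i
    · rw [Lp.edist_def] at hd2
      refine le_trans (eLpNorm_mono_ae ?_) hd2
      filter_upwards [h3] with q e1
      rw [Pi.sub_apply, e1]
      exact PiLp.norm_apply_le ((g q : G) - WithLp.toLp 2 (fun i => D i q.1 q.2)) i
  · filter_upwards [hgK] with q hq
    have := pow_le_pow_left₀ (norm_nonneg _) hq 2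
    rw [PiLp.norm_sq_eq_of_L2] at this
    exact this

end Smooth

/-! ### Dominated convergence in L² -/

section Convergence

variable {Ω F : Type*} [MeasurableSpace Ω] {P : Measure Ω} [NormedAddCommGroup F]

lemma tendsto_eLpNorm_sub_of_dominated {f : ℕ → Ω → F} {f₀ : Ω → F} {g : Ω → ℝ}
    (hf : ∀ n, AEStronglyMeasurable (f n) P) (hf₀ : AEStronglyMeasurable f₀ P) (hg : MemLp g 2 P)
    (hle : ∀ n, ∀ᵐ ω ∂P, ‖f₀ ω - f n ω‖ ≤ g ω)
    (hlim : ∀ᵐ ω ∂P, Tendsto (fun n => f n ω) atTop (𝓝 (f₀ ω))) :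
    Tendsto (fun n => eLpNorm (fun ω => f₀ ω - f n ω) 2 P) atTop (𝓝 0) := by
  simp_rw [eLpNorm_two_eq]
  have h1 : Tendsto (fun n => ∫⁻ ω, ‖f₀ ω - f n ω‖ₑ ^ 2 ∂P) atTop (𝓝 (∫⁻ _, 0 ∂P)) := by
    refine tendsto_lintegral_of_dominated_convergence' (fun ω => ‖g ω‖ₑ ^ 2)
      (fun n => (hf₀.sub (hf n)).enorm.pow_const 2) (fun n => ?_) ?_ ?_
    · filter_upwards [hle n] with ω hω
      refine pow_le_pow_left' ?_ 2
      exact enorm_le_iff_norm_le.2 (hω.trans (le_abs_self _))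
    · have := hg.2
      rw [eLpNorm_two_eq, ENNReal.rpow_lt_top_iff_of_pos (by norm_num)] at this
      exact this.ne
    · filter_upwards [hlim] with ω hω
      have h2 := (ENNReal.continuous_pow 2).continuousAt.tendsto.comp (hω.const_sub (f₀ ω)).enorm
      simpa [Function.comp_def] using h2
  rw [lintegral_zero] at h1
  have h2 := (ENNReal.continuous_rpow_const (y := (1 / 2 : ℝ))).continuousAt.tendsto.comp h1
  simpa [Function.comp_def] using h2

end Convergence

/-! ### Cutoff and mollification of Lipschitz maps -/

section Mollification

variable {V F : Type*} [NormedAddCommGroup V] [NormedSpace ℝ V] [FiniteDimensional ℝ V]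
  [MeasurableSpace V] [BorelSpace V] [NormedAddCommGroup F] [NormedSpace ℝ F] [CompleteSpace F]

/-- A compactly supported Lipschitz map is a uniform limit of smooth compactly supported maps with
the same Lipschitz constant. -/
lemma exists_smooth_approx (μ : Measure V) [μ.IsAddHaarMeasure] {g : V → F} {Λ : ℝ≥0}
    (hg : LipschitzWith Λ g) (hc : HasCompactSupport g) {δ : ℝ} (hδ : 0 < δ) :
    ∃ Φ : V → F, ContDiff ℝ ((⊤ : ℕ∞) : WithTop ℕ∞) Φ ∧ HasCompactSupport Φ ∧ LipschitzWith Λ Φ ∧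
      ∀ y, ‖g y - Φ y‖ ≤ δ := by
  have hΛ : (0 : ℝ) < Λ + 1 := by positivity
  -- Over the support of the bump, g varies by at most Λδ/(Λ + 1) ≤ δ; the +1 covers Λ = 0.
  let φ : ContDiffBump (0 : V) := ⟨δ / (Λ + 1) / 2, δ / (Λ + 1), by positivity, by
    have : 0 < δ / (Λ + 1) := by positivity
    linarith⟩
  have hint : ∀ y, Integrable (fun t => φ.normed μ t • g (y - t)) μ := fun y => by
    refine Continuous.integrable_of_hasCompactSupport ?_ ?_
    · exact (φ.continuous_normed).smul (hg.continuous.comp (continuous_const.sub continuous_id))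
    · exact φ.hasCompactSupport_normed.smul_right
  refine ⟨convolution (φ.normed μ) g (ContinuousLinearMap.lsmul ℝ ℝ) μ, ?_, ?_, ?_, fun y => ?_⟩
  · exact φ.hasCompactSupport_normed.contDiff_convolution_left _ φ.contDiff_normed
      hg.continuous.locallyIntegrable
  · exact φ.hasCompactSupport_normed.convolution _ hc
  · refine LipschitzWith.of_dist_le_mul fun y y' => ?_
    rw [dist_eq_norm, convolution_def, convolution_def]
    simp only [ContinuousLinearMap.lsmul_apply]
    rw [← integral_sub (hint y) (hint y')]
    have hb : ∀ t, ‖φ.normed μ t • g (y - t) - φ.normed μ t • g (y' - t)‖ ≤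
        φ.normed μ t * (Λ * dist y y') := fun t => by
      rw [← smul_sub, norm_smul, Real.norm_of_nonneg (φ.nonneg_normed t)]
      refine mul_le_mul_of_nonneg_left ?_ (φ.nonneg_normed t)
      rw [← dist_eq_norm]
      exact (hg.dist_le_mul _ _).trans_eq (by rw [dist_sub_right])
    refine (norm_integral_le_of_norm_le (φ.integrable_normed.mul_const _)
      (ae_of_all _ hb)).trans_eq ?_
    rw [integral_mul_const, φ.integral_normed, one_mul]
  · rw [← dist_eq_norm, dist_comm]
    refine φ.dist_normed_convolution_le hg.continuous.aestronglyMeasurable fun z hz => ?_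
    refine (hg.dist_le_mul _ _).trans ?_
    have hz' : dist z y ≤ δ / (Λ + 1) := (Metric.mem_ball.1 hz).le
    calc (Λ : ℝ) * dist z y ≤ Λ * (δ / (Λ + 1)) := by gcongr
      _ = δ * (Λ / (Λ + 1)) := by ring
      _ ≤ δ := mul_le_of_le_one_right hδ.le (div_le_one_of_le₀ (by linarith) hΛ.le)

/-- The cutoff `max (0, 1 - |y| / R)`. -/
def cutoff (R : ℝ) (y : V) : ℝ := max 0 (1 - ‖y‖ / R)

lemma cutoff_nonneg (R : ℝ) (y : V) : 0 ≤ cutoff R y := le_max_left _ _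

lemma cutoff_le_one {R : ℝ} (hR : 0 < R) (y : V) : cutoff R y ≤ 1 :=
  max_le zero_le_one (by have : 0 ≤ ‖y‖ / R := by positivity
                         linarith)

lemma cutoff_eq_zero {R : ℝ} (hR : 0 < R) {y : V} (hy : R ≤ ‖y‖) : cutoff R y = 0 :=
  max_eq_left (by rw [sub_nonpos, le_div_iff₀ hR]; linarith)

lemma abs_cutoff_sub_le {R : ℝ} (hR : 0 < R) (y y' : V) :
    |cutoff R y - cutoff R y'| ≤ ‖y - y'‖ / R := by
  have h1 := abs_max_sub_max_le_abs (1 - ‖y‖ / R) (1 - ‖y'‖ / R) 0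
  unfold cutoff
  rw [max_comm 0, max_comm 0]
  refine h1.trans ?_
  rw [show (1 - ‖y‖ / R) - (1 - ‖y'‖ / R) = (‖y'‖ - ‖y‖) / R by ring, abs_div, abs_of_pos hR,
    norm_sub_rev]
  gcongr
  exact abs_norm_sub_norm_le _ _

lemma hasCompactSupport_cutoff_smul {R : ℝ} (hR : 0 < R) (f : V → F) :
    HasCompactSupport fun y => cutoff R y • f y := by
  have : ProperSpace V := FiniteDimensional.proper_real V
  refine HasCompactSupport.of_support_subset_isCompact (isCompact_closedBall 0 R) fun y hy => ?_
  rw [mem_closedBall_zero_iff]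
  by_contra h
  exact hy (by simp [cutoff_eq_zero hR (not_le.1 h).le])

/-- The cutoff has slope 1/R while |f| ≤ R + ΛR on the ball, so their product is 1 + Λ for every
large R; varying f adds another Λ. -/
lemma lipschitzWith_cutoff_smul {f : V → F} {Λ : ℝ≥0} (hf : LipschitzWith Λ f) {R : ℝ}
    (hR : 0 < R) (hR' : ‖f 0‖ ≤ R) : LipschitzWith (2 * Λ + 1) fun y => cutoff R y • f y := by
  have key : ∀ y y' : V, ‖y'‖ ≤ R →
      ‖cutoff R y • f y - cutoff R y' • f y'‖ ≤ (2 * Λ + 1) * ‖y - y'‖ := by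
    intro y y' hy'
    have e : cutoff R y • f y - cutoff R y' • f y' =
        cutoff R y • (f y - f y') + (cutoff R y - cutoff R y') • f y' := by module
    have h1 : ‖f y - f y'‖ ≤ Λ * ‖y - y'‖ := hf.norm_sub_le y y'
    have h2 : ‖f y'‖ ≤ R + Λ * R := by
      have h3 := hf.norm_sub_le y' 0
      rw [sub_zero] at h3
      have h4 := norm_add_le (f y' - f 0) (f 0)
      rw [sub_add_cancel] at h4
      have h5 : (Λ : ℝ) * ‖y'‖ ≤ Λ * R := by gcongr
      linarith
    rw [e]
    refine (norm_add_le _ _).trans ?_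
    rw [norm_smul, norm_smul, Real.norm_of_nonneg (cutoff_nonneg R y), Real.norm_eq_abs]
    have h6 : cutoff R y * ‖f y - f y'‖ ≤ Λ * ‖y - y'‖ :=
      (mul_le_of_le_one_left (norm_nonneg _) (cutoff_le_one hR y)).trans h1
    have h7 : |cutoff R y - cutoff R y'| * ‖f y'‖ ≤ ‖y - y'‖ / R * (R + Λ * R) := by
      gcongr
      exact abs_cutoff_sub_le hR y y'
    have h8 : ‖y - y'‖ / R * (R + Λ * R) = (1 + Λ) * ‖y - y'‖ := by field_simp
    linarith
  refine LipschitzWith.of_dist_le_mul fun y y' => ?_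
  rw [dist_eq_norm, dist_eq_norm]
  push_cast
  rcases le_total ‖y'‖ R with h | h
  · exact key y y' h
  · rcases le_total ‖y‖ R with h' | h'
    · rw [norm_sub_rev, norm_sub_rev y]
      exact key y' y h'
    · rw [cutoff_eq_zero hR h, cutoff_eq_zero hR h', zero_smul, zero_smul, sub_zero, norm_zero]
      positivity

lemma tendsto_cutoff (y : V) : Tendsto (fun n : ℕ => cutoff (n : ℝ) y) atTop (𝓝 1) := by
  have h1 : Tendsto (fun n : ℕ => 1 - ‖y‖ / (n : ℝ)) atTop (𝓝 (1 - 0)) :=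
    (tendsto_const_div_atTop_nhds_zero_nat ‖y‖).const_sub 1
  have h2 := h1.max (tendsto_const_nhds (x := (0 : ℝ)))
  simpa [cutoff, max_comm] using h2

/-- Lipschitz functionals of finitely many random variables are `L²` limits of smooth compactly
supported functionals, with control of the Lipschitz constants. -/
lemma exists_smooth_approx_comp {Ω : Type*} [MeasurableSpace Ω] {P : Measure Ω}
    [IsProbabilityMeasure P] (μ : Measure V) [μ.IsAddHaarMeasure] {f : V → F} {Λ : ℝ≥0}
    (hf : LipschitzWith Λ f) {Y : Ω → V} (hY : AEStronglyMeasurable Y P)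
    (hfY : MemLp (fun ω => f (Y ω)) 2 P) {δ : ℝ≥0∞} (hδ : 0 < δ) :
    ∃ Φ : V → F, ContDiff ℝ ((⊤ : ℕ∞) : WithTop ℕ∞) Φ ∧ HasCompactSupport Φ ∧
      LipschitzWith (2 * Λ + 1) Φ ∧ eLpNorm (fun ω => f (Y ω) - Φ (Y ω)) 2 P ≤ δ := by
  let g : ℕ → V → F := fun n y => cutoff (n + 1 : ℕ) y • f y
  have hcut : ∀ n : ℕ, Continuous fun y : V => cutoff ((n + 1 : ℕ) : ℝ) y := fun n =>
    continuous_const.max (continuous_const.sub (continuous_norm.div_const _))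
  have hgm : ∀ n, AEStronglyMeasurable (fun ω => g n (Y ω)) P := fun n =>
    ((hcut n).smul hf.continuous).comp_aestronglyMeasurable hY
  have hlim : Tendsto (fun n => eLpNorm (fun ω => f (Y ω) - g n (Y ω)) 2 P) atTop (𝓝 0) := by
    refine tendsto_eLpNorm_sub_of_dominated (f := fun n ω => g n (Y ω)) hgm hfY.1 hfY.norm
      (fun n => ae_of_all _ fun ω => ?_) (ae_of_all _ fun ω => ?_)
    · have h1 := cutoff_nonneg ((n + 1 : ℕ) : ℝ) (Y ω)
      have h2 := cutoff_le_one (R := ((n + 1 : ℕ) : ℝ)) (by positivity) (Y ω)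
      simp only [g]
      rw [show f (Y ω) - cutoff ((n + 1 : ℕ) : ℝ) (Y ω) • f (Y ω) =
        (1 - cutoff ((n + 1 : ℕ) : ℝ) (Y ω)) • f (Y ω) by module, norm_smul,
        Real.norm_of_nonneg (by linarith)]
      exact mul_le_of_le_one_left (norm_nonneg _) (by linarith)
    · have h1 := ((tendsto_cutoff (Y ω)).comp (tendsto_add_atTop_nat 1)).smul_const (f (Y ω))
      rw [one_smul] at h1
      exact h1
  have hδ2 : 0 < δ / 2 := ENNReal.div_pos hδ.ne' (by simp)
  obtain ⟨N, hN⟩ := exists_nat_ge ‖f 0‖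
  obtain ⟨n, hn, hnN⟩ := ((hlim.eventually (ge_mem_nhds hδ2)).and (eventually_ge_atTop N)).exists
  have hR : ‖f 0‖ ≤ ((n + 1 : ℕ) : ℝ) := hN.trans (by exact_mod_cast hnN.trans n.le_succ)
  have hR0 : (0 : ℝ) < ((n + 1 : ℕ) : ℝ) := by positivity
  obtain ⟨δ', hδ'0, hδ'⟩ : ∃ δ' : ℝ, 0 < δ' ∧ ENNReal.ofReal δ' ≤ δ / 2 := by
    refine ⟨(min (δ / 2) 1).toReal, ENNReal.toReal_pos (lt_min hδ2 one_pos).ne' (by simp), ?_⟩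
    rw [ENNReal.ofReal_toReal (by simp)]
    exact min_le_left _ _
  obtain ⟨Φ, h1, h2, h3, h4⟩ := exists_smooth_approx μ (lipschitzWith_cutoff_smul hf hR0 hR)
    (hasCompactSupport_cutoff_smul hR0 f) hδ'0
  refine ⟨Φ, h1, h2, h3, ?_⟩
  have e : (fun ω => f (Y ω) - Φ (Y ω)) =
      (fun ω => f (Y ω) - g n (Y ω)) + fun ω => g n (Y ω) - Φ (Y ω) := by
    ext ω; simp
  have hm : AEStronglyMeasurable (fun ω => g n (Y ω) - Φ (Y ω)) P :=
    (hgm n).sub (h3.continuous.comp_aestronglyMeasurable hY)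
  have hb : eLpNorm (fun ω => g n (Y ω) - Φ (Y ω)) 2 P ≤ ENNReal.ofReal δ' := by
    refine (eLpNorm_le_of_ae_bound (C := δ') (ae_of_all _ fun ω => h4 (Y ω))).trans_eq ?_
    simp
  rw [e]
  refine (eLpNorm_add_le (hfY.1.sub (hgm n)) hm (by norm_num)).trans ?_
  exact (add_le_add hn (hb.trans hδ')).trans_eq (ENNReal.add_halves δ)

end Mollification

/-! ### Derivative bounds for functionals of Wiener integrals -/

section SmoothVectors

variable {Ω : Type*} [MeasurableSpace Ω] {P : Measure Ω} {m d k : ℕ} {W : ℝ≥0 → Ω → E d} {T : ℝ}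

/-- Smooth compactly supported functionals of Wiener integrals are smooth random variables, and their
derivatives are controlled by the Lipschitz constant. -/
lemma exists_isSmoothWithDeriv {Φ : (Fin k → E m) → E m} {Λ : ℝ≥0}
    (hΦ : ContDiff ℝ ((⊤ : ℕ∞) : WithTop ℕ∞) Φ) (hc : HasCompactSupport Φ) (hL : LipschitzWith Λ Φ)
    {h : Fin k → Fin m → ℝ → E d} {y : Fin k → Fin m → Ω → ℝ}
    (hy : ∀ l i, IsWienerIntegral W P T (h l i) (y l i)) :
    ∃ (η : Fin m → Ω → ℝ) (D : Fin m → ℝ → Ω → E d), (∀ i, IsSmoothWithDeriv W P T (η i) (D i)) ∧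
      (∀ i ω, η i ω = Φ (fun l => WithLp.toLp 2 (fun i => y l i ω)) i) ∧
      ∀ (r : ℝ) (s : Fin d → ℝ), (∀ j, 0 ≤ s j) →
        (∀ l j, ‖(WithLp.toLp 2 (fun i => h l i r j) : E m)‖ ≤ s j) →
        ∀ ω, ∑ i, ‖D i r ω‖ ^ 2 ≤ (Λ * ∑ j, s j) ^ 2 := by
  let e : Fin k × Fin m ≃ Fin (k * m) := finProdFinEquiv
  let A : (Fin (k * m) → ℝ) →L[ℝ] (Fin k → E m) := LinearMap.toContinuousLinearMap
    { toFun := fun z l => WithLp.toLp 2 (fun i => z (e (l, i)))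
      map_add' := fun _ _ => rfl
      map_smul' := fun _ _ => rfl }
  have hAapply : ∀ z l, A z l = WithLp.toLp 2 (fun i => z (e (l, i))) := fun z l => rfl
  let π : Fin m → E m →L[ℝ] ℝ := fun i => EuclideanSpace.proj i
  let φ : Fin m → (Fin (k * m) → ℝ) → ℝ := fun i => (π i ∘ Φ) ∘ A
  let w : Fin (k * m) → Ω → ℝ := fun a => y (e.symm a).1 (e.symm a).2
  let g : Fin (k * m) → ℝ → E d := fun a => h (e.symm a).1 (e.symm a).2
  have hAw : ∀ ω, A (fun a => w a ω) = fun l => WithLp.toLp 2 (fun i => y l i ω) := fun ω => by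
    ext1 l; rw [hAapply]; simp [w]
  have hφ : ∀ i, HasBoundedDerivs (φ i) := fun i =>
    (hasBoundedDerivs_of_hasCompactSupport ((π i).contDiff.comp hΦ)
      (hc.comp_left (map_zero (π i)))).comp_clm A
  have hfd : ∀ i z v, fderiv ℝ (φ i) z v = (fderiv ℝ Φ (A z) (A v)) i := by
    intro i z v
    have h1 : HasFDerivAt (φ i) (((π i).comp (fderiv ℝ Φ (A z))).comp A) z :=
      ((π i).hasFDerivAt.comp (A z) ((hΦ.differentiable (by simp)) (A z)).hasFDerivAt).comp z
        A.hasFDerivAt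
    rw [h1.fderiv]
    rfl
  refine ⟨fun i ω => φ i (fun a => w a ω),
    fun i r ω => ∑ a, fderiv ℝ (φ i) (fun a' => w a' ω) (Pi.single a 1) • g a r,
    fun i => ⟨k * m, φ i, g, w, hφ i, fun a => hy _ _, fun _ => rfl, fun _ _ => rfl⟩,
    fun i ω => ?_, fun r s hs0 hs ω => ?_⟩
  · simp only [φ, Function.comp, hAw]
    rfl
  · set z : Fin (k * m) → ℝ := fun a => w a ω with hz
    -- In noise direction j the derivative is DΦ applied to the j-th columns of the integrands. The
    -- maximum norm over l bounds these by `s j`, so the number of grid points does not enter.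
    have hcoord : ∀ i j, (∑ a, fderiv ℝ (φ i) z (Pi.single a 1) • g a r) j =
        (fderiv ℝ Φ (A z) (A fun a => g a r j)) i := by
      intro i j
      rw [← hfd]
      have h1 : (fun a => g a r j) = ∑ a, g a r j • (Pi.single a 1 : Fin (k * m) → ℝ) := by
        ext a
        simp [Finset.sum_apply, Pi.single_apply]
      rw [h1, map_sum]
      simp [mul_comm]
    have hAg : ∀ j, ‖A fun a => g a r j‖ ≤ s j := fun j => by
      refine (pi_norm_le_iff_of_nonneg (hs0 j)).2 fun l => ?_
      rw [hAapply]
      simpa [g] using hs l j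
    have hnorm : ‖fderiv ℝ Φ (A z)‖ ≤ Λ := norm_fderiv_le_of_lipschitz ℝ hL
    calc ∑ i, ‖∑ a, fderiv ℝ (φ i) z (Pi.single a 1) • g a r‖ ^ 2
        = ∑ i, ∑ j, ((fderiv ℝ Φ (A z) (A fun a => g a r j)) i) ^ 2 := by
          refine Finset.sum_congr rfl fun i _ => ?_
          rw [EuclideanSpace.norm_sq_eq]
          refine Finset.sum_congr rfl fun j _ => ?_
          rw [hcoord, Real.norm_eq_abs, sq_abs]
      _ = ∑ j, ‖fderiv ℝ Φ (A z) (A fun a => g a r j)‖ ^ 2 := by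
          rw [Finset.sum_comm]
          refine Finset.sum_congr rfl fun j _ => ?_
          rw [EuclideanSpace.norm_sq_eq]
          simp
      _ ≤ ∑ j, (Λ * s j) ^ 2 := by
          refine Finset.sum_le_sum fun j _ => pow_le_pow_left₀ (norm_nonneg _) ?_ 2
          exact ((fderiv ℝ Φ (A z)).le_opNorm _).trans
            (mul_le_mul hnorm (hAg j) (norm_nonneg _) Λ.coe_nonneg)
      _ ≤ (∑ j, Λ * s j) ^ 2 :=
          Finset.sum_sq_le_sq_sum_of_nonneg fun j _ => mul_nonneg Λ.coe_nonneg (hs0 j)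
      _ = _ := by rw [← Finset.mul_sum]

end SmoothVectors

/-! ### The bound on the Malliavin derivative -/

section MalliavinBound

variable {Ω : Type*} [MeasurableSpace Ω] {P : Measure Ω} [IsProbabilityMeasure P] {m d : ℕ}
  {W : ℝ≥0 → Ω → E d} {T L C : ℝ} {b : ℝ → E m → E m} {σ : ℝ → Matrix (Fin m) (Fin d) ℝ}
  {Z : ℝ → Ω → E m}

lemma norm_interpolation_le (t s : ℝ) {n : ℕ} (y : Fin (n + 1) → E m) (r : ℝ) :
    ‖interpolation t s y r‖ ≤ ‖y‖ := by
  have := norm_interpolation_sub_le t s y 0 r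
  simpa [interpolation] using this

/-- X_s is an L² limit of grid solutions, each smoothed with Lipschitz constant 2e^{LT} + 1. The
remaining factor L bounds the sum of the column norms of σ; truncating the integrands to (t,
gridPoint] only decreases it. -/
theorem IsSolution.exists_hasMalliavinDeriv (hW : IsBrownianMotion W P)
    (hA : CoeffAssumption T L b σ) (hZ : IsNoiseProcess W P T σ C Z) {ε t : ℝ}
    (hε : ε ∈ Icc (0 : ℝ) 1) (ht : t ∈ Ico 0 T) {x : E m} {X : ℝ → Ω → E m}
    (hX : IsSolution W P T b σ ε t x X) {s : ℝ} (hs : s ∈ Icc 0 T) :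
    ∃ D : Fin m → ℝ → Ω → E d, (∀ i, HasMalliavinDeriv W P T (fun ω => X s ω i) (D i)) ∧
      ∀ᵐ p ∂((volume.restrict (Icc 0 T)).prod P),
        ∑ i, ‖D i p.1 p.2‖ ^ 2 ≤ ((2 * Real.exp (L * T) + 1) * L) ^ 2 := by
  have hL := hA.L_pos
  have hK : 0 ≤ (2 * Real.exp (L * T) + 1) * L := by positivity
  have hXfin : eLpNorm (X s) 2 P < ∞ := by
    rw [eLpNorm_two_eq, ENNReal.rpow_lt_top_iff_of_pos (by norm_num)]
    refine lt_of_le_of_lt (lintegral_mono fun ω => ?_) hX.memS2.sup_lt_top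
    exact le_iSup₂ (f := fun s (_ : s ∈ Icc 0 T) => ‖X s ω‖ₑ ^ 2) s hs
  rcases le_or_gt s t with hst | hst
  · have hconst : X s =ᵐ[P] fun _ => x := by
      filter_upwards [hX.before] with ω hω using hω s ⟨hs.1, hst⟩
    refine exists_hasMalliavinDeriv_of_approx
      ⟨aestronglyMeasurable_const.congr hconst.symm, hXfin⟩ hK fun δ _ =>
      ⟨fun i _ => x i, fun _ _ _ => 0, fun i => isSmoothWithDeriv_const _, ?_, ?_⟩
    · refine ae_of_all _ fun p => ?_
      simp; positivity
    · have h0 : (fun ω => X s ω - WithLp.toLp 2 (fun i => x i)) =ᵐ[P] fun _ => (0 : E m) := by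
        filter_upwards [hconst] with ω hω
        rw [hω]; exact sub_self x
      rw [eLpNorm_congr_ae h0]
      simp
  · have hint := hZ.integral t ⟨ht.1, ht.2.le⟩
    set M : ℝ → Ω → E m := fun r ω => Z r ω - Z t ω with hM
    have hgrid : ∀ (n : ℕ) (l : Fin (n + 1)), gridPoint t s l ∈ Icc t s := fun n l =>
      gridPoint_mem hst.le l
    let Y : ∀ n : ℕ, Ω → Fin (n + 1) → E m := fun n ω l => M (gridPoint t s l) ω
    have hMint : ∀ n (l : Fin (n + 1)) i, IsWienerIntegral W P T
        ((Ioc t (gridPoint t s l)).indicator fun r => WithLp.toLp 2 (σ r i))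
        (fun ω => M (gridPoint t s l) ω i) := fun n l i =>
      hint.integral _ ⟨(hgrid n l).1, (hgrid n l).2.trans hs.2⟩ i
    have hYm : ∀ n, AEStronglyMeasurable (Y n) P := fun n => by
      refine (aemeasurable_pi_lambda _ fun l => ?_).aestronglyMeasurable
      have h1 : AEMeasurable (fun ω i => M (gridPoint t s l) ω i) P :=
        aemeasurable_pi_lambda _ fun i => (hMint n l i).memLp_integral.1.aemeasurable
      exact (WithLp.measurable_toLp 2 _).comp_aemeasurable h1
    let Λ : ℝ≥0 := ⟨Real.exp (L * T), (Real.exp_pos _).le⟩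
    have hlip : ∀ n, LipschitzWith Λ fun y : Fin (n + 1) → E m => gridSolution b t s x ε y :=
      fun n => LipschitzWith.of_dist_le_mul fun y y' => by
        rw [dist_eq_norm, dist_eq_norm]
        exact norm_gridSolution_sub_le hA ht.1 hst.le hs.2 x hε y y'
    let U : ∀ n : ℕ, Ω → E m := fun n ω => gridSolution b t s x ε (Y n ω)
    have hUm : ∀ n, AEStronglyMeasurable (U n) P := fun n =>
      (hlip n).continuous.comp_aestronglyMeasurable (hYm n)
    have hsol := hX.ae_isPathSolution hW hZ ht
    have hlim : ∀ᵐ ω ∂P, Tendsto (fun n => U n ω) atTop (𝓝 (X s ω)) := by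
      filter_upwards [hsol, hint.continuous_paths] with ω h1 h2
      exact tendsto_gridSolution hA ht.1 hst hs.2 x hε (f := fun r => M r ω)
        (h2.mono (Icc_subset_Icc_right hs.2)) (h1.mono hs.2)
    have hXm : AEStronglyMeasurable (X s) P := aestronglyMeasurable_of_tendsto_ae atTop hUm hlim
    have hXL : MemLp (X s) 2 P := ⟨hXm, hXfin⟩
    obtain ⟨g, hgm, hg0, hg, hgle⟩ := hZ.exists_bound ht.1 hst.le hs.2
    let G : Ω → ℝ := fun ω => 2 * √(g ω) * Real.exp (L * T)
    have hG : MemLp G 2 P := by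
      have h1 : MemLp (fun ω => √(g ω)) 2 P := by
        refine ⟨(Real.continuous_sqrt.measurable.comp_aemeasurable hgm).aestronglyMeasurable, ?_⟩
        rw [eLpNorm_two_eq, ENNReal.rpow_lt_top_iff_of_pos (by norm_num)]
        refine lt_of_le_of_lt (le_of_eq (lintegral_congr fun ω => ?_))
          (hgle.trans_lt ENNReal.ofReal_lt_top)
        rw [← ofReal_norm, ← ENNReal.ofReal_pow (norm_nonneg _), Real.norm_eq_abs, sq_abs,
          Real.sq_sqrt (hg0 ω)]
      exact (h1.const_mul 2).mul_const _
    have hdom : ∀ n, ∀ᵐ ω ∂P, ‖X s ω - U n ω‖ ≤ G ω := fun n => by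
      filter_upwards [hsol, hg] with ω h1 h2
      have h2' : ∀ r ∈ Icc t s, ‖M r ω‖ ≤ √(g ω) := fun r hr => Real.le_sqrt_of_sq_le (h2 r hr)
      refine norm_sub_gridSolution_le hA ht.1 hst.le hs.2 x hε (f := fun r => M r ω)
        (h1.mono hs.2) fun r hr => ?_
      refine (norm_sub_le _ _).trans ?_
      have h3 : ‖Y n ω‖ ≤ √(g ω) :=
        (pi_norm_le_iff_of_nonneg (Real.sqrt_nonneg _)).2 fun l => h2' _ (hgrid n l)
      have h4 := norm_interpolation_le t s (Y n ω) r
      have h5 := h2' r hr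
      simp only [Y] at h4 h3
      linarith
    have hconv := tendsto_eLpNorm_sub_of_dominated hUm hXm hG hdom hlim
    refine exists_hasMalliavinDeriv_of_approx hXL hK fun δ hδ => ?_
    have hδ2 : 0 < δ / 2 := ENNReal.div_pos hδ.ne' (by simp)
    obtain ⟨n, hn⟩ := (hconv.eventually (ge_mem_nhds hδ2)).exists
    have hUL : MemLp (U n) 2 P := by
      have h1 : MemLp (fun ω => X s ω - U n ω) 2 P := by
        refine hG.mono (hXm.sub (hUm n)) ?_
        filter_upwards [hdom n] with ω hω using hω.trans (le_abs_self _)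
      have h2 := hXL.sub h1
      have h3 : X s - (fun ω => X s ω - U n ω) = U n := by ext1 ω; simp
      rwa [h3] at h2
    obtain ⟨Φ, hΦ, hΦc, hΦL, hΦe⟩ := exists_smooth_approx_comp (volume : Measure (Fin (n + 1) → E m))
      (hlip n) (hYm n) hUL hδ2
    obtain ⟨η, D, h1, h2, h3⟩ := exists_isSmoothWithDeriv hΦ hΦc hΦL (hMint n)
    refine ⟨η, D, h1, ?_, ?_⟩
    · have hmem : ∀ᵐ p ∂((volume.restrict (Icc 0 T)).prod P), p.1 ∈ Icc 0 T :=
        Measure.quasiMeasurePreserving_fst.ae (ae_restrict_mem measurableSet_Icc)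
      filter_upwards [hmem] with p hp
      refine (h3 p.1 (fun j => ‖(WithLp.toLp 2 (fun i => σ p.1 i j) : E m)‖)
        (fun j => norm_nonneg _) (fun l j => ?_) p.2).trans ?_
      · by_cases hr : p.1 ∈ Ioc t (gridPoint t s l)
        · simp [indicator_of_mem hr]
        · simp only [indicator_of_notMem hr]
          exact le_of_eq_of_le (norm_eq_zero.2 rfl) (norm_nonneg _)
      · have h4 : ∑ j, ‖(WithLp.toLp 2 (fun i => σ p.1 i j) : E m)‖ ≤ L :=
          (le_add_of_nonneg_left (norm_nonneg _)).trans (hA.bound p.1 hp 0)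
        refine pow_le_pow_left₀ (by positivity) ?_ 2
        push_cast
        exact mul_le_mul_of_nonneg_left h4 (by positivity)
    · have h5 : (fun ω => X s ω - WithLp.toLp 2 (fun i => η i ω)) =
          (fun ω => X s ω - U n ω) + fun ω => U n ω - Φ (Y n ω) := by
        ext1 ω
        have : WithLp.toLp 2 (fun i => η i ω) = Φ (Y n ω) := by
          ext i; exact h2 i ω
        rw [this]
        simp
      rw [h5]
      refine (eLpNorm_add_le (hXm.sub (hUm n)) ((hUm n).sub
        (hΦL.continuous.comp_aestronglyMeasurable (hYm n))) (by norm_num)).trans ?_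
      exact (add_le_add hn hΦe).trans_eq (ENNReal.add_halves δ)

end MalliavinBound

end SmallNoise

end

/-! ### Assembly of the three statements from one noise process -/

theorem mainTheorem9 {Ω : Type*} [MeasurableSpace Ω] (P : MeasureTheory.Measure Ω)
    [MeasureTheory.IsProbabilityMeasure P] [P.IsComplete] {m d : ℕ}
    (W : ℝ≥0 → Ω → SmallNoise.E d) (hW : SmallNoise.IsBrownianMotion W P)
    (T L : ℝ) (hT : 0 < T)
    (b : ℝ → SmallNoise.E m → SmallNoise.E m) (σ : ℝ → Matrix (Fin m) (Fin d) ℝ)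
    (hA : SmallNoise.CoeffAssumption T L b σ) :
    -- existence and uniqueness (up to indistinguishability)
    (∀ ε ∈ Set.Icc (0 : ℝ) 1, ∀ t ∈ Set.Ico 0 T, ∀ x : SmallNoise.E m,
      ∃ X : ℝ → Ω → SmallNoise.E m, SmallNoise.IsSolution W P T b σ ε t x X ∧
        ∀ Y : ℝ → Ω → SmallNoise.E m, SmallNoise.IsSolution W P T b σ ε t x Y →
          ∀ᵐ ω ∂P, ∀ s ∈ Set.Icc 0 T, Y s ω = X s ω) ∧
    -- the Malliavin derivative exists and is bounded, uniformly in all parameters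
    (∃ K : ℝ, 0 < K ∧ ∀ ε ∈ Set.Icc (0 : ℝ) 1, ∀ t ∈ Set.Ico 0 T, ∀ x : SmallNoise.E m,
      ∀ X : ℝ → Ω → SmallNoise.E m, SmallNoise.IsSolution W P T b σ ε t x X →
        ∀ s ∈ Set.Icc 0 T, ∃ D : Fin m → ℝ → Ω → SmallNoise.E d,
          (∀ i, SmallNoise.HasMalliavinDeriv W P T (fun ω => X s ω i) (D i)) ∧
          ∀ᵐ p ∂((MeasureTheory.volume.restrict (Set.Icc 0 T)).prod P),
            ∑ i, ‖D i p.1 p.2‖ ^ 2 ≤ K ^ 2) ∧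
    -- the stability estimate
    (∃ C : ℝ, 0 < C ∧ ∀ ε ∈ Set.Icc (0 : ℝ) 1, ∀ ε' ∈ Set.Icc (0 : ℝ) 1,
      ∀ t ∈ Set.Ico 0 T, ∀ t' ∈ Set.Ico 0 T, ∀ x x' : SmallNoise.E m,
      ∀ X X' : ℝ → Ω → SmallNoise.E m, SmallNoise.IsSolution W P T b σ ε t x X →
        SmallNoise.IsSolution W P T b σ ε' t' x' X' →
        ∫⁻ ω, ⨆ s ∈ Set.Icc 0 T, ‖X s ω - X' s ω‖ₑ ^ 2 ∂P ≤
          ENNReal.ofReal (C * (|t - t'| + |ε - ε'| ^ 2 + ‖x - x'‖ ^ 2))) := by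
  obtain ⟨Z, hZ⟩ := SmallNoise.exists_noiseProcess hW hT.le hA
  have hL := hA.L_pos
  refine ⟨fun ε hε t ht x => ?_, ⟨(2 * Real.exp (L * T) + 1) * L, by positivity,
    fun ε hε t ht x X hX s hs => hX.exists_hasMalliavinDeriv hW hA hZ hε ht hs⟩,
    ⟨4 * Real.exp (L * T) ^ 2 * (1 + L ^ 2 * T + m * (4 * d * L ^ 2) + m * (4 * d * L ^ 2) * T),
      by positivity, fun ε hε ε' hε' t ht t' ht' x x' X X' hX hX' =>
        SmallNoise.stability hW hA (by positivity) hZ hε hε' ht ht' hX hX'⟩⟩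
  obtain ⟨X, hX⟩ := SmallNoise.exists_isSolution hA hZ hε ht x
  exact ⟨X, hX, fun Y hY => SmallNoise.IsSolution.ae_eq hW hA hZ ht hX hY⟩
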